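/- Let $T$ be Thompson's group, realized as the group of bijections of $[0,1)$ given by pairs of trees $(R,S,n)$: $R,S$ are full binary trees with the same number $m$ of leaves, $1\le n\le m$, the first leaf of $R$ is identified with the $n$-th leaf of $S$ and the other leaves are identified cyclically, and the function maps the standard dyadic interval of each leaf of $R$ affinely onto that of the leaf of $S$ identified with it. Each $g\in T$ has a unique reduced pair of trees (one in which no caret of $R$ has its left and right leaves identified with the left and right leaves of one caret of $S$). The Thompson graph of a full binary tree has one vertex directly to the left of each leaf, and for every left edge of the tree an edge joining the two vertices that can be connected by a curve above the leaves crossing the tree only in that left edge; the Thompson graph of $g\in T$ is obtained from the Thompson graphs of the trees $R,S$ of its reduced pair by identifying their vertices in the same way as the leaves. Let $\vec T$ be the set of $g\in T$ whose Thompson graph is bipartite. The diagram of $g\in T$ is the directed graph obtained from its reduced pair of trees by directing the edges away from the roots, labelling left edges $0$ and right edges $1$, and identifying the leaves. For a finite set $Y\subset T$, the (Stallings 2-)core of $Y$ is obtained from the disjoint union of the diagrams of the elements of $Y$ by identifying all roots, and then repeatedly (1) identifying the left children (and left edges) and the right children (and right edges) of identified vertices and (2) identifying vertices whose left children and whose right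 children are identified. The core accepts $g\in T$ if there is a homomorphism of labelled directed graphs from the diagram of $g$ to the core that sends the roots to the root. For a semigroup presentation $\mathcal P$ and a word $u$, let $\mathcal D^a(\mathcal P,u)$ be the annular diagram group: annular diagrams over $\mathcal P$ with outer and inner path both labelled $u$ (read from the outer and inner vertex), up to insertion and removal of dipoles, multiplied by identifying the inner path of the first with the outer path of the second. Then $\vec T$ is a finitely generated subgroup of $T$; for every finite generating set $Y$ of $\vec T$, the set $C(\vec T)$ of elements of $T$ accepted by the core of $Y$ is exactly $\vec T$; and $\vec T$ is isomorphic to the annular diagram group $\mathcal D^a(\langle e,f\mid e=ff,\ f=fe\rangle,e)$. -/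

import Mathlib

/-- Full binary trees: every vertex has either no child or a left and a right child. -/
inductive BinTree where
  | leaf : BinTree
  | node (l r : BinTree) : BinTree

namespace BinTree

/-- The leaves of a tree from left to right.  A vertex is recorded by the label of the path from the
root to it, where left edges are labelled `false` (digit 0) and right edges `true` (digit 1). -/
def leaves : BinTree → List (List Bool)
  | leaf => [[]]
  | node l r => l.leaves.map (fun w => false :: w) ++ r.leaves.map (fun w => true :: w)

/-- `w` is (the address of) a vertex of `t`: an initial segment of the address of a leaf. -/
def IsVertex (t : BinTree) (w : List Bool) : Prop := ∃ u ∈ t.leaves, w <+: u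

/-- The edges of the Thompson graph of a tree.  The vertex of the graph directly to the left of the
leaf `a` is recorded by `a`.  The left edge from `w` to its left child separates exactly two regions:
the one to the left of the subtree below the left child of `w`, whose vertex stands directly to the
left of the leftmost leaf `w 0 0 ⋯ 0` of that subtree, and the one between the two subtrees below
`w`, whose vertex stands directly to the left of the leftmost leaf `w 1 0 ⋯ 0` of the right one. -/
def ThompsonAdj (t : BinTree) (a b : List Bool) : Prop :=
  a ∈ t.leaves ∧ b ∈ t.leaves ∧ ∃ (w : List Bool) (k l : ℕ),
    a = w ++ false :: List.replicate k false ∧ b = w ++ true :: List.replicate l false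

end BinTree

/-- The binary fraction `0.w`, the left end of the dyadic interval of the vertex `w`; this interval is
`[binVal w, binVal w + (1/2)^|w|)`. -/
noncomputable def binVal : List Bool → ℝ
  | [] => 0
  | b :: w => ((if b then 1 else 0) + binVal w) / 2

/-- A pair of trees `(R, S, n)` with the same number `m` of leaves and `1 ≤ n ≤ m`.
Here `shift = n - 1`, so leaves are counted from `0`. -/
structure TreeDiagram where
  input : BinTree
  output : BinTree
  shift : ℕ
  length_eq : output.leaves.length = input.leaves.length
  shift_lt : shift < input.leaves.length

namespace TreeDiagram

variable (d : TreeDiagram)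

/-- The `i`-th leaf of the input tree. -/
def inLeaf (i : Fin d.input.leaves.length) : List Bool := d.input.leaves[i]

/-- The leaf of the output tree that is identified with the `i`-th leaf of the input tree. -/
def outLeaf (i : Fin d.input.leaves.length) : List Bool :=
  d.output.leaves[((i : ℕ) + d.shift) % d.input.leaves.length]'(by
    rw [d.length_eq]; exact Nat.mod_lt _ (Nat.zero_lt_of_lt d.shift_lt))

/-- The leaf `u` of the input tree is identified with the leaf `v` of the output tree. -/
def Matched (u v : List Bool) : Prop := ∃ i, d.inLeaf i = u ∧ d.outLeaf i = v

/-- `f` is the function on `[0,1)` given by the tree diagram: it maps the interval of every leaf of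
the input tree affinely, and increasingly, onto the interval of the leaf identified with it. -/
def Represents (f : Equiv.Perm (Set.Ico (0 : ℝ) 1)) : Prop :=
  ∀ u v, d.Matched u v → ∀ x : Set.Ico (0 : ℝ) 1,
    binVal u ≤ (x : ℝ) → (x : ℝ) < binVal u + (1 / 2) ^ u.length →
      (f x : ℝ) = binVal v + ((x : ℝ) - binVal u) * (2 ^ u.length / 2 ^ v.length)

/-- No dipole can be removed: there are no two carets, one in each tree, whose left leaves are
identified with each other and whose right leaves are identified with each other. -/
def Reduced : Prop :=
  ¬ ∃ u v, d.Matched (u ++ [false]) (v ++ [false]) ∧ d.Matched (u ++ [true]) (v ++ [true])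

/-- The Thompson graph of a tree diagram: the Thompson graphs of the two trees, with their vertices
identified in the same way as the leaves. -/
def thompsonGraph : SimpleGraph (Fin d.input.leaves.length) :=
  SimpleGraph.fromRel fun i j =>
    d.input.ThompsonAdj (d.inLeaf i) (d.inLeaf j) ∨
      d.output.ThompsonAdj (d.outLeaf i) (d.outLeaf j)

/-- The input tree (`false`) and the output tree (`true`). -/
def tree : Bool → BinTree
  | false => d.input
  | true => d.output

/-- The vertices of the two trees, before the leaves are identified. -/
structure PreVertex where
  side : Bool
  addr : List Bool
  isVertex : (d.tree side).IsVertex addr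

/-- The vertices of the directed graph of `d`: vertices of the two trees, leaves identified. -/
def Vertex : Type :=
  Quot fun p q : d.PreVertex => p.side = false ∧ q.side = true ∧ d.Matched p.addr q.addr

end TreeDiagram

/-- The Thompson group `T`: the group of bijections of `[0,1)` generated by (in fact equal to the set
of) the functions given by pairs of trees.  Products are compositions from right to left. -/
def ThompsonT : Subgroup (Equiv.Perm (Set.Ico (0 : ℝ) 1)) :=
  Subgroup.closure {f | ∃ d : TreeDiagram, d.Represents f}

/-- The elements of `T` whose Thompson graph, i.e. that of the reduced tree diagram, is bipartite. -/
def jonesSet : Set ThompsonT :=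
  {g | ∃ d : TreeDiagram, d.Reduced ∧ d.Represents g ∧ d.thompsonGraph.IsBipartite}

/-- Directed graphs with edges labelled `false` (left) or `true` (right) and some vertices marked as
roots; `edge b x y` says that there is an edge from `x` to `y` with label `b`. -/
structure LabeledDigraph (V : Type*) where
  edge : Bool → V → V → Prop
  root : V → Prop

namespace LabeledDigraph

/-- Disjoint union. -/
def sigma {ι : Type*} {V : ι → Type*} (G : ∀ i, LabeledDigraph (V i)) :
    LabeledDigraph (Σ i, V i) where
  edge b x y := ∃ i, ∃ x' y' : V i, x = ⟨i, x'⟩ ∧ y = ⟨i, y'⟩ ∧ (G i).edge b x' y'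
  root x := (G x.1).root x.2

/-- The identifications of vertices: all roots are identified; children of identified vertices along
edges with the same label are identified; vertices whose left children and whose right children are
identified are identified. -/
inductive FoldRel {V : Type*} (G : LabeledDigraph V) : V → V → Prop
  | refl (x) : FoldRel G x x
  | symm {x y} : FoldRel G x y → FoldRel G y x
  | trans {x y z} : FoldRel G x y → FoldRel G y z → FoldRel G x z
  | root {x y} : G.root x → G.root y → FoldRel G x y
  | child {b x y x' y'} : FoldRel G x y → G.edge b x x' → G.edge b y y' → FoldRel G x' y'
  | parent {x xl xr y yl yr} : G.edge false x xl → G.edge true x xr →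
      G.edge false y yl → G.edge true y yr →
      FoldRel G xl yl → FoldRel G xr yr → FoldRel G x y

/-- The graph obtained from `G` by carrying out all identifications. -/
def folded {V : Type*} (G : LabeledDigraph V) : LabeledDigraph (Quot G.FoldRel) where
  edge b x y := ∃ x' y', x = Quot.mk _ x' ∧ y = Quot.mk _ y' ∧ G.edge b x' y'
  root x := ∃ x', x = Quot.mk _ x' ∧ G.root x'

/-- Homomorphisms of labelled directed graphs that send roots to roots. -/
def IsHom {V W : Type*} (G : LabeledDigraph V) (K : LabeledDigraph W) (φ : V → W) : Prop :=
  (∀ b x y, G.edge b x y → K.edge b (φ x) (φ y)) ∧ ∀ x, G.root x → K.root (φ x)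

end LabeledDigraph

/-- The labelled directed graph of a tree diagram, with the edges directed away from the roots of
the two trees. -/
def TreeDiagram.graph (d : TreeDiagram) : LabeledDigraph d.Vertex where
  edge b x y := ∃ p q : d.PreVertex, x = Quot.mk _ p ∧ y = Quot.mk _ q ∧
    q.side = p.side ∧ q.addr = p.addr ++ [b]
  root x := ∃ p : d.PreVertex, x = Quot.mk _ p ∧ p.addr = []

/-- The reduced tree diagrams of the elements of `X`. -/
def reducedDiagrams (X : Set ThompsonT) : Set TreeDiagram :=
  {d | d.Reduced ∧ ∃ g ∈ X, d.Represents g}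

/-- The disjoint union of the graphs of the reduced diagrams of the elements of `X`. -/
def generatorGraph (X : Set ThompsonT) :
    LabeledDigraph (Σ d : reducedDiagrams X, d.1.Vertex) :=
  LabeledDigraph.sigma fun d : reducedDiagrams X => d.1.graph

/-- The Stallings 2-core constructed from a set `X` of generators. -/
def stallingsCore (X : Set ThompsonT) : LabeledDigraph (Quot (generatorGraph X).FoldRel) :=
  (generatorGraph X).folded

/-- The elements of `T` accepted by the core constructed from the generators `X`. -/
def coreAccepted (X : Set ThompsonT) : Set ThompsonT :=
  {g | ∃ d : TreeDiagram, d.Reduced ∧ d.Represents g ∧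
    ∃ φ : d.Vertex → Quot (generatorGraph X).FoldRel, d.graph.IsHom (stallingsCore X) φ}

/-- Semigroup presentations: an alphabet `X` and a set of relations between nonempty words. -/
structure SemigroupPresentation (X : Type*) where
  rel : List X → List X → Prop
  left_ne_nil : ∀ r s, rel r s → r ≠ []
  right_ne_nil : ∀ r s, rel r s → s ≠ []

section Annular

variable {X : Type*}

/-- Annular diagrams over `P` with outer path labelled `u` and inner path labelled `v`, drawn as
composites of elementary ones.  The words `u` and `v` are read around the annulus, beginning at the
outer and at the inner vertex.
* `id u`: the diagram without cells, with equal inner and outer vertex;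
* `cell`: a diagram with a single cell, with outer path `r` and inner path `s`;
* `rot`: no cells; outer and inner path are the same closed path, the inner vertex being reached
  from the outer vertex along the initial segment `p`;
* `comp`: the inner path of the first diagram is identified with the outer path of the second. -/
inductive AnnularDiagram (P : SemigroupPresentation X) : List X → List X → Type _
  | id (u : List X) : AnnularDiagram P u u
  | cell {u v : List X} (p r s q : List X) (h : P.rel r s ∨ P.rel s r)
      (hu : u = p ++ r ++ q) (hv : v = p ++ s ++ q) : AnnularDiagram P u v
  | rot {u v : List X} (p q : List X) (hu : u = p ++ q) (hv : v = q ++ p) : AnnularDiagram P u v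
  | comp {u v w : List X} (a : AnnularDiagram P u v) (b : AnnularDiagram P v w) :
      AnnularDiagram P u w

namespace AnnularDiagram

variable {P : SemigroupPresentation X}

/-- Two annular diagrams are equivalent if they become equal after inserting and removing dipoles.
The constructors `assoc` to `rot_cell` say when two drawings show the same diagram: cells that occupy
disjoint segments can be drawn in either order, moving the vertex around the annulus in two steps or
in one gives the same, moving it once around gives nothing, and it does not matter whether it is
moved before or after drawing a cell.  The constructor `dipole` removes a dipole. -/
inductive Equivalent : ∀ {u v : List X}, AnnularDiagram P u v → AnnularDiagram P u v → Prop
  | refl {u v} (a : AnnularDiagram P u v) : Equivalent a a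
  | symm {u v} {a b : AnnularDiagram P u v} : Equivalent a b → Equivalent b a
  | trans {u v} {a b c : AnnularDiagram P u v} : Equivalent a b → Equivalent b c → Equivalent a c
  | congr {u v w} {a a' : AnnularDiagram P u v} {b b' : AnnularDiagram P v w} :
      Equivalent a a' → Equivalent b b' → Equivalent (comp a b) (comp a' b')
  | assoc {u v w z} (a : AnnularDiagram P u v) (b : AnnularDiagram P v w)
      (c : AnnularDiagram P w z) : Equivalent (comp (comp a b) c) (comp a (comp b c))
  | id_comp {u v} (a : AnnularDiagram P u v) : Equivalent (comp (id u) a) a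
  | comp_id {u v} (a : AnnularDiagram P u v) : Equivalent (comp a (id v)) a
  | interchange {u v v' w} (p r s q r' s' t : List X)
      (h : P.rel r s ∨ P.rel s r) (h' : P.rel r' s' ∨ P.rel s' r')
      (hu : u = p ++ r ++ q ++ r' ++ t) (hv : v = p ++ s ++ q ++ r' ++ t)
      (hv' : v' = p ++ r ++ q ++ s' ++ t) (hw : w = p ++ s ++ q ++ s' ++ t) :
      Equivalent
        (comp (cell (u := u) (v := v) p r s (q ++ r' ++ t) h (by simp [hu]) (by simp [hv]))
          (cell (v := w) (p ++ s ++ q) r' s' t h' hv hw))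
        (comp (cell (u := u) (v := v') (p ++ r ++ q) r' s' t h' hu hv')
          (cell (v := w) p r s (q ++ s' ++ t) h (by simp [hv']) (by simp [hw])))
  | rot_nil (u : List X) : Equivalent (rot u [] (by simp) (by simp)) (id u)
  | rot_rot {u v w} (p q t : List X) (hu : u = p ++ q ++ t) (hv : v = q ++ t ++ p)
      (hw : w = t ++ (p ++ q)) :
      Equivalent
        (comp (rot (u := u) (v := v) p (q ++ t) (by simp [hu]) hv)
          (rot (v := w) q (t ++ p) (by simp [hv]) (by simp [hw])))
        (rot (p ++ q) t hu hw)
  | rot_cell {u v v' w} (p r s q t : List X) (h : P.rel r s ∨ P.rel s r)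
      (hu : u = p ++ r ++ q ++ t) (hv : v = p ++ s ++ q ++ t)
      (hv' : v' = t ++ (p ++ r ++ q)) (hw : w = t ++ (p ++ s ++ q)) :
      Equivalent
        (comp (cell (u := u) (v := v) p r s (q ++ t) h (by simp [hu]) (by simp [hv]))
          (rot (v := w) (p ++ s ++ q) t hv hw))
        (comp (rot (u := u) (v := v') (p ++ r ++ q) t hu hv')
          (cell (v := w) (t ++ p) r s q h (by simp [hv']) (by simp [hw])))
  | dipole {u v} (p r s q : List X) (h : P.rel r s ∨ P.rel s r)
      (hu : u = p ++ r ++ q) (hv : v = p ++ s ++ q) :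
      Equivalent (comp (cell p r s q h hu hv) (cell p s r q h.symm hv hu)) (id u)

/-- The mirror image of a diagram, with inner and outer paths exchanged. -/
def mirror : ∀ {u v : List X}, AnnularDiagram P u v → AnnularDiagram P v u
  | _, _, id u => id u
  | _, _, cell p r s q h hu hv => cell p s r q h.symm hv hu
  | _, _, rot p q hu hv => rot q p hv hu
  | _, _, comp a b => comp b.mirror a.mirror

theorem rot_inv {u v : List X} (p q : List X) (hu : u = p ++ q) (hv : v = q ++ p) :
    Equivalent (P := P) (comp (rot p q hu hv) (rot q p hv hu)) (id u) := by
  subst hu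
  have h := Equivalent.rot_rot (P := P) (u := p ++ q) (v := v) (w := p ++ q) p q []
    (by simp) (by simpa using hv) (by simp)
  simp only [List.append_nil, List.nil_append] at h
  exact h.trans (Equivalent.rot_nil _)

theorem mirror_mirror {u v : List X} (a : AnnularDiagram P u v) : a.mirror.mirror = a := by
  induction a with
  | id u => rfl
  | cell p r s q h hu hv => rfl
  | rot p q hu hv => rfl
  | comp a b iha ihb => simp [mirror, iha, ihb]

theorem comp_mirror {u v : List X} (a : AnnularDiagram P u v) :
    Equivalent (comp a a.mirror) (id u) := by
  induction a with
  | id u => exact Equivalent.id_comp _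
  | cell p r s q h hu hv => exact Equivalent.dipole p r s q h hu hv
  | rot p q hu hv => exact rot_inv p q hu hv
  | comp a b iha ihb =>
    refine (Equivalent.assoc _ _ _).trans (Equivalent.trans (Equivalent.congr (.refl _) ?_) iha)
    refine (Equivalent.assoc _ _ _).symm.trans ?_
    exact (Equivalent.congr ihb (.refl _)).trans (Equivalent.id_comp _)

theorem mirror_comp {u v : List X} (a : AnnularDiagram P u v) :
    Equivalent (comp a.mirror a) (id v) := by
  have h := comp_mirror a.mirror
  rwa [mirror_mirror] at h

theorem mirror_congr {u v : List X} {a b : AnnularDiagram P u v} (h : Equivalent a b) :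
    Equivalent a.mirror b.mirror := by
  refine (Equivalent.comp_id _).symm.trans ?_
  refine (Equivalent.congr (.refl _) (comp_mirror b).symm).trans ?_
  refine (Equivalent.assoc _ _ _).symm.trans ?_
  refine Equivalent.trans (Equivalent.congr ?_ (.refl _)) (Equivalent.id_comp _)
  exact (Equivalent.congr (.refl _) h.symm).trans (mirror_comp a)

/-- Equivalence of annular diagrams with the same boundary labels. -/
def setoid (P : SemigroupPresentation X) (u v : List X) : Setoid (AnnularDiagram P u v) where
  r := Equivalent
  iseqv := ⟨Equivalent.refl, Equivalent.symm, Equivalent.trans⟩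

end AnnularDiagram

/-- The annular diagram group `𝒟ᵃ(P, u)`: annular diagrams with outer and inner path labelled `u`, up
to insertion and removal of dipoles. -/
def AnnularDiagramGroup (P : SemigroupPresentation X) (u : List X) : Type _ :=
  Quotient (AnnularDiagram.setoid P u u)

instance (P : SemigroupPresentation X) (u : List X) : Group (AnnularDiagramGroup P u) where
  mul := Quotient.map₂ AnnularDiagram.comp fun _ _ h _ _ h' => AnnularDiagram.Equivalent.congr h h'
  one := Quotient.mk _ (AnnularDiagram.id u)
  inv := Quotient.map AnnularDiagram.mirror fun _ _ h => AnnularDiagram.mirror_congr h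
  mul_assoc := by
    rintro ⟨a⟩ ⟨b⟩ ⟨c⟩
    exact Quotient.sound (AnnularDiagram.Equivalent.assoc a b c)
  one_mul := by
    rintro ⟨a⟩
    exact Quotient.sound (AnnularDiagram.Equivalent.id_comp a)
  mul_one := by
    rintro ⟨a⟩
    exact Quotient.sound (AnnularDiagram.Equivalent.comp_id a)
  inv_mul_cancel := by
    rintro ⟨a⟩
    exact Quotient.sound (AnnularDiagram.mirror_comp a)

end Annular

/-- The letters of the alphabet `{e, f}`. -/
inductive EF where
  | e : EF
  | f : EF

/-- The semigroup presentation `⟨e, f ∣ e = ff, f = fe⟩`. -/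
def efPresentation : SemigroupPresentation EF where
  rel r s := (r = [EF.e] ∧ s = [EF.f, EF.f]) ∨ (r = [EF.f] ∧ s = [EF.f, EF.e])
  left_ne_nil := by rintro r s (⟨rfl, rfl⟩ | ⟨rfl, rfl⟩) <;> simp
  right_ne_nil := by rintro r s (⟨rfl, rfl⟩ | ⟨rfl, rfl⟩) <;> simp

/-! Give the root of a binary tree the type `e`, every left child the type `f`, and every right
child the type opposite to that of its parent. A caret is then exactly one of the relations `e =
ff`, `f = fe`. The type of a leaf is the sum mod 2 of its own digit sum and that of the cyclically
next leaf. Up to swapping colours, the parity of the digit sum is the only proper 2-colouring of the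
Thompson graph of a tree. So the graph of a pair of trees is bipartite iff the parities of
identified leaves differ by one global constant, and, taking cyclic differences, iff identified
leaves have equal types (`isBipartite_iff`). This survives the removal of dipoles, so any diagram of
an element decides membership (`mem_jonesSet_iff`).

Isomorphism and finite generation: annular diagrams act on circles by piecewise affine maps,
independently of dipoles. A tree gives a composite of cells from `e` to the word of the types of its
leaves, so a pair of trees with matching types gives a loop at `e` acting as that pair
(`TypesAgree.exists_represents`). Conversely, after expanding every letter `e` to `ff`, a loop
becomes a product of rotations and of replacements of `f` by `fff` and their inverses
(`exists_generated_of_loop`). A calculus of fractions turns it into a positive part, a rotation and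
an inverse positive part (`Generated.hasNormalForm`). This yields a pair of trees with all leaves of
type `f` (`exists_typesAgree_represents`). Positive parts can be sorted, and sorted ones are
determined by their action, so the action is faithful (`circleAction_injective`). Commutation
relations like those of Thompson's group reduce all replacements to three, which together with one
rotation generate (`fg_EFGroup`).

The core: let `ρ` be a function on words whose kernel passes to children and to parents. If
generators identify only leaves with equal `ρ`, then every element of the group they generate that
maps one dyadic interval affinely onto another relates words with equal `ρ`
(`PreservesClasses.eq_of_mapsTo`). Take for `ρ` the state reached by reading a word in the core. The
subgroup maps every interval `u0` onto the interval `0` (`exists_mapsTo_false`), which forces every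
word to be readable, so reading addresses is a homomorphism from the diagram of any element of the
subgroup. Conversely all foldings respect types, so types descend to the core, and a homomorphism
from a diagram to the core forces identified leaves to have equal types. -/

/-! ### Dyadic intervals -/

theorem binVal_nonneg (u : List Bool) : 0 ≤ binVal u := by
  induction u with
  | nil => simp [binVal]
  | cons b w ih => cases b <;> simp [binVal] <;> linarith

theorem binVal_add_le_one (u : List Bool) : binVal u + (1 / 2) ^ u.length ≤ 1 := by
  induction u with
  | nil => simp [binVal]
  | cons b w ih => cases b <;> simp only [binVal, List.length_cons, pow_succ] <;> norm_num <;>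
      norm_num at ih <;> linarith

theorem binVal_append (u w : List Bool) :
    binVal (u ++ w) = binVal u + binVal w * (1 / 2) ^ u.length := by
  induction u with
  | nil => simp [binVal]
  | cons b u ih => simp only [List.cons_append, binVal, ih, List.length_cons, pow_succ]; ring

/-- The tails have values in `[0,1)`, so the value determines the first digit. -/
theorem binVal_injective {u v : List Bool} (hl : u.length = v.length)
    (h : binVal u = binVal v) : u = v := by
  induction u generalizing v with
  | nil => exact (List.length_eq_zero_iff.mp hl.symm).symm
  | cons b u ih =>
    cases v with
    | nil => simp at hl
    | cons c v =>
      have hu := binVal_add_le_one u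
      have hv := binVal_add_le_one v
      have hu0 := binVal_nonneg u
      have hv0 := binVal_nonneg v
      have pu : (0 : ℝ) < (1 / 2) ^ u.length := by positivity
      have pv : (0 : ℝ) < (1 / 2) ^ v.length := by positivity
      simp only [List.length_cons, add_left_inj] at hl
      cases b <;> cases c <;> simp [binVal] at h
      · rw [ih hl h]
      · linarith
      · linarith
      · rw [ih hl h]

/-- `x` lies in the dyadic interval of `u`. -/
def InInterval (u : List Bool) (x : ℝ) : Prop :=
  binVal u ≤ x ∧ x < binVal u + (1 / 2) ^ u.length

theorem inInterval_nil {x : ℝ} : InInterval [] x ↔ 0 ≤ x ∧ x < 1 := by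
  simp [InInterval, binVal]

theorem InInterval.mem_Ico {u : List Bool} {x : ℝ} (h : InInterval u x) :
    x ∈ Set.Ico (0 : ℝ) 1 :=
  ⟨(binVal_nonneg u).trans h.1, h.2.trans_le (binVal_add_le_one u)⟩

theorem inInterval_cons {b : Bool} {u : List Bool} {x : ℝ} :
    InInterval (b :: u) x ↔ InInterval u (2 * x - if b then 1 else 0) := by
  simp only [InInterval, binVal, List.length_cons, pow_succ]
  constructor <;> rintro ⟨h1, h2⟩ <;> constructor <;> linarith

theorem inInterval_append {u w : List Bool} {x : ℝ} :
    InInterval (u ++ w) x ↔ InInterval w ((x - binVal u) * 2 ^ u.length) := by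
  induction u generalizing x with
  | nil => simp [binVal]
  | cons b u ih =>
    rw [List.cons_append, inInterval_cons, ih]
    have : (2 * x - (if b then 1 else 0) - binVal u) * 2 ^ u.length =
      (x - binVal (b :: u)) * 2 ^ (b :: u).length := by
      simp only [binVal, List.length_cons, pow_succ]; ring
    rw [this]

theorem inInterval_iff {u : List Bool} {x : ℝ} :
    InInterval u x ↔ (x - binVal u) * 2 ^ u.length ∈ Set.Ico (0 : ℝ) 1 := by
  have := @inInterval_append u [] x
  rwa [List.append_nil, inInterval_nil] at this

theorem InInterval.of_append {u w : List Bool} {x : ℝ} (h : InInterval (u ++ w) x) :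
    InInterval u x :=
  inInterval_iff.mpr (inInterval_append.mp h).mem_Ico

theorem inInterval_of_coord {u : List Bool} {s : ℝ} (h0 : 0 ≤ s) (h1 : s < 1) :
    InInterval u (binVal u + s / 2 ^ u.length) := by
  rw [inInterval_iff]
  have : (binVal u + s / 2 ^ u.length - binVal u) * 2 ^ u.length = s := by field_simp; ring
  rw [this]; exact ⟨h0, h1⟩

theorem InInterval.exists_coord {u : List Bool} {x : ℝ} (h : InInterval u x) :
    ∃ s : ℝ, 0 ≤ s ∧ s < 1 ∧ x = binVal u + s / 2 ^ u.length :=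
  ⟨(x - binVal u) * 2 ^ u.length, (inInterval_iff.mp h).1, (inInterval_iff.mp h).2, by
    field_simp; ring⟩

/-! ### Leaves of binary trees -/

theorem List.Nodup.append_cons_unique {α : Type*} {A A' B B' : List α} {a : α}
    (hd : (A ++ a :: B).Nodup) (h : A ++ a :: B = A' ++ a :: B') : A = A' ∧ B = B' := by
  have h1 : a ∉ A := fun hm => (List.nodup_append.mp hd).2.2 _ hm _ (by simp) rfl
  have h2 : a ∉ B := (List.nodup_cons.mp (List.nodup_append.mp hd).2.1).1
  have h' := (List.append_cons_inj_of_notMem h1 h2).mp h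
  exact ⟨h'.1, h'.2.2⟩

namespace BinTree

theorem leaves_ne_nil (t : BinTree) : t.leaves ≠ [] := by
  induction t with
  | leaf => simp [leaves]
  | node l r ihl _ => simp [leaves, ihl]

theorem leaves_nodup (t : BinTree) : t.leaves.Nodup := by
  induction t with
  | leaf => simp [leaves]
  | node l r ihl ihr =>
    refine List.nodup_append.mpr ⟨ihl.map fun _ _ h => by simpa using h,
      ihr.map fun _ _ h => by simpa using h, ?_⟩
    simp only [List.mem_map]
    rintro _ ⟨a, _, rfl⟩ _ ⟨b, _, rfl⟩ h
    simp at h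

theorem exists_leaf_inInterval (t : BinTree) {x : ℝ} (hx : x ∈ Set.Ico (0 : ℝ) 1) :
    ∃ u ∈ t.leaves, InInterval u x := by
  induction t generalizing x with
  | leaf => exact ⟨[], by simp [leaves], inInterval_nil.mpr hx⟩
  | node l r ihl ihr =>
    rcases lt_or_ge x (1 / 2) with h | h
    · obtain ⟨u, hu, hux⟩ := ihl (x := 2 * x) ⟨by linarith [hx.1], by linarith⟩
      exact ⟨false :: u, by simp [leaves, hu], inInterval_cons.mpr (by simpa using hux)⟩
    · obtain ⟨u, hu, hux⟩ := ihr (x := 2 * x - 1) ⟨by linarith, by linarith [hx.2]⟩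
      exact ⟨true :: u, by simp [leaves, hu], inInterval_cons.mpr (by simpa using hux)⟩

/-- A leaf can be replaced by a caret. -/
theorem exists_split {t : BinTree} {A B : List (List Bool)} {u : List Bool}
    (h : t.leaves = A ++ u :: B) :
    ∃ t' : BinTree, t'.leaves = A ++ (u ++ [false]) :: (u ++ [true]) :: B := by
  induction t generalizing A B u with
  | leaf =>
    refine ⟨node leaf leaf, ?_⟩
    rcases A with _ | ⟨a, A⟩
    · simp [leaves] at h ⊢; obtain ⟨rfl, rfl⟩ := h; simp
    · simp [leaves] at h
  | node l r ihl ihr =>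
    rw [leaves, List.append_eq_append_iff] at h
    rcases h with ⟨C, rfl, h⟩ | ⟨C, h, h'⟩
    · obtain ⟨A', D, h1, rfl, h2⟩ := List.map_eq_append_iff.mp h
      obtain ⟨u', B', rfl, rfl, rfl⟩ := List.map_eq_cons_iff.mp h2
      obtain ⟨r', hr'⟩ := ihr h1
      exact ⟨node l r', by simp [leaves, hr']⟩
    · rcases C with _ | ⟨c, C⟩
      · simp only [List.append_nil, List.nil_append] at h h'
        obtain ⟨u', B', h1, rfl, rfl⟩ := List.map_eq_cons_iff.mp h'.symm
        obtain ⟨r', hr'⟩ := ihr (A := []) h1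
        exact ⟨node l r', by simp [leaves, hr', h]⟩
      · simp only [List.cons_append, List.cons.injEq] at h'
        obtain ⟨rfl, rfl⟩ := h'
        obtain ⟨A', D, h1, rfl, h2⟩ := List.map_eq_append_iff.mp h
        obtain ⟨u', B', rfl, rfl, rfl⟩ := List.map_eq_cons_iff.mp h2
        obtain ⟨l', hl'⟩ := ihl h1
        exact ⟨node l' r, by simp [leaves, hl']⟩

/-- The two leaves of a caret are adjacent, and the caret can be removed. -/
theorem exists_merge {t : BinTree} {A B : List (List Bool)} {u : List Bool}
    (h : t.leaves = A ++ (u ++ [false]) :: B) (h' : u ++ [true] ∈ t.leaves) :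
    ∃ (t' : BinTree) (C : List (List Bool)), B = (u ++ [true]) :: C ∧
      t'.leaves = A ++ u :: C := by
  induction t generalizing A B u with
  | leaf => simp [leaves] at h'
  | node l r ihl ihr =>
    have hd := leaves_nodup (node l r)
    have hu : (u ++ [false]) ∈ (node l r).leaves := by simp [h]
    rcases u with _ | ⟨b, u⟩
    · have hl : l = leaf := by
        rcases l with _ | ⟨l1, l2⟩
        · rfl
        · simp [leaves] at hu
      have hr : r = leaf := by
        rcases r with _ | ⟨l1, l2⟩
        · rfl
        · simp [leaves] at h'
      subst hl hr
      have : A = [] := by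
        rcases A with _ | ⟨a, A⟩
        · rfl
        · simp [leaves] at h
          obtain ⟨rfl, h⟩ := h
          rcases A with _ | ⟨a, A⟩ <;> simp at h
      subst this
      simp [leaves] at h
      exact ⟨leaf, [], by simp [leaves, ← h]⟩
    · cases b
      · have hu1 : u ++ [false] ∈ l.leaves := by simpa [leaves] using hu
        have hu2 : u ++ [true] ∈ l.leaves := by simpa [leaves] using h'
        obtain ⟨A', B', hl⟩ := List.append_of_mem hu1
        obtain ⟨l', C, rfl, hl'⟩ := ihl hl hu2
        have key : (node l r).leaves = A'.map (List.cons false) ++ (false :: u ++ [false]) ::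
            ((false :: u ++ [true]) :: (C.map (List.cons false) ++
              r.leaves.map (List.cons true))) := by
          simp [leaves, hl]
        obtain ⟨rfl, rfl⟩ := List.Nodup.append_cons_unique (h ▸ hd) (h.symm.trans key)
        exact ⟨node l' r, _, rfl, by simp [leaves, hl']⟩
      · have hu1 : u ++ [false] ∈ r.leaves := by simpa [leaves] using hu
        have hu2 : u ++ [true] ∈ r.leaves := by simpa [leaves] using h'
        obtain ⟨A', B', hl⟩ := List.append_of_mem hu1
        obtain ⟨r', C, rfl, hr'⟩ := ihr hl hu2
        have key : (node l r).leaves = (l.leaves.map (List.cons false) ++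
            A'.map (List.cons true)) ++ (true :: u ++ [false]) ::
            ((true :: u ++ [true]) :: (C.map (List.cons true))) := by
          simp [leaves, hl]
        obtain ⟨rfl, rfl⟩ := List.Nodup.append_cons_unique (h ▸ hd) (h.symm.trans key)
        exact ⟨node l r', _, rfl, by simp [leaves, hr']⟩

end BinTree

/-! ### Labels of vertices -/

/-- The types of words: `false` if the two end points of the interval have digit sums of the same
parity, `true` otherwise; `typeFrom x u` is the type of `u` below a vertex of type `x`. -/
def typeFrom (x : Bool) (u : List Bool) : Bool := u.foldl (fun y b => if b then !y else true) x

theorem typeFrom_nil (x : Bool) : typeFrom x [] = x := rfl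

theorem typeFrom_cons (x b : Bool) (u : List Bool) :
    typeFrom x (b :: u) = typeFrom (if b then !x else true) u := rfl

theorem typeFrom_append (x : Bool) (u v : List Bool) :
    typeFrom x (u ++ v) = typeFrom (typeFrom x u) v := by
  simp [typeFrom]

/-! ### Bars -/

/-- `P` holds at all leaves of some finite binary tree with root `u`. -/
inductive Bar (P : List Bool → Prop) : List Bool → Prop
  | base {u} : P u → Bar P u
  | split {u} : Bar P (u ++ [false]) → Bar P (u ++ [true]) → Bar P u

theorem Bar.map_cons {P Q : List Bool → Prop} {b : Bool} {u : List Bool} (h : Bar P u)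
    (hPQ : ∀ w, P w → Q (b :: w)) : Bar Q (b :: u) := by
  induction h with
  | base h => exact .base (hPQ _ h)
  | split _ _ ih1 ih2 => exact .split ih1 ih2

theorem Bar.mono {P Q : List Bool → Prop} {u : List Bool} (h : Bar P u)
    (hPQ : ∀ w, P w → Q w) : Bar Q u := by
  induction h with
  | base h => exact .base (hPQ _ h)
  | split _ _ ih1 ih2 => exact .split ih1 ih2

theorem BinTree.bar_leaf_prefix (t : BinTree) (u : List Bool) :
    Bar (fun w => ∃ l ∈ t.leaves, l <+: w) u := by
  induction t generalizing u with
  | leaf => exact .base ⟨[], by simp [leaves], List.nil_prefix⟩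
  | node l r ihl ihr =>
    have hl : ∀ u, Bar (fun w => ∃ m ∈ (node l r).leaves, m <+: w) (false :: u) := fun u =>
      (ihl u).map_cons fun w ⟨m, hm, hw⟩ => ⟨false :: m, by simp [leaves, hm], by simpa using hw⟩
    have hr : ∀ u, Bar (fun w => ∃ m ∈ (node l r).leaves, m <+: w) (true :: u) := fun u =>
      (ihr u).map_cons fun w ⟨m, hm, hw⟩ => ⟨true :: m, by simp [leaves, hm], by simpa using hw⟩
    rcases u with _ | ⟨_ | _, u⟩
    · exact .split (hl []) (hr [])
    · exact hl u
    · exact hr u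

/-! ### Affine maps between dyadic intervals -/

/-- `f` maps the interval of `u` affinely and increasingly onto that of `v`. -/
def MapsTo (f : Equiv.Perm (Set.Ico (0 : ℝ) 1)) (u v : List Bool) : Prop :=
  ∀ x : Set.Ico (0 : ℝ) 1,
    binVal u ≤ (x : ℝ) → (x : ℝ) < binVal u + (1 / 2) ^ u.length →
      (f x : ℝ) = binVal v + ((x : ℝ) - binVal u) * (2 ^ u.length / 2 ^ v.length)

namespace MapsTo

variable {f g : Equiv.Perm (Set.Ico (0 : ℝ) 1)} {u v w : List Bool}

/-- In the coordinate `s` that rescales each dyadic interval to `[0,1)` the map is the identity;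
composition and inversion become immediate. -/
theorem apply_coord (h : MapsTo f u v) {s : ℝ} (h0 : 0 ≤ s) (h1 : s < 1) :
    (f ⟨binVal u + s / 2 ^ u.length, (inInterval_of_coord h0 h1).mem_Ico⟩ : ℝ) =
      binVal v + s / 2 ^ v.length := by
  rw [h _ (inInterval_of_coord h0 h1).1 (inInterval_of_coord h0 h1).2]
  simp only
  field_simp
  ring

theorem of_coord (h : ∀ s : ℝ, ∀ (h0 : 0 ≤ s) (h1 : s < 1),
    (f ⟨binVal u + s / 2 ^ u.length, (inInterval_of_coord h0 h1).mem_Ico⟩ : ℝ) =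
      binVal v + s / 2 ^ v.length) : MapsTo f u v := by
  rintro ⟨x, hx⟩ h1 h2
  obtain ⟨s, hs0, hs1, rfl⟩ := InInterval.exists_coord ⟨h1, h2⟩
  rw [h s hs0 hs1]
  simp only
  field_simp
  ring

/-- The image of the left end point fixes the value of the target word; the image of the midpoint
fixes the slope and with it the length. -/
theorem unique (h : MapsTo f u v) (h' : MapsTo f u w) : v = w := by
  have e0 := (h.apply_coord (s := 0) le_rfl one_pos).symm.trans
    (h'.apply_coord (s := 0) le_rfl one_pos)
  have e1 := (h.apply_coord (s := 1 / 2) (by norm_num) (by norm_num)).symm.trans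
    (h'.apply_coord (s := 1 / 2) (by norm_num) (by norm_num))
  simp only [zero_div, add_zero] at e0
  rw [e0, add_right_inj] at e1
  have e2 : (2 : ℝ) ^ v.length = 2 ^ w.length := by
    rw [div_eq_div_iff (by positivity) (by positivity)] at e1
    linarith
  exact binVal_injective (pow_right_injective₀ (by norm_num) (by norm_num) e2) e0

theorem append (h : MapsTo f u v) (w : List Bool) : MapsTo f (u ++ w) (v ++ w) := by
  intro x h1 h2
  have hx := InInterval.of_append (u := u) (w := w) ⟨h1, h2⟩
  rw [h x hx.1 hx.2]
  simp only [binVal_append, List.length_append, pow_add, div_pow, one_pow]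
  field_simp
  ring

theorem one : MapsTo 1 u u := by
  refine of_coord fun s h0 h1 => ?_
  simp

theorem mul (h : MapsTo f u v) (h' : MapsTo g v w) : MapsTo (g * f) u w := by
  refine of_coord fun s h0 h1 => ?_
  have : f ⟨_, (inInterval_of_coord (u := u) h0 h1).mem_Ico⟩ =
      ⟨_, (inInterval_of_coord (u := v) h0 h1).mem_Ico⟩ := Subtype.ext (h.apply_coord h0 h1)
  rw [Equiv.Perm.mul_apply, this, h'.apply_coord h0 h1]

theorem inv (h : MapsTo f u v) : MapsTo f⁻¹ v u := by
  refine of_coord fun s h0 h1 => ?_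
  have : f ⟨_, (inInterval_of_coord (u := u) h0 h1).mem_Ico⟩ =
      ⟨_, (inInterval_of_coord (u := v) h0 h1).mem_Ico⟩ := Subtype.ext (h.apply_coord h0 h1)
  rw [← this]
  exact congrArg Subtype.val (f.symm_apply_apply _)

end MapsTo

/-! ### Relations on words closed under passing to children and to parents -/

/-- The kernel of `ρ` is closed under passing to children and to parents. -/
structure IsTreeCongruence {α : Type*} (ρ : List Bool → α) : Prop where
  child : ∀ {u v}, ρ u = ρ v → ∀ b, ρ (u ++ [b]) = ρ (v ++ [b])
  parent : ∀ {u v}, ρ (u ++ [false]) = ρ (v ++ [false]) → ρ (u ++ [true]) = ρ (v ++ [true]) →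
    ρ u = ρ v

theorem IsTreeCongruence.append {α : Type*} {ρ : List Bool → α} (hρ : IsTreeCongruence ρ)
    {u v : List Bool} (h : ρ u = ρ v) (w : List Bool) : ρ (u ++ w) = ρ (v ++ w) := by
  induction w using List.reverseRecOn with
  | nil => simpa using h
  | append_singleton w b ih => simpa using hρ.child ih b

theorem isTreeCongruence_typeFrom : IsTreeCongruence (typeFrom false) where
  child h b := by rw [typeFrom_append, typeFrom_append, h]
  parent _ h := by simpa [typeFrom_append, typeFrom_cons, typeFrom_nil] using h

/-- Every interval has a finite dyadic subdivision whose pieces `f` maps affinely to dyadic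
intervals in the same class. -/
def PreservesClasses {α : Type*} (ρ : List Bool → α) (f : Equiv.Perm (Set.Ico (0 : ℝ) 1)) : Prop :=
  ∀ u, Bar (fun w => ∃ v, MapsTo f w v ∧ ρ w = ρ v) u

namespace PreservesClasses

variable {α : Type*} {ρ : List Bool → α} {f g : Equiv.Perm (Set.Ico (0 : ℝ) 1)}

theorem one : PreservesClasses ρ 1 := fun u => .base ⟨u, .one, rfl⟩

theorem mul (hρ : IsTreeCongruence ρ) (hg : PreservesClasses ρ g) (hf : PreservesClasses ρ f) :
    PreservesClasses ρ (g * f) := by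
  intro u
  induction hf u with
  | base h =>
    obtain ⟨v, hv, e⟩ := h
    -- The subdivision of the image interval `v` that suits `g` is pulled back along the affine
    -- piece of `f`.
    have hb := hg v
    generalize hP : (fun w => ∃ v, MapsTo g w v ∧ ρ w = ρ v) = P at hb
    rename_i u
    clear hf hg
    induction hb generalizing u with
    | base h =>
      subst hP
      obtain ⟨w, hw, e'⟩ := h
      exact .base ⟨w, hv.mul hw, e.trans e'⟩
    | split _ _ ih1 ih2 =>
      exact .split (ih1 (hv.append _) (hρ.child e _)) (ih2 (hv.append _) (hρ.child e _))
  | split _ _ ih1 ih2 => exact .split ih1 ih2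

/-- On the pieces of a fine subdivision the equality is known, since images are unique; closure
under parents carries it back up to `u`. -/
theorem eq_of_mapsTo (hρ : IsTreeCongruence ρ) (hf : PreservesClasses ρ f) {u v : List Bool}
    (h : MapsTo f u v) : ρ u = ρ v := by
  induction hf u generalizing v with
  | base h' =>
    obtain ⟨w, hw, e⟩ := h'
    rw [h.unique hw, e]
  | split _ _ ih1 ih2 => exact hρ.parent (ih1 (h.append _)) (ih2 (h.append _))

end PreservesClasses

/-! ### Tree diagrams -/

namespace TreeDiagram

theorem matched_iff (d : TreeDiagram) (u v : List Bool) :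
    d.Matched u v ↔ (u, v) ∈ d.input.leaves.zip (d.output.leaves.rotate d.shift) := by
  rw [List.mem_iff_getElem]
  constructor
  · rintro ⟨i, rfl, rfl⟩
    refine ⟨i, by simp [d.length_eq], ?_⟩
    simp [inLeaf, outLeaf, List.getElem_rotate, d.length_eq]
  · rintro ⟨i, hi, h⟩
    simp only [List.length_zip, List.length_rotate, d.length_eq, min_self] at hi
    refine ⟨⟨i, hi⟩, ?_⟩
    simp only [List.getElem_zip, Prod.mk.injEq, List.getElem_rotate, d.length_eq] at h
    exact h

/-- The tree diagram in which the leaves of `R` are identified with those of `S`, rotated. -/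
def ofRotate (R S : BinTree) (k : ℕ) (h : S.leaves.length = R.leaves.length) : TreeDiagram where
  input := R
  output := S
  shift := k % R.leaves.length
  length_eq := h
  shift_lt := Nat.mod_lt _ (List.length_pos_iff.mpr R.leaves_ne_nil)

theorem matched_ofRotate {R S : BinTree} {k : ℕ} (h : S.leaves.length = R.leaves.length)
    (u v : List Bool) :
    (ofRotate R S k h).Matched u v ↔ (u, v) ∈ R.leaves.zip (S.leaves.rotate k) := by
  rw [matched_iff]
  simp only [ofRotate]
  rw [← h, List.rotate_mod]

variable {d : TreeDiagram} {f g : Equiv.Perm (Set.Ico (0 : ℝ) 1)}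

theorem exists_matched_of_mem_input {u : List Bool} (hu : u ∈ d.input.leaves) :
    ∃ v, d.Matched u v := by
  obtain ⟨i, hi, rfl⟩ := List.mem_iff_getElem.mp hu
  exact ⟨_, ⟨i, hi⟩, rfl, rfl⟩

theorem exists_matched_of_mem_output {v : List Bool} (hv : v ∈ d.output.leaves) :
    ∃ u, d.Matched u v := by
  obtain ⟨i, hi, h⟩ := List.mem_iff_getElem.mp (List.mem_rotate (n := d.shift).mpr hv)
  have hi' : i < d.input.leaves.length := by simpa [d.length_eq] using hi
  refine ⟨_, ⟨i, hi'⟩, rfl, ?_⟩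
  rw [← h]
  simp [outLeaf, List.getElem_rotate, d.length_eq]

theorem Matched.mem_input {u v : List Bool} (h : d.Matched u v) : u ∈ d.input.leaves := by
  obtain ⟨i, rfl, rfl⟩ := h
  exact List.getElem_mem _

theorem Matched.mem_output {u v : List Bool} (h : d.Matched u v) : v ∈ d.output.leaves := by
  obtain ⟨i, rfl, rfl⟩ := h
  exact List.getElem_mem _

theorem Represents.eq (hf : d.Represents f) (hg : d.Represents g) : f = g := by
  ext x
  obtain ⟨u, hu, hx⟩ := d.input.exists_leaf_inInterval x.2
  obtain ⟨v, hv⟩ := exists_matched_of_mem_input hu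
  rw [hf u v hv x hx.1 hx.2, hg u v hv x hx.1 hx.2]

/-- Below every word there is a finite subdivision into extensions of input leaves, and closure
under children extends the agreement at leaves to these. -/
theorem Represents.preservesClasses {α : Type*} {ρ : List Bool → α} (hρ : IsTreeCongruence ρ)
    (hf : d.Represents f) (h : ∀ u v, d.Matched u v → ρ u = ρ v) : PreservesClasses ρ f := by
  intro u
  refine (d.input.bar_leaf_prefix u).mono ?_
  rintro w ⟨l, hl, z, rfl⟩
  obtain ⟨v, hv⟩ := exists_matched_of_mem_input hl
  exact ⟨v ++ z, MapsTo.append (hf l v hv) z, hρ.append (h l v hv) z⟩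

theorem Represents.preservesClasses_inv {α : Type*} {ρ : List Bool → α} (hρ : IsTreeCongruence ρ)
    (hf : d.Represents f) (h : ∀ u v, d.Matched u v → ρ u = ρ v) : PreservesClasses ρ f⁻¹ := by
  intro u
  refine (d.output.bar_leaf_prefix u).mono ?_
  rintro w ⟨l, hl, z, rfl⟩
  obtain ⟨v, hv⟩ := exists_matched_of_mem_output hl
  exact ⟨v ++ z, (MapsTo.inv (hf v l hv)).append z, hρ.append (h v l hv).symm z⟩

/-- Identified leaves have the same type. -/
def TypesAgree (d : TreeDiagram) : Prop :=
  ∀ u v, d.Matched u v → typeFrom false u = typeFrom false v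

end TreeDiagram

/-! ### Parities and types of leaves -/

/-- The digit sum modulo 2. -/
def parity (u : List Bool) : Bool := u.foldr xor false

theorem parity_cons (b : Bool) (u : List Bool) : parity (b :: u) = (b ^^ parity u) := rfl

theorem parity_append (u v : List Bool) : parity (u ++ v) = (parity u ^^ parity v) := by
  induction u with
  | nil => simp [parity]
  | cons b u ih => rw [List.cons_append, parity_cons, parity_cons, ih, Bool.xor_assoc]

theorem parity_replicate_false (k : ℕ) : parity (List.replicate k false) = false := by
  induction k with
  | zero => rfl
  | succ k ih => rw [List.replicate_succ, parity_cons, ih]; rfl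

namespace BinTree

theorem leaves_eq_cons (t : BinTree) :
    ∃ (k : ℕ) (L : List (List Bool)), t.leaves = List.replicate k false :: L := by
  induction t with
  | leaf => exact ⟨0, [], rfl⟩
  | node l r ihl _ =>
    obtain ⟨k, L, h⟩ := ihl
    exact ⟨k + 1, L.map (List.cons false) ++ r.leaves.map (List.cons true), by
      simp [leaves, h, List.replicate_succ]⟩

/-- The type of a leaf is the difference of its parity and the parity of the next leaf. -/
theorem map_typeFrom_leaves (t : BinTree) (x c : Bool) :
    t.leaves.map (typeFrom x) = List.zipWith xor (t.leaves.map fun u => c ^^ parity u)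
      ((t.leaves.map fun u => c ^^ parity u).tail ++ [c ^^ x]) := by
  induction t generalizing x c with
  | leaf => simp [leaves, typeFrom_nil, parity]
  | node l r ihl ihr =>
    have hl : (l.leaves.map fun w => false :: w).map (fun u => c ^^ parity u) =
        l.leaves.map fun u => c ^^ parity u := by
      simp [parity_cons, Function.comp_def]
    have hr : (r.leaves.map fun w => true :: w).map (fun u => c ^^ parity u) =
        r.leaves.map fun u => (!c) ^^ parity u := by
      simp [parity_cons, Function.comp_def]
    have e1 : (l.leaves.map fun w => false :: w).map (typeFrom x) =
        l.leaves.map (typeFrom true) := by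
      simp [typeFrom_cons, Function.comp_def]
    have e2 : (r.leaves.map fun w => true :: w).map (typeFrom x) =
        r.leaves.map (typeFrom (!x)) := by
      simp [typeFrom_cons, Function.comp_def]
    -- The left subtree, of type `true` and offset `c`, ends with the value `!c`, which is the
    -- parity of the first leaf on the right. The right subtree ends with `!c ^^ !x = c ^^ x`.
    rw [leaves, List.map_append, List.map_append, hl, hr, e1, e2, ihl true c, ihr (!x) (!c)]
    obtain ⟨k, L, hk⟩ := l.leaves_eq_cons
    obtain ⟨k', L', hk'⟩ := r.leaves_eq_cons
    rw [hk, hk']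
    simp only [List.map_cons, List.tail_cons, parity_replicate_false, Bool.xor_false,
      Bool.not_bne_not, List.cons_append]
    rw [← List.cons_append, ← List.zipWith_append (by simp)]
    simp

/-- A proper 2-colouring of the Thompson graph of a tree is given by the parities. -/
theorem coloring_eq_parity (t : BinTree) (χ : List Bool → Bool)
    (h : ∀ a b, t.ThompsonAdj a b → χ a ≠ χ b) :
    ∃ c : Bool, ∀ u ∈ t.leaves, χ u = (c ^^ parity u) := by
  induction t generalizing χ with
  | leaf => exact ⟨χ [], by simp [leaves, parity]⟩
  | node l r ihl ihr =>
    have hlift : ∀ (s : BinTree) (b₀ : Bool),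
        (∀ u ∈ s.leaves, b₀ :: u ∈ (node l r).leaves) →
        ∀ a b, s.ThompsonAdj a b → χ (b₀ :: a) ≠ χ (b₀ :: b) := by
      rintro s b₀ hs a b ⟨ha, hb, w, k, m, rfl, rfl⟩
      exact h _ _ ⟨hs _ ha, hs _ hb, b₀ :: w, k, m, rfl, rfl⟩
    obtain ⟨c, hc⟩ := ihl (fun u => χ (false :: u)) (hlift l false fun u hu => by
      simp [leaves, hu])
    obtain ⟨c', hc'⟩ := ihr (fun u => χ (true :: u)) (hlift r true fun u hu => by
      simp [leaves, hu])
    obtain ⟨k, L, hk⟩ := l.leaves_eq_cons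
    obtain ⟨k', L', hk'⟩ := r.leaves_eq_cons
    -- The left edge at the root joins the leftmost leaves of the two subtrees and so ties their two
    -- colour constants together.
    have h1 := h (false :: List.replicate k false) (true :: List.replicate k' false)
      ⟨by simp [leaves, hk], by simp [leaves, hk'], [], k, k', rfl, rfl⟩
    have h2 := hc (List.replicate k false) (by simp [hk])
    have h3 := hc' (List.replicate k' false) (by simp [hk'])
    simp only [parity_replicate_false, Bool.xor_false] at h2 h3
    rw [h2, h3] at h1
    refine ⟨c, fun u hu => ?_⟩
    simp only [leaves, List.mem_append, List.mem_map] at hu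
    rcases hu with ⟨a, ha, rfl⟩ | ⟨a, ha, rfl⟩
    · rw [hc a ha, parity_cons]; simp
    · rw [hc' a ha, parity_cons]
      revert h1
      cases c <;> cases c' <;> cases parity a <;> simp

theorem ThompsonAdj.parity_ne {t : BinTree} {a b : List Bool} (h : t.ThompsonAdj a b) :
    parity a ≠ parity b := by
  obtain ⟨-, -, w, k, l, rfl, rfl⟩ := h
  simp [parity_append, parity_cons, parity_replicate_false]

end BinTree

/-- The cyclic differences of a list. -/
def cyclicDiff (l : List Bool) : List Bool := List.zipWith xor l (l.rotate 1)

theorem cyclicDiff_rotate (l : List Bool) (k : ℕ) :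
    cyclicDiff (l.rotate k) = (cyclicDiff l).rotate k := by
  rw [cyclicDiff, cyclicDiff, List.rotate_rotate, Nat.add_comm, ← List.rotate_rotate,
    List.zipWith_rotate_distrib _ _ _ _ (by simp)]

/-- For a root of type `false` the closing value is 0, the parity of the first leaf, so the
differences close up cyclically. -/
theorem BinTree.map_typeFrom_false_leaves (t : BinTree) :
    t.leaves.map (typeFrom false) = cyclicDiff (t.leaves.map parity) := by
  have h := t.map_typeFrom_leaves false false
  obtain ⟨k, L, hk⟩ := t.leaves_eq_cons
  rw [h, cyclicDiff]
  simp [hk, parity_replicate_false]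

/-- A discrete derivative determines its list up to a constant of integration, here the difference
of the first entries. -/
theorem cyclicDiff_eq_iff {l l' : List Bool} (hl : l.length = l'.length) :
    cyclicDiff l = cyclicDiff l' ↔
      ∃ c : Bool, ∀ (i : ℕ) (h : i < l.length), (l'[i]'(hl ▸ h)) = (c ^^ l[i]) := by
  constructor
  · intro h
    rcases Nat.eq_zero_or_pos l.length with h0 | h0
    · exact ⟨false, fun i hi => by omega⟩
    · refine ⟨l[0] ^^ l'[0]'(hl ▸ h0), fun i => ?_⟩
      induction i with
      | zero => intro _; cases l[0] <;> cases l'[0]'(hl ▸ h0) <;> rfl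
      | succ i ih =>
        intro hi
        have ih := ih (by omega)
        have e := List.getElem_of_eq h (i := i) (by simp [cyclicDiff]; omega)
        simp only [cyclicDiff, List.getElem_zipWith, List.getElem_rotate] at e
        simp only [← hl, Nat.mod_eq_of_lt hi] at e
        revert ih e
        cases l[i] <;> cases l[i+1] <;> cases l'[i] <;> cases l'[i+1] <;> cases l[0] <;>
          cases l'[0] <;> simp
  · rintro ⟨c, h⟩
    refine List.ext_getElem (by simp [cyclicDiff, hl]) fun i h1 h2 => ?_
    have hi : i < l.length := by simpa [cyclicDiff] using h1
    simp only [cyclicDiff, List.getElem_zipWith, List.getElem_rotate]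
    simp only [← hl]
    rw [h i hi, h _ (Nat.mod_lt _ (by omega))]
    cases c <;> simp

namespace TreeDiagram

variable {d : TreeDiagram}

theorem typesAgree_iff_map_eq : d.TypesAgree ↔ d.input.leaves.map (typeFrom false) =
    (d.output.leaves.map (typeFrom false)).rotate d.shift := by
  rw [← List.map_rotate]
  constructor
  · intro h
    refine List.ext_getElem (by simp [d.length_eq]) fun i h1 h2 => ?_
    have hi : i < d.input.leaves.length := by simpa using h1
    have := h _ _ ⟨⟨i, hi⟩, rfl, rfl⟩
    simpa [inLeaf, outLeaf, List.getElem_rotate, d.length_eq] using this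
  · rintro h _ _ ⟨⟨i, hi⟩, rfl, rfl⟩
    have := List.getElem_of_eq h (i := i) (by simpa using hi)
    simpa [inLeaf, outLeaf, List.getElem_rotate, d.length_eq] using this

theorem typesAgree_iff_parity : d.TypesAgree ↔
    ∃ c : Bool, ∀ i, parity (d.outLeaf i) = (c ^^ parity (d.inLeaf i)) := by
  rw [typesAgree_iff_map_eq, BinTree.map_typeFrom_false_leaves, BinTree.map_typeFrom_false_leaves,
    ← cyclicDiff_rotate, cyclicDiff_eq_iff (by simp [d.length_eq])]
  refine exists_congr fun c => ⟨fun h i => ?_, fun h i hi => ?_⟩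
  · have := h i (by simp)
    simpa [inLeaf, outLeaf, List.getElem_rotate, d.length_eq] using this
  · have := h ⟨i, by simpa using hi⟩
    simpa [inLeaf, outLeaf, List.getElem_rotate, d.length_eq] using this

theorem inLeaf_injective (d : TreeDiagram) : Function.Injective d.inLeaf := fun _ _ h =>
  Fin.ext (d.input.leaves_nodup.getElem_inj_iff.mp h)

theorem outLeaf_injective (d : TreeDiagram) : Function.Injective d.outLeaf := by
  intro i j h
  have hn := (List.nodup_rotate (n := d.shift)).mpr d.output.leaves_nodup
  have e : ∀ i, d.outLeaf i = (d.output.leaves.rotate d.shift)[(i : ℕ)]'(by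
      simp [d.length_eq]) := fun i => by
    simp [outLeaf, List.getElem_rotate, d.length_eq]
  rw [e, e] at h
  exact Fin.ext (hn.getElem_inj_iff.mp h)

/-- A 2-colouring restricts to the parity colouring of each tree up to a swap. The two swaps combine
to the one constant of `typesAgree_iff_parity`. -/
theorem isBipartite_iff : d.thompsonGraph.IsBipartite ↔ d.TypesAgree := by
  rw [typesAgree_iff_parity]
  constructor
  · rintro ⟨C⟩
    have hC : ∀ i j, d.input.ThompsonAdj (d.inLeaf i) (d.inLeaf j) ∨
        d.output.ThompsonAdj (d.outLeaf i) (d.outLeaf j) →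
        decide (C i = 0) ≠ decide (C j = 0) := by
      intro i j h
      -- `SimpleGraph.fromRel` discards loops, so distinctness has to be supplied: the ends of an
      -- edge have different parities in the tree it comes from.
      have hij : i ≠ j := by
        rintro rfl
        rcases h with h | h <;> exact h.parity_ne rfl
      have hn := C.valid (show d.thompsonGraph.Adj i j from ⟨hij, Or.inl h⟩)
      generalize C i = a at *
      generalize C j = b at *
      revert a b
      decide
    classical
    obtain ⟨c, hc⟩ := d.input.coloring_eq_parity
      (fun u => decide (∃ i, d.inLeaf i = u ∧ C i = 0)) (by
        rintro a b ⟨ha, hb, hab⟩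
        obtain ⟨i, hi, rfl⟩ := List.mem_iff_getElem.mp ha
        obtain ⟨j, hj, rfl⟩ := List.mem_iff_getElem.mp hb
        have := hC ⟨i, hi⟩ ⟨j, hj⟩ (Or.inl ⟨ha, hb, hab⟩)
        change decide (∃ k, d.inLeaf k = d.inLeaf ⟨i, hi⟩ ∧ _) ≠
          decide (∃ k, d.inLeaf k = d.inLeaf ⟨j, hj⟩ ∧ _)
        simpa [d.inLeaf_injective.eq_iff] using this)
    obtain ⟨c', hc'⟩ := d.output.coloring_eq_parity
      (fun u => decide (∃ i, d.outLeaf i = u ∧ C i = 0)) (by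
        rintro a b ⟨ha, hb, hab⟩
        obtain ⟨u, i, rfl, rfl⟩ := exists_matched_of_mem_output ha
        obtain ⟨u, j, rfl, rfl⟩ := exists_matched_of_mem_output hb
        have := hC i j (Or.inr ⟨ha, hb, hab⟩)
        simpa [d.outLeaf_injective.eq_iff] using this)
    refine ⟨c ^^ c', fun i => ?_⟩
    have h1 := hc (d.inLeaf i) (List.getElem_mem _)
    have h2 := hc' (d.outLeaf i) (List.getElem_mem _)
    simp only [d.inLeaf_injective.eq_iff, d.outLeaf_injective.eq_iff, exists_eq_left] at h1 h2
    rw [h1] at h2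
    revert h2
    cases c <;> cases c' <;> cases parity (d.outLeaf i) <;> cases parity (d.inLeaf i) <;> simp
  · rintro ⟨c, h⟩
    have hr : ∀ i j, (d.input.ThompsonAdj (d.inLeaf i) (d.inLeaf j) ∨
        d.output.ThompsonAdj (d.outLeaf i) (d.outLeaf j)) →
        parity (d.inLeaf i) ≠ parity (d.inLeaf j) := by
      rintro i j (h' | h')
      · exact h'.parity_ne
      · have := h'.parity_ne
        rw [h, h] at this
        exact fun e => this (by rw [e])
    refine SimpleGraph.Coloring.colorable (α := Bool)
      (SimpleGraph.Coloring.mk (fun i => parity (d.inLeaf i)) ?_)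
    rintro i j ⟨-, h' | h'⟩
    · exact hr i j h'
    · exact (hr j i h').symm

end TreeDiagram

/-! ### Reduction of tree diagrams -/

theorem MapsTo.merge {f : Equiv.Perm (Set.Ico (0 : ℝ) 1)} {u v : List Bool}
    (h0 : MapsTo f (u ++ [false]) (v ++ [false])) (h1 : MapsTo f (u ++ [true]) (v ++ [true])) :
    MapsTo f u v := by
  intro x hx1 hx2
  have hx : InInterval u x := ⟨hx1, hx2⟩
  rw [inInterval_iff] at hx
  rcases lt_or_ge (((x : ℝ) - binVal u) * 2 ^ u.length) (1 / 2) with h | h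
  · have hx' : InInterval (u ++ [false]) x := by
      rw [inInterval_append, inInterval_cons, inInterval_nil]
      simp only [Bool.false_eq_true, if_false, sub_zero]
      constructor <;> linarith [hx.1]
    rw [h0 x hx'.1 hx'.2]
    simp [binVal_append, binVal, pow_succ]
    field_simp
    simp
  · have hx' : InInterval (u ++ [true]) x := by
      rw [inInterval_append, inInterval_cons, inInterval_nil]
      simp only [if_true]
      constructor <;> linarith [hx.2]
    rw [h1 x hx'.1 hx'.2]
    simp [binVal_append, binVal, pow_succ]
    field_simp
    ring

theorem List.IsRotated.tail_eq_of_nodup {α : Type*} {a : α} {X Y : List α}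
    (h : (a :: X) ~r (a :: Y)) (hn : (a :: X).Nodup) : X = Y := by
  obtain ⟨n, hn'⟩ := h
  rw [← List.rotate_mod] at hn'
  have hlt : n % (a :: X).length < (a :: X).length := Nat.mod_lt _ (by simp)
  have e := List.getElem_of_eq hn' (i := 0) (by simp)
  rw [List.getElem_rotate] at e
  simp only [Nat.zero_add, Nat.mod_eq_of_lt hlt] at e
  have e2 : (a :: X)[n % (a :: X).length] = (a :: X)[0] := e
  have e3 := hn.getElem_inj_iff.mp e2
  rw [e3, List.rotate_zero] at hn'
  exact (List.cons.inj hn').2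

namespace TreeDiagram

variable {d : TreeDiagram} {f : Equiv.Perm (Set.Ico (0 : ℝ) 1)}

/-- Both carets of a dipole are contracted. The point to check is that the remaining identification
of leaves is still a rotation. -/
theorem exists_smaller (hd : ¬ d.Reduced) (ht : d.TypesAgree) (hf : d.Represents f) :
    ∃ d' : TreeDiagram, d'.input.leaves.length < d.input.leaves.length ∧ d'.TypesAgree ∧
      d'.Represents f := by
  rw [Reduced, not_not] at hd
  obtain ⟨u, v, h0, h1⟩ := hd
  have hnR := d.input.leaves_nodup
  have hnM := (List.nodup_rotate (n := d.shift)).mpr d.output.leaves_nodup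
  have m0 := (d.matched_iff _ _).mp h0
  have m1 := (d.matched_iff _ _).mp h1
  obtain ⟨Z, Z', hZ⟩ := List.append_of_mem m0
  obtain ⟨A, B, A', B', hlen, hR, hM, rfl, hZ2⟩ := List.zip_eq_append_iff.mp hZ
  obtain ⟨B1, B1', rfl, rfl, rfl⟩ := List.zip_eq_cons_iff.mp hZ2.symm
  obtain ⟨R', C, rfl, hR'⟩ := BinTree.exists_merge hR h1.mem_input
  -- The two leaves of the caret are consecutive in the input tree and occur only once there, so
  -- their partners are consecutive in the rotated output list.
  have hB : ∃ C', B1' = (v ++ [true]) :: C' := by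
    rw [hZ] at m1
    rw [hR] at hnR
    rcases B1' with _ | ⟨b, C'⟩
    · simp only [List.zip_nil_right, List.mem_append, List.mem_singleton, Prod.mk.injEq] at m1
      rcases m1 with m1 | m1
      · exact absurd rfl ((List.nodup_append.mp hnR).2.2 _ (List.of_mem_zip m1).1 _ (by simp))
      · simp at m1
    · refine ⟨C', ?_⟩
      simp only [List.zip_cons_cons, List.mem_append, List.mem_cons, Prod.mk.injEq] at m1
      rcases m1 with m1 | m1 | m1 | m1
      · exact absurd rfl ((List.nodup_append.mp hnR).2.2 _ (List.of_mem_zip m1).1 _ (by simp))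
      · simp at m1
      · rw [m1.2]
      · have := (List.nodup_append.mp hnR).2.1
        simp [(List.of_mem_zip m1).1] at this
  obtain ⟨C', rfl⟩ := hB
  obtain ⟨D, E, hS⟩ := List.append_of_mem h0.mem_output
  obtain ⟨S', E', rfl, hS'⟩ := BinTree.exists_merge hS h1.mem_output
  -- Both cyclic lists are cut open at the same leaf; having no repetitions, they are then equal as
  -- lists, and contracting the caret preserves this.
  have hrot : (v ++ [false]) :: (v ++ [true]) :: (C' ++ A') ~r
      (v ++ [false]) :: (v ++ [true]) :: (E' ++ D) := by
    have e1 : A' ++ (v ++ [false]) :: (v ++ [true]) :: C' ~r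
        (v ++ [false]) :: (v ++ [true]) :: C' ++ A' := List.isRotated_append
    have e2 : D ++ (v ++ [false]) :: (v ++ [true]) :: E' ~r
        (v ++ [false]) :: (v ++ [true]) :: E' ++ D := List.isRotated_append
    rw [← hM] at e1
    rw [← hS] at e2
    exact e1.symm.trans ((List.IsRotated.symm ⟨d.shift, rfl⟩).trans e2)
  have hCE : C' ++ A' = E' ++ D := by
    have hn : ((v ++ [false]) :: (v ++ [true]) :: (C' ++ A')).Nodup := by
      rw [hM] at hnM
      have := (List.isRotated_append (l := A')
        (l' := (v ++ [false]) :: (v ++ [true]) :: C')).nodup_iff.mp hnM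
      exact this
    exact (List.cons.inj (hrot.tail_eq_of_nodup hn)).2
  have hrot' : S'.leaves ~r A' ++ v :: C' := by
    rw [hS']
    have e1 : A' ++ v :: C' ~r v :: C' ++ A' := List.isRotated_append
    have e2 : D ++ v :: E' ~r v :: E' ++ D := List.isRotated_append
    rw [List.cons_append, hCE] at e1
    exact e2.trans e1.symm
  obtain ⟨k, hk⟩ := hrot'
  have hlen1 : d.output.leaves.length = d.input.leaves.length := d.length_eq
  have hl : S'.leaves.length = R'.leaves.length := by
    rw [hR, hS] at hlen1
    rw [hR', hS']
    simp at hlen1 ⊢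
    omega
  have hmatch : ∀ a b, (ofRotate R' S' k hl).Matched a b → d.Matched a b ∨ (a = u ∧ b = v) := by
    intro a b hab
    rw [matched_ofRotate, hk, hR', List.zip_append hlen, List.zip_cons_cons, List.mem_append,
      List.mem_cons] at hab
    rw [d.matched_iff, hZ]
    simp only [List.zip_cons_cons, List.mem_append, List.mem_cons]
    rcases hab with hab | hab | hab
    · exact .inl (.inl hab)
    · exact .inr (by simpa using hab)
    · exact .inl (.inr (.inr (.inr hab)))
  refine ⟨ofRotate R' S' k hl, ?_, fun a b hab => ?_, fun a b hab => ?_⟩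
  · simp [ofRotate, hR, hR']
  · rcases hmatch a b hab with h | ⟨rfl, rfl⟩
    · exact ht a b h
    · exact isTreeCongruence_typeFrom.parent (ht _ _ h0) (ht _ _ h1)
  · rcases hmatch a b hab with h | ⟨rfl, rfl⟩
    · exact hf a b h
    · exact MapsTo.merge (hf _ _ h0) (hf _ _ h1)

theorem exists_reduced (ht : d.TypesAgree) (hf : d.Represents f) :
    ∃ d' : TreeDiagram, d'.Reduced ∧ d'.TypesAgree ∧ d'.Represents f := by
  induction hn : d.input.leaves.length using Nat.strong_induction_on generalizing d with
  | _ n ih =>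
    by_cases hd : d.Reduced
    · exact ⟨d, hd, ht, hf⟩
    · obtain ⟨d', hlt, ht', hf'⟩ := exists_smaller hd ht hf
      exact ih _ (hn ▸ hlt) ht' hf' rfl

end TreeDiagram

/-- Reducedness can be dropped, because equality of types persists under reduction. -/
theorem mem_jonesSet_iff {g : ThompsonT} :
    g ∈ jonesSet ↔ ∃ d : TreeDiagram, d.TypesAgree ∧ d.Represents g := by
  constructor
  · rintro ⟨d, _, hg, hb⟩
    exact ⟨d, TreeDiagram.isBipartite_iff.mp hb, hg⟩
  · rintro ⟨d, ht, hg⟩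
    obtain ⟨d', hr, ht', hg'⟩ := TreeDiagram.exists_reduced ht hg
    exact ⟨d', hr, hg', TreeDiagram.isBipartite_iff.mpr ht'⟩

/-! ### The action of annular diagrams on circles -/

/-- The homeomorphism given by a cell: it maps `[p, p + r)` affinely onto `[p, p + s)`. -/
noncomputable def cellFun (p r s x : ℝ) : ℝ :=
  if x < p then x else if x < p + r then p + (x - p) * (s / r) else x - r + s

section cellFun

variable {p r s x : ℝ}

theorem cellFun_of_lt (h : x < p) : cellFun p r s x = x := by simp [cellFun, h]

theorem cellFun_of_mem (h : p ≤ x) (h' : x < p + r) :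
    cellFun p r s x = p + (x - p) * (s / r) := by
  simp [cellFun, not_lt.mpr h, h']

theorem cellFun_of_ge (h0 : 0 ≤ r) (h : p + r ≤ x) : cellFun p r s x = x - r + s := by
  simp [cellFun, not_lt.mpr h, not_lt.mpr (show p ≤ x by linarith)]

theorem cell_mid_bounds (hr : 0 < r) (hs : 0 < s) (h : p ≤ x) (h' : x < p + r) :
    p ≤ p + (x - p) * (s / r) ∧ p + (x - p) * (s / r) < p + s := by
  have hsr : 0 < s / r := by positivity
  constructor
  · nlinarith
  · have : (x - p) * (s / r) < r * (s / r) := by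
      apply mul_lt_mul_of_pos_right _ hsr; linarith
    have e : r * (s / r) = s := by field_simp
    linarith

theorem cellFun_cellFun_inv (hr : 0 < r) (hs : 0 < s) (x : ℝ) :
    cellFun p s r (cellFun p r s x) = x := by
  rcases lt_or_ge x p with h | h
  · rw [cellFun_of_lt h, cellFun_of_lt h]
  · rcases lt_or_ge x (p + r) with h' | h'
    · obtain ⟨b1, b2⟩ := cell_mid_bounds hr hs h h'
      rw [cellFun_of_mem h h', cellFun_of_mem b1 b2]
      field_simp
      ring
    · rw [cellFun_of_ge hr.le h', cellFun_of_ge hs.le (by linarith)]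
      ring

theorem cellFun_mem {t : ℝ} (hp : 0 ≤ p) (hr : 0 < r) (hs : 0 < s) (ht : 0 ≤ t)
    (hx : x ∈ Set.Ico 0 (p + r + t)) : cellFun p r s x ∈ Set.Ico 0 (p + s + t) := by
  rcases lt_or_ge x p with h | h
  · rw [cellFun_of_lt h]
    exact ⟨hx.1, by linarith⟩
  · rcases lt_or_ge x (p + r) with h' | h'
    · obtain ⟨b1, b2⟩ := cell_mid_bounds hr hs h h'
      rw [cellFun_of_mem h h']
      exact ⟨by linarith, by linarith⟩
    · rw [cellFun_of_ge hr.le h']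
      exact ⟨by linarith, by linarith [hx.2]⟩

theorem cellFun_interchange {q r' s' : ℝ} (hr : 0 < r) (hs : 0 < s) (hq : 0 ≤ q)
    (hr' : 0 < r') (hs' : 0 < s') (x : ℝ) :
    cellFun (p + s + q) r' s' (cellFun p r s x) = cellFun p r s (cellFun (p + r + q) r' s' x) := by
  rcases lt_or_ge x p with h | h
  · rw [cellFun_of_lt h, cellFun_of_lt (by linarith),
      cellFun_of_lt (show x < p + r + q by linarith), cellFun_of_lt h]
  · rcases lt_or_ge x (p + r) with h' | h'
    · obtain ⟨b1, b2⟩ := cell_mid_bounds hr hs h h'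
      rw [cellFun_of_lt (show x < p + r + q by linarith), cellFun_of_mem h h',
        cellFun_of_lt (by linarith)]
    · rw [cellFun_of_ge hr.le h']
      rcases lt_or_ge x (p + r + q) with h2 | h2
      · rw [cellFun_of_lt (by linarith), cellFun_of_lt h2, cellFun_of_ge hr.le h']
      · rcases lt_or_ge x (p + r + q + r') with h3 | h3
        · obtain ⟨b1, b2⟩ := cell_mid_bounds hr' hs' h2 h3
          rw [cellFun_of_mem (by linarith) (by linarith), cellFun_of_mem h2 h3,
            cellFun_of_ge hr.le (by linarith)]
          ring
        · rw [cellFun_of_ge hr'.le (by linarith), cellFun_of_ge hr'.le h3,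
            cellFun_of_ge hr.le (by linarith)]
          ring

end cellFun

/-- Moving the base point by `p` on a circle of length `p + q`. -/
noncomputable def rotFun (p q x : ℝ) : ℝ := if x < p then x + q else x - p

theorem rotFun_of_lt {p q x : ℝ} (h : x < p) : rotFun p q x = x + q := by simp [rotFun, h]

theorem rotFun_of_ge {p q x : ℝ} (h : p ≤ x) : rotFun p q x = x - p := by
  simp [rotFun, not_lt.mpr h]

theorem rotFun_mem {p q x : ℝ} (hp : 0 ≤ p) (hq : 0 ≤ q) (hx : x ∈ Set.Ico 0 (p + q)) :
    rotFun p q x ∈ Set.Ico 0 (q + p) := by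
  rcases lt_or_ge x p with h | h
  · rw [rotFun_of_lt h]; exact ⟨by linarith [hx.1], by linarith⟩
  · rw [rotFun_of_ge h]; exact ⟨by linarith, by linarith [hx.2]⟩

theorem rotFun_rotFun {p q t x : ℝ} (hq : 0 ≤ q) (ht : 0 ≤ t)
    (hx : x ∈ Set.Ico 0 (p + q + t)) :
    rotFun q (t + p) (rotFun p (q + t) x) = rotFun (p + q) t x := by
  rcases lt_or_ge x p with h | h
  · rw [rotFun_of_lt h, rotFun_of_ge (by linarith [hx.1]), rotFun_of_lt (by linarith)]
    ring
  · rw [rotFun_of_ge h]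
    rcases lt_or_ge x (p + q) with h' | h'
    · rw [rotFun_of_lt (by linarith), rotFun_of_lt h']
      ring
    · rw [rotFun_of_ge (by linarith), rotFun_of_ge h']
      ring

theorem rotFun_cellFun {p r s q t x : ℝ} (hp : 0 ≤ p) (hr : 0 < r) (hs : 0 < s) (hq : 0 ≤ q)
    (hx : x ∈ Set.Ico 0 (p + r + q + t)) :
    rotFun (p + s + q) t (cellFun p r s x) = cellFun (t + p) r s (rotFun (p + r + q) t x) := by
  rcases lt_or_ge x p with h | h
  · rw [cellFun_of_lt h, rotFun_of_lt (by linarith), rotFun_of_lt (by linarith),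
      cellFun_of_lt (by linarith)]
  · rcases lt_or_ge x (p + r) with h' | h'
    · obtain ⟨b1, b2⟩ := cell_mid_bounds hr hs h h'
      rw [cellFun_of_mem h h', rotFun_of_lt (by linarith), rotFun_of_lt (by linarith),
        cellFun_of_mem (by linarith) (by linarith)]
      ring
    · rw [cellFun_of_ge hr.le h']
      rcases lt_or_ge x (p + r + q) with h2 | h2
      · rw [rotFun_of_lt (by linarith), rotFun_of_lt h2, cellFun_of_ge hr.le (by linarith)]
        ring
      · rw [rotFun_of_ge (by linarith), rotFun_of_ge h2, cellFun_of_lt (by linarith [hx.2])]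
        ring

namespace SemigroupPresentation

variable {X : Type*} {P : SemigroupPresentation X} {r s : List X}

theorem length_pos_left (h : P.rel r s ∨ P.rel s r) : (0 : ℝ) < r.length := by
  rcases h with h | h
  · exact_mod_cast List.length_pos_iff.mpr (P.left_ne_nil _ _ h)
  · exact_mod_cast List.length_pos_iff.mpr (P.right_ne_nil _ _ h)

end SemigroupPresentation

namespace AnnularDiagram

variable {X : Type*} {P : SemigroupPresentation X}

/-- The map from the outer circle (of length `|u|`) to the inner circle (of length `|v|`) given by
an annular diagram. -/
noncomputable def eval : ∀ {u v : List X}, AnnularDiagram P u v → ℝ → ℝ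
  | _, _, id _, x => x
  | _, _, cell p r s _ _ _ _, x => cellFun p.length r.length s.length x
  | _, _, rot p q _ _, x => rotFun p.length q.length x
  | _, _, comp a b, x => b.eval (a.eval x)

theorem eval_mem {u v : List X} (a : AnnularDiagram P u v) {x : ℝ}
    (hx : x ∈ Set.Ico (0 : ℝ) u.length) : a.eval x ∈ Set.Ico (0 : ℝ) v.length := by
  induction a generalizing x with
  | id u => exact hx
  | cell p r s q h hu hv =>
    subst hu hv
    simp only [List.length_append, Nat.cast_add] at hx ⊢
    exact cellFun_mem (by positivity) (SemigroupPresentation.length_pos_left h)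
      (SemigroupPresentation.length_pos_left h.symm) (by positivity) hx
  | rot p q hu hv =>
    subst hu hv
    simp only [List.length_append, Nat.cast_add] at hx ⊢
    exact rotFun_mem (by positivity) (by positivity) hx
  | comp a b iha ihb => exact ihb (iha hx)

/-- Interchange and dipole removal hold on the whole line; the relations for rotations hold only on
the outer circle, hence the restriction on `x`. -/
theorem Equivalent.eval_eq {u v : List X} {a b : AnnularDiagram P u v} (h : Equivalent a b)
    {x : ℝ} (hx : x ∈ Set.Ico (0 : ℝ) u.length) : a.eval x = b.eval x := by
  induction h generalizing x with
  | refl a => rfl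
  | symm _ ih => exact (ih hx).symm
  | trans _ _ ih1 ih2 => exact (ih1 hx).trans (ih2 hx)
  | @congr _ _ _ a a' b b' _ _ ih1 ih2 =>
    change b.eval (a.eval x) = b'.eval (a'.eval x)
    rw [ih2 (a.eval_mem hx), ih1 hx]
  | assoc a b c => rfl
  | id_comp a => rfl
  | comp_id a => rfl
  | interchange p r s q r' s' t h h' hu hv hv' hw =>
    simp only [eval, List.length_append, Nat.cast_add]
    exact cellFun_interchange (SemigroupPresentation.length_pos_left h)
      (SemigroupPresentation.length_pos_left h.symm) (by positivity)
      (SemigroupPresentation.length_pos_left h') (SemigroupPresentation.length_pos_left h'.symm) x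
  | rot_nil u =>
    simp only [eval, List.length_nil, Nat.cast_zero]
    rw [rotFun_of_lt hx.2, add_zero]
  | rot_rot p q t hu hv hw =>
    subst hu
    simp only [eval, List.length_append, Nat.cast_add] at hx ⊢
    exact rotFun_rotFun (by positivity) (by positivity) hx
  | rot_cell p r s q t h hu hv hv' hw =>
    subst hu
    simp only [eval, List.length_append, Nat.cast_add] at hx ⊢
    exact rotFun_cellFun (by positivity) (SemigroupPresentation.length_pos_left h)
      (SemigroupPresentation.length_pos_left h.symm) (by positivity) hx
  | dipole p r s q h hu hv =>
    exact cellFun_cellFun_inv (SemigroupPresentation.length_pos_left h)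
      (SemigroupPresentation.length_pos_left h.symm) x

end AnnularDiagram

/-! ### The groupoid of annular diagrams -/

open CategoryTheory

/-- Words over the alphabet of a presentation, as the objects of the groupoid of annular
diagrams. -/
def AnnularObj {X : Type*} (_ : SemigroupPresentation X) : Type _ := List X

namespace AnnularObj

variable {X : Type*} {P : SemigroupPresentation X}

instance : Groupoid (AnnularObj P) where
  Hom u v := Quotient (AnnularDiagram.setoid P u v)
  id u := Quotient.mk _ (AnnularDiagram.id u)
  comp := Quotient.map₂ AnnularDiagram.comp fun _ _ h _ _ h' =>
    AnnularDiagram.Equivalent.congr h h'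
  id_comp := by
    rintro _ _ ⟨a⟩
    exact Quotient.sound (AnnularDiagram.Equivalent.id_comp a)
  comp_id := by
    rintro _ _ ⟨a⟩
    exact Quotient.sound (AnnularDiagram.Equivalent.comp_id a)
  assoc := by
    rintro _ _ _ _ ⟨a⟩ ⟨b⟩ ⟨c⟩
    exact Quotient.sound (AnnularDiagram.Equivalent.assoc a b c)
  inv := Quotient.map AnnularDiagram.mirror fun _ _ h => AnnularDiagram.mirror_congr h
  inv_comp := by
    rintro _ _ ⟨a⟩
    exact Quotient.sound (AnnularDiagram.mirror_comp a)
  comp_inv := by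
    rintro _ _ ⟨a⟩
    exact Quotient.sound (AnnularDiagram.comp_mirror a)

/-- The word of an object. -/
def word (u : AnnularObj P) : List X := u

/-- The class of an annular diagram. -/
def ofDiagram {u v : List X} (a : AnnularDiagram P u v) :
    (show AnnularObj P from u) ⟶ (show AnnularObj P from v) :=
  Quotient.mk (AnnularDiagram.setoid P u v) a

/-- The morphism with a single cell. -/
def cell {u v : AnnularObj P} (p r s q : List X) (h : P.rel r s ∨ P.rel s r)
    (hu : u.word = p ++ r ++ q) (hv : v.word = p ++ s ++ q) : u ⟶ v :=
  ofDiagram (.cell p r s q h hu hv)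

/-- The morphism that moves the base point. -/
def rot {u v : AnnularObj P} (p q : List X) (hu : u.word = p ++ q) (hv : v.word = q ++ p) :
    u ⟶ v :=
  ofDiagram (.rot p q hu hv)

theorem inv_cell {u v : AnnularObj P} (p r s q : List X) (h : P.rel r s ∨ P.rel s r)
    (hu : u.word = p ++ r ++ q) (hv : v.word = p ++ s ++ q) :
    Groupoid.inv (cell p r s q h hu hv) = cell p s r q h.symm hv hu := rfl

theorem inv_rot {u v : AnnularObj P} (p q : List X) (hu : u.word = p ++ q)
    (hv : v.word = q ++ p) : Groupoid.inv (rot p q hu hv) = rot q p hv hu := rfl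

theorem rot_nil {u : AnnularObj P} {p : List X} (hu : u.word = p ++ []) (hv : u.word = [] ++ p) :
    rot p [] hu hv = 𝟙 u := by
  obtain rfl : u = p := hv
  exact Quotient.sound (AnnularDiagram.Equivalent.rot_nil _)

theorem nil_rot {u : AnnularObj P} {p : List X} (hu : u.word = [] ++ p) (hv : u.word = p ++ []) :
    rot [] p hu hv = 𝟙 u := by
  rw [← inv_rot p [] hv hu, rot_nil hv hu]
  simp

theorem rot_rot {u v w : AnnularObj P} (p q t : List X) (hu : u.word = p ++ q ++ t)
    (hv : v.word = q ++ t ++ p) (hw : w.word = t ++ (p ++ q)) :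
    (rot p (q ++ t) (by simp [hu]) hv : u ⟶ v) ≫
      (rot q (t ++ p) (by simp [hv]) (by simp [hw]) : v ⟶ w) = rot (p ++ q) t hu hw :=
  Quotient.sound (AnnularDiagram.Equivalent.rot_rot p q t hu hv hw)

theorem cell_interchange {u v v' w : AnnularObj P} (p r s q r' s' t : List X)
    (h : P.rel r s ∨ P.rel s r) (h' : P.rel r' s' ∨ P.rel s' r')
    (hu : u.word = p ++ r ++ q ++ r' ++ t) (hv : v.word = p ++ s ++ q ++ r' ++ t)
    (hv' : v'.word = p ++ r ++ q ++ s' ++ t) (hw : w.word = p ++ s ++ q ++ s' ++ t) :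
    (cell p r s (q ++ r' ++ t) h (by simp [hu]) (by simp [hv]) : u ⟶ v) ≫
      (cell (p ++ s ++ q) r' s' t h' hv hw : v ⟶ w) =
    (cell (p ++ r ++ q) r' s' t h' hu hv' : u ⟶ v') ≫
      (cell p r s (q ++ s' ++ t) h (by simp [hv']) (by simp [hw]) : v' ⟶ w) :=
  Quotient.sound (AnnularDiagram.Equivalent.interchange p r s q r' s' t h h' hu hv hv' hw)

theorem cell_rot {u v v' w : AnnularObj P} (p r s q t : List X) (h : P.rel r s ∨ P.rel s r)
    (hu : u.word = p ++ r ++ q ++ t) (hv : v.word = p ++ s ++ q ++ t)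
    (hv' : v'.word = t ++ (p ++ r ++ q)) (hw : w.word = t ++ (p ++ s ++ q)) :
    (cell p r s (q ++ t) h (by simp [hu]) (by simp [hv]) : u ⟶ v) ≫
      (rot (p ++ s ++ q) t hv hw : v ⟶ w) =
    (rot (p ++ r ++ q) t hu hv' : u ⟶ v') ≫
      (cell (t ++ p) r s q h (by simp [hv']) (by simp [hw]) : v' ⟶ w) :=
  Quotient.sound (AnnularDiagram.Equivalent.rot_cell p r s q t h hu hv hv' hw)

theorem hom_induction {motive : ∀ {u v : AnnularObj P}, (u ⟶ v) → Prop}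
    (id : ∀ u, motive (𝟙 u))
    (cell : ∀ {u v : AnnularObj P} (p r s q : List X) (h : P.rel r s ∨ P.rel s r)
      (hu : u.word = p ++ r ++ q) (hv : v.word = p ++ s ++ q),
      motive (cell p r s q h hu hv : u ⟶ v))
    (rot : ∀ {u v : AnnularObj P} (p q : List X) (hu : u.word = p ++ q) (hv : v.word = q ++ p),
      motive (rot p q hu hv : u ⟶ v))
    (comp : ∀ {u v w : AnnularObj P} (a : u ⟶ v) (b : v ⟶ w), motive a → motive b →
      motive (a ≫ b)) {u v : AnnularObj P} (f : u ⟶ v) : motive f := by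
  suffices h : ∀ {u v : List X} (a : AnnularDiagram P u v), motive (ofDiagram a) by
    obtain ⟨a⟩ := f
    exact h a
  intro u v a
  induction a with
  | id u => exact id u
  | cell p r s q h hu hv => exact cell p r s q h hu hv
  | rot p q hu hv => exact rot p q hu hv
  | comp a b iha ihb => exact comp _ _ iha ihb

/-- The map from the outer to the inner circle, extended by zero. -/
noncomputable def eval {u v : AnnularObj P} (f : u ⟶ v) : ℝ → ℝ :=
  Quotient.lift
    (fun a : AnnularDiagram P u v => (Set.Ico (0 : ℝ) u.word.length).indicator a.eval)
    (fun _ _ h => funext fun x => by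
      by_cases hx : x ∈ Set.Ico (0 : ℝ) u.word.length
      · rw [Set.indicator_of_mem hx, Set.indicator_of_mem hx]
        exact AnnularDiagram.Equivalent.eval_eq h hx
      · rw [Set.indicator_of_notMem hx, Set.indicator_of_notMem hx]) f

variable {u v w : AnnularObj P} {x : ℝ}

theorem eval_ofDiagram {u v : List X} (a : AnnularDiagram P u v)
    (hx : x ∈ Set.Ico (0 : ℝ) u.length) : eval (ofDiagram a) x = a.eval x :=
  Set.indicator_of_mem (s := Set.Ico (0 : ℝ) u.length) hx _

theorem eval_mem (f : u ⟶ v) (hx : x ∈ Set.Ico (0 : ℝ) u.word.length) :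
    eval f x ∈ Set.Ico (0 : ℝ) v.word.length := by
  obtain ⟨a⟩ := f
  have e : eval (ofDiagram a) x = a.eval x := eval_ofDiagram a hx
  exact e ▸ a.eval_mem hx

theorem eval_comp (f : u ⟶ v) (g : v ⟶ w) (hx : x ∈ Set.Ico (0 : ℝ) u.word.length) :
    eval (f ≫ g) x = eval g (eval f x) := by
  obtain ⟨a⟩ := f
  obtain ⟨b⟩ := g
  have e1 : eval (ofDiagram a) x = a.eval x := eval_ofDiagram a hx
  have e2 : eval (ofDiagram (a.comp b)) x = (a.comp b).eval x := eval_ofDiagram _ hx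
  have e3 : eval (ofDiagram b) (a.eval x) = b.eval (a.eval x) :=
    eval_ofDiagram _ (a.eval_mem hx)
  change eval (ofDiagram (a.comp b)) x = eval (ofDiagram b) (eval (ofDiagram a) x)
  rw [e1, e2, e3]
  rfl

theorem eval_id (hx : x ∈ Set.Ico (0 : ℝ) u.word.length) : eval (𝟙 u) x = x :=
  eval_ofDiagram (AnnularDiagram.id (P := P) u.word) hx

theorem eval_inv_eval (f : u ⟶ v) (hx : x ∈ Set.Ico (0 : ℝ) u.word.length) :
    eval (Groupoid.inv f) (eval f x) = x := by
  rw [← eval_comp _ _ hx, Groupoid.comp_inv, eval_id hx]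

theorem eval_eval_inv (f : u ⟶ v) (hx : x ∈ Set.Ico (0 : ℝ) v.word.length) :
    eval f (eval (Groupoid.inv f) x) = x := by
  rw [← eval_comp _ _ hx, Groupoid.inv_comp, eval_id hx]

theorem eval_cell (p r s q : List X) (h : P.rel r s ∨ P.rel s r)
    (hu : u.word = p ++ r ++ q) (hv : v.word = p ++ s ++ q)
    (hx : x ∈ Set.Ico (0 : ℝ) u.word.length) :
    eval (cell p r s q h hu hv : u ⟶ v) x = cellFun p.length r.length s.length x :=
  eval_ofDiagram (AnnularDiagram.cell p r s q h hu hv) hx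

theorem eval_rot (p q : List X) (hu : u.word = p ++ q) (hv : v.word = q ++ p)
    (hx : x ∈ Set.Ico (0 : ℝ) u.word.length) :
    eval (rot p q hu hv : u ⟶ v) x = rotFun p.length q.length x :=
  eval_ofDiagram (AnnularDiagram.rot p q hu hv) hx

end AnnularObj

namespace AnnularObj

/-! ### Moving cells past each other and past rotations -/

section General

variable {X : Type*} {P : SemigroupPresentation X}

/-- The interchange law with all boundary segments as variables pinned down by equations, so that it
applies to words that agree only after reassociation. -/
theorem cell_comm {u v w v' : AnnularObj P} {p q p₂ q₂ p₃ q₃ p₄ q₄ r s r' s' : List X}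
    {h : P.rel r s ∨ P.rel s r} {h' : P.rel r' s' ∨ P.rel s' r'} (m t : List X)
    (hu : u.word = p ++ r ++ q) (hv : v.word = p ++ s ++ q) (hv₂ : v.word = p₂ ++ r' ++ q₂)
    (hw : w.word = p₂ ++ s' ++ q₂)
    (e₁ : q = m ++ r' ++ t) (e₂ : p₂ = p ++ s ++ m) (e₃ : q₂ = t) (e₄ : p₃ = p ++ r ++ m)
    (e₅ : q₃ = t) (e₆ : p₄ = p) (e₇ : q₄ = m ++ s' ++ t)
    (h₁ : u.word = p₃ ++ r' ++ q₃) (h₂ : v'.word = p₃ ++ s' ++ q₃)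
    (h₃ : v'.word = p₄ ++ r ++ q₄) (h₄ : w.word = p₄ ++ s ++ q₄) :
    (cell p r s q h hu hv : u ⟶ v) ≫ (cell p₂ r' s' q₂ h' hv₂ hw : v ⟶ w) =
      (cell p₃ r' s' q₃ h' h₁ h₂ : u ⟶ v') ≫ (cell p₄ r s q₄ h h₃ h₄ : v' ⟶ w) := by
  subst e₁ e₂ e₃ e₄ e₅ e₆ e₇
  exact cell_interchange _ _ _ _ _ _ _ h h' h₁ hv₂ h₂ hw

theorem cell_rot_left {u v v' w : AnnularObj P} {p r s q p₂ q₂ p₃ q₃ p₄ q₄ : List X}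
    {h : P.rel r s ∨ P.rel s r} (m t : List X)
    (hu : u.word = p ++ r ++ q) (hv : v.word = p ++ s ++ q) (hv₂ : v.word = p₂ ++ q₂)
    (hw : w.word = q₂ ++ p₂)
    (e₁ : q = m ++ t) (e₂ : p₂ = p ++ s ++ m) (e₃ : q₂ = t) (e₄ : p₃ = p ++ r ++ m) (e₅ : q₃ = t)
    (e₆ : p₄ = t ++ p) (e₇ : q₄ = m)
    (h₁ : u.word = p₃ ++ q₃) (h₂ : v'.word = q₃ ++ p₃)
    (h₃ : v'.word = p₄ ++ r ++ q₄) (h₄ : w.word = p₄ ++ s ++ q₄) :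
    (cell p r s q h hu hv : u ⟶ v) ≫ (rot p₂ q₂ hv₂ hw : v ⟶ w) =
      (rot p₃ q₃ h₁ h₂ : u ⟶ v') ≫ (cell p₄ r s q₄ h h₃ h₄ : v' ⟶ w) := by
  subst e₁ e₂ e₃ e₄ e₅ e₆ e₇
  exact cell_rot _ _ _ _ _ h h₁ hv₂ h₂ hw

theorem rot_comp_rot {u v : AnnularObj P} {p q : List X} (hu : u.word = p ++ q)
    (hv : v.word = q ++ p) :
    (rot p q hu hv : u ⟶ v) ≫ (rot q p hv hu : v ⟶ u) = 𝟙 u := by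
  rw [← inv_rot p q hu hv, Groupoid.comp_inv]

/-- Composing with the inverse rotations on both sides reverses a commutation square. Thus the rule
for a cell before the cut gives the one for a cell after it. -/
theorem comp_rot_of_rot_comp {u v v' w : AnnularObj P} {p q p' q' : List X} {a : u ⟶ v}
    {b : v' ⟶ w} (h₁ : u.word = p ++ q) (h₂ : v'.word = q ++ p) (h₃ : v.word = p' ++ q')
    (h₄ : w.word = q' ++ p')
    (h : b ≫ (rot q' p' h₄ h₃ : w ⟶ v) = (rot q p h₂ h₁ : v' ⟶ u) ≫ a) :
    a ≫ (rot p' q' h₃ h₄ : v ⟶ w) = (rot p q h₁ h₂ : u ⟶ v') ≫ b := by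
  rw [← cancel_mono (rot q' p' h₄ h₃), Category.assoc, Category.assoc, h, rot_comp_rot,
    ← Category.assoc, rot_comp_rot, Category.id_comp, Category.comp_id]

theorem cell_rot_right {u v v' w : AnnularObj P} {p r s q p₂ q₂ p₃ q₃ p₄ q₄ : List X}
    {h : P.rel r s ∨ P.rel s r} (t m : List X)
    (hu : u.word = p ++ r ++ q) (hv : v.word = p ++ s ++ q) (hv₂ : v.word = p₂ ++ q₂)
    (hw : w.word = q₂ ++ p₂)
    (e₁ : p = t ++ m) (e₂ : p₂ = t) (e₃ : q₂ = m ++ s ++ q) (e₄ : p₃ = t) (e₅ : q₃ = m ++ r ++ q)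
    (e₆ : p₄ = m) (e₇ : q₄ = q ++ t)
    (h₁ : u.word = p₃ ++ q₃) (h₂ : v'.word = q₃ ++ p₃)
    (h₃ : v'.word = p₄ ++ r ++ q₄) (h₄ : w.word = p₄ ++ s ++ q₄) :
    (cell p r s q h hu hv : u ⟶ v) ≫ (rot p₂ q₂ hv₂ hw : v ⟶ w) =
      (rot p₃ q₃ h₁ h₂ : u ⟶ v') ≫ (cell p₄ r s q₄ h h₃ h₄ : v' ⟶ w) :=
  comp_rot_of_rot_comp _ _ _ _ <| cell_rot_left q t _ _ _ _ e₇ (by rw [e₃, e₆]) e₂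
    (by rw [e₅, e₆]) e₄ (by rw [e₁, e₆]) rfl _ _ _ _

end General

/-! ### The cells of `⟨e, f ∣ e = ff, f = fe⟩` -/

/-- Objects of the groupoid of annular diagrams over `⟨e, f ∣ e = ff, f = fe⟩`. -/
abbrev EFObj := AnnularObj efPresentation

/-- The word `w` as an object. -/
abbrev ofWord (w : List EF) : EFObj := w

theorem rel_e : efPresentation.rel [EF.e] [EF.f, EF.f] := .inl ⟨rfl, rfl⟩

theorem rel_f : efPresentation.rel [EF.f] [EF.f, EF.e] := .inr ⟨rfl, rfl⟩

/-- Replace a letter `e` by `ff`. -/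
def splitE {u v : EFObj} (p q : List EF) (hu : u.word = p ++ [EF.e] ++ q)
    (hv : v.word = p ++ [EF.f, EF.f] ++ q) : u ⟶ v :=
  cell p [EF.e] [EF.f, EF.f] q (.inl rel_e) hu hv

/-- Replace a letter `f` by `fe`. -/
def splitF {u v : EFObj} (p q : List EF) (hu : u.word = p ++ [EF.f] ++ q)
    (hv : v.word = p ++ [EF.f, EF.e] ++ q) : u ⟶ v :=
  cell p [EF.f] [EF.f, EF.e] q (.inl rel_f) hu hv

/-- Replace a letter `f` by `fff`. -/
def tri {u v : EFObj} (p q : List EF) (hu : u.word = p ++ [EF.f] ++ q)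
    (hv : v.word = p ++ [EF.f, EF.f, EF.f] ++ q) : u ⟶ v :=
  (splitF p q hu (by simp [word]) : u ⟶ ofWord (p ++ [EF.f, EF.e] ++ q)) ≫
    splitE (p ++ [EF.f]) q (by simp [word]) (by simp [hv])

theorem splitF_comp_splitE {u v w : EFObj} {p q p' : List EF} (hu : u.word = p ++ [EF.f] ++ q)
    (hv : v.word = p ++ [EF.f, EF.e] ++ q) (hv' : v.word = p' ++ [EF.e] ++ q)
    (hw : w.word = p' ++ [EF.f, EF.f] ++ q) (e : p' = p ++ [EF.f]) :
    (splitF p q hu hv : u ⟶ v) ≫ (splitE p' q hv' hw : v ⟶ w) =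
      tri p q hu (by simp [hw, e]) := by
  subst e
  obtain rfl : v = ofWord (p ++ [EF.f, EF.e] ++ q) := hv
  rfl

/-- `tri` commutes with cells on its right. -/
theorem tri_cell_comm {u v w v' : EFObj} {p q p₂ q₂ p₃ q₃ p₄ q₄ r s : List EF}
    {h : efPresentation.rel r s ∨ efPresentation.rel s r} (m t : List EF)
    (hu : u.word = p ++ [EF.f] ++ q) (hv : v.word = p ++ [EF.f, EF.f, EF.f] ++ q)
    (hv₂ : v.word = p₂ ++ r ++ q₂) (hw : w.word = p₂ ++ s ++ q₂)
    (e₁ : q = m ++ r ++ t) (e₂ : p₂ = p ++ [EF.f, EF.f, EF.f] ++ m) (e₃ : q₂ = t)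
    (e₄ : p₃ = p ++ [EF.f] ++ m) (e₅ : q₃ = t) (e₆ : p₄ = p) (e₇ : q₄ = m ++ s ++ t)
    (h₁ : u.word = p₃ ++ r ++ q₃) (h₂ : v'.word = p₃ ++ s ++ q₃)
    (h₃ : v'.word = p₄ ++ [EF.f] ++ q₄) (h₄ : w.word = p₄ ++ [EF.f, EF.f, EF.f] ++ q₄) :
    (tri p q hu hv : u ⟶ v) ≫ (cell p₂ r s q₂ h hv₂ hw : v ⟶ w) =
      (cell p₃ r s q₃ h h₁ h₂ : u ⟶ v') ≫ (tri p₄ q₄ h₃ h₄ : v' ⟶ w) := by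
  subst e₁ e₂ e₃ e₄ e₅ e₆ e₇
  rw [tri, Category.assoc, splitE, cell_comm (v' := ofWord (p₄ ++ [EF.f, EF.e] ++ (m ++ s ++ q₃)))
    (p₃ := p₄ ++ [EF.f, EF.e] ++ m) (q₃ := q₃) (p₄ := p₄ ++ [EF.f]) (q₄ := m ++ s ++ q₃) m q₃,
    ← Category.assoc, splitF, cell_comm (v' := v') (p₃ := p₄ ++ [EF.f] ++ m) (q₃ := q₃)
    (p₄ := p₄) (q₄ := m ++ s ++ q₃) m q₃, Category.assoc]
  · rfl
  all_goals simp [word]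

/-- `tri` commutes with cells on its left. -/
theorem cell_tri_comm {u v w v' : EFObj} {p q p₂ q₂ p₃ q₃ p₄ q₄ r s : List EF}
    {h : efPresentation.rel r s ∨ efPresentation.rel s r} (m t : List EF)
    (hu : u.word = p ++ r ++ q) (hv : v.word = p ++ s ++ q)
    (hv₂ : v.word = p₂ ++ [EF.f] ++ q₂) (hw : w.word = p₂ ++ [EF.f, EF.f, EF.f] ++ q₂)
    (e₁ : q = m ++ [EF.f] ++ t) (e₂ : p₂ = p ++ s ++ m) (e₃ : q₂ = t)
    (e₄ : p₃ = p ++ r ++ m) (e₅ : q₃ = t) (e₆ : p₄ = p) (e₇ : q₄ = m ++ [EF.f, EF.f, EF.f] ++ t)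
    (h₁ : u.word = p₃ ++ [EF.f] ++ q₃) (h₂ : v'.word = p₃ ++ [EF.f, EF.f, EF.f] ++ q₃)
    (h₃ : v'.word = p₄ ++ r ++ q₄) (h₄ : w.word = p₄ ++ s ++ q₄) :
    (cell p r s q h hu hv : u ⟶ v) ≫ (tri p₂ q₂ hv₂ hw : v ⟶ w) =
      (tri p₃ q₃ h₁ h₂ : u ⟶ v') ≫ (cell p₄ r s q₄ h h₃ h₄ : v' ⟶ w) := by
  subst e₁ e₂ e₃ e₄ e₅ e₆ e₇
  rw [tri, ← Category.assoc, splitF,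
    cell_comm (v' := ofWord (p₄ ++ r ++ m ++ [EF.f, EF.e] ++ q₃))
    (p₃ := p₄ ++ r ++ m) (q₃ := q₃) (p₄ := p₄) (q₄ := m ++ [EF.f, EF.e] ++ q₃) m q₃,
    Category.assoc, splitE, cell_comm (v' := v') (p₃ := p₄ ++ r ++ m ++ [EF.f]) (q₃ := q₃)
    (p₄ := p₄) (q₄ := m ++ [EF.f, EF.f, EF.f] ++ q₃) (m ++ [EF.f]) q₃, ← Category.assoc]
  · rfl
  all_goals simp [word]

theorem tri_comm {u v w v' : EFObj} {p q p₂ q₂ p₃ q₃ p₄ q₄ : List EF} (m t : List EF)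
    (hu : u.word = p ++ [EF.f] ++ q) (hv : v.word = p ++ [EF.f, EF.f, EF.f] ++ q)
    (hv₂ : v.word = p₂ ++ [EF.f] ++ q₂) (hw : w.word = p₂ ++ [EF.f, EF.f, EF.f] ++ q₂)
    (e₁ : q = m ++ [EF.f] ++ t) (e₂ : p₂ = p ++ [EF.f, EF.f, EF.f] ++ m) (e₃ : q₂ = t)
    (e₄ : p₃ = p ++ [EF.f] ++ m) (e₅ : q₃ = t) (e₆ : p₄ = p)
    (e₇ : q₄ = m ++ [EF.f, EF.f, EF.f] ++ t)
    (h₁ : u.word = p₃ ++ [EF.f] ++ q₃) (h₂ : v'.word = p₃ ++ [EF.f, EF.f, EF.f] ++ q₃)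
    (h₃ : v'.word = p₄ ++ [EF.f] ++ q₄) (h₄ : w.word = p₄ ++ [EF.f, EF.f, EF.f] ++ q₄) :
    (tri p q hu hv : u ⟶ v) ≫ (tri p₂ q₂ hv₂ hw : v ⟶ w) =
      (tri p₃ q₃ h₁ h₂ : u ⟶ v') ≫ (tri p₄ q₄ h₃ h₄ : v' ⟶ w) := by
  subst e₁ e₂ e₃ e₄ e₅ e₆ e₇
  rw [tri.eq_1 (p₄ ++ _ ++ m), ← Category.assoc, splitF, tri_cell_comm
    (v' := ofWord (p₄ ++ [EF.f] ++ m ++ [EF.f, EF.e] ++ q₃))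
    (p₃ := p₄ ++ [EF.f] ++ m) (q₃ := q₃) (p₄ := p₄) (q₄ := m ++ [EF.f, EF.e] ++ q₃) m q₃,
    Category.assoc, splitE, tri_cell_comm (v' := v') (p₃ := p₄ ++ [EF.f] ++ m ++ [EF.f])
    (q₃ := q₃) (p₄ := p₄) (q₄ := m ++ [EF.f, EF.f, EF.f] ++ q₃) (m ++ [EF.f]) q₃,
    ← Category.assoc]
  · rfl
  all_goals simp [word]

theorem tri_rot_left {u v v' w : EFObj} {p q p₂ q₂ p₃ q₃ p₄ q₄ : List EF} (m t : List EF)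
    (hu : u.word = p ++ [EF.f] ++ q) (hv : v.word = p ++ [EF.f, EF.f, EF.f] ++ q)
    (hv₂ : v.word = p₂ ++ q₂) (hw : w.word = q₂ ++ p₂)
    (e₁ : q = m ++ t) (e₂ : p₂ = p ++ [EF.f, EF.f, EF.f] ++ m) (e₃ : q₂ = t)
    (e₄ : p₃ = p ++ [EF.f] ++ m) (e₅ : q₃ = t) (e₆ : p₄ = t ++ p) (e₇ : q₄ = m)
    (h₁ : u.word = p₃ ++ q₃) (h₂ : v'.word = q₃ ++ p₃)
    (h₃ : v'.word = p₄ ++ [EF.f] ++ q₄) (h₄ : w.word = p₄ ++ [EF.f, EF.f, EF.f] ++ q₄) :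
    (tri p q hu hv : u ⟶ v) ≫ (rot p₂ q₂ hv₂ hw : v ⟶ w) =
      (rot p₃ q₃ h₁ h₂ : u ⟶ v') ≫ (tri p₄ q₄ h₃ h₄ : v' ⟶ w) := by
  subst e₁ e₂ e₃ e₄ e₅ e₆ e₇
  rw [tri, Category.assoc, splitE, cell_rot_left
    (v' := ofWord (q₃ ++ p ++ [EF.f, EF.e] ++ q₄)) (p₃ := p ++ [EF.f, EF.e] ++ q₄) (q₃ := q₃)
    (p₄ := q₃ ++ p ++ [EF.f]) (q₄ := q₄) q₄ q₃,
    ← Category.assoc, splitF, cell_rot_left (v' := v') (p₃ := p ++ [EF.f] ++ q₄) (q₃ := q₃)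
    (p₄ := q₃ ++ p) (q₄ := q₄) q₄ q₃, Category.assoc]
  · rfl
  all_goals simp [word]

theorem tri_rot_right {u v v' w : EFObj} {p q p₂ q₂ p₃ q₃ p₄ q₄ : List EF} (t m : List EF)
    (hu : u.word = p ++ [EF.f] ++ q) (hv : v.word = p ++ [EF.f, EF.f, EF.f] ++ q)
    (hv₂ : v.word = p₂ ++ q₂) (hw : w.word = q₂ ++ p₂)
    (e₁ : p = t ++ m) (e₂ : p₂ = t) (e₃ : q₂ = m ++ [EF.f, EF.f, EF.f] ++ q) (e₄ : p₃ = t)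
    (e₅ : q₃ = m ++ [EF.f] ++ q) (e₆ : p₄ = m) (e₇ : q₄ = q ++ t)
    (h₁ : u.word = p₃ ++ q₃) (h₂ : v'.word = q₃ ++ p₃)
    (h₃ : v'.word = p₄ ++ [EF.f] ++ q₄) (h₄ : w.word = p₄ ++ [EF.f, EF.f, EF.f] ++ q₄) :
    (tri p q hu hv : u ⟶ v) ≫ (rot p₂ q₂ hv₂ hw : v ⟶ w) =
      (rot p₃ q₃ h₁ h₂ : u ⟶ v') ≫ (tri p₄ q₄ h₃ h₄ : v' ⟶ w) :=
  comp_rot_of_rot_comp _ _ _ _ <| tri_rot_left q t _ _ _ _ e₇ (by rw [e₃, e₆]) e₂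
    (by rw [e₅, e₆]) e₄ (by rw [e₁, e₆]) rfl _ _ _ _

end AnnularObj

namespace AnnularObj

/-! ### Words without the letter `e` -/

/-- The word `f ^ n`. -/
abbrev fPow (n : ℕ) : List EF := List.replicate n EF.f

/-- The word `f ^ (2m + 2)` as an object. -/
def fObj (m : ℕ) : EFObj := fPow (2 * m + 2)

theorem word_fObj (m : ℕ) : (fObj m).word = fPow (2 * m + 2) := rfl

theorem fPow_split {n i : ℕ} (h : i ≤ n) : fPow n = fPow i ++ fPow (n - i) := by
  rw [fPow, fPow, fPow, ← List.replicate_add, Nat.add_sub_cancel' h]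

theorem fPow_split_f {n i : ℕ} (h : i < n) : fPow n = fPow i ++ [EF.f] ++ fPow (n - 1 - i) := by
  change _ = List.replicate i EF.f ++ List.replicate 1 EF.f ++ _
  rw [← List.replicate_add, ← List.replicate_add]
  congr 1
  omega

theorem fPow_split_fff {n i : ℕ} (h : i < n) :
    fPow (n + 2) = fPow i ++ [EF.f, EF.f, EF.f] ++ fPow (n - 1 - i) := by
  change _ = List.replicate i EF.f ++ List.replicate 3 EF.f ++ _
  rw [← List.replicate_add, ← List.replicate_add]
  congr 1
  omega

theorem eq_fPow_of_append {n : ℕ} {p q : List EF} (h : fPow n = p ++ q) :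
    p = fPow p.length ∧ q = fPow (n - p.length) ∧ p.length ≤ n := by
  have hl := congrArg List.length h
  simp only [fPow, List.length_replicate, List.length_append] at hl
  obtain ⟨_, h1, h2⟩ := List.append_eq_replicate_iff.mp h.symm
  refine ⟨h1, h2.trans ?_, by omega⟩
  congr 1
  omega

theorem eq_fPow_of_append_f {n : ℕ} {p q : List EF} (h : fPow n = p ++ [EF.f] ++ q) :
    p = fPow p.length ∧ q = fPow (n - 1 - p.length) ∧ p.length < n := by
  rw [List.append_assoc] at h
  have hl := congrArg List.length h
  simp only [fPow, List.length_replicate, List.length_append, List.length_cons,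
    List.length_nil] at hl
  obtain ⟨h1, h2, -⟩ := eq_fPow_of_append h
  obtain ⟨-, h3, -⟩ := eq_fPow_of_append h2.symm
  refine ⟨h1, h3.trans ?_, by omega⟩
  congr 1
  simp only [List.length_singleton]
  omega

theorem word_fObj_eq_f {m i : ℕ} (h : i < 2 * m + 2) :
    (fObj m).word = fPow i ++ [EF.f] ++ fPow (2 * m + 2 - 1 - i) := fPow_split_f h

theorem word_fObj_eq_fff {m i : ℕ} (h : i < 2 * m + 2) :
    (fObj (m + 1)).word = fPow i ++ [EF.f, EF.f, EF.f] ++ fPow (2 * m + 2 - 1 - i) :=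
  fPow_split_fff h

theorem word_fObj_eq_append {m r : ℕ} (h : r ≤ 2 * m + 2) :
    (fObj m).word = fPow r ++ fPow (2 * m + 2 - r) := fPow_split h

theorem word_fObj_eq_append' {m r : ℕ} (h : r ≤ 2 * m + 2) :
    (fObj m).word = fPow (2 * m + 2 - r) ++ fPow r := by
  rw [word_fObj, fPow, fPow, fPow, ← List.replicate_add, Nat.sub_add_cancel h]

/-- Replace the `i`-th letter of `f ^ (2m + 2)` by `fff`. -/
def lam (m i : ℕ) (h : i < 2 * m + 2) : fObj m ⟶ fObj (m + 1) :=
  tri (fPow i) (fPow (2 * m + 2 - 1 - i)) (word_fObj_eq_f h) (word_fObj_eq_fff h)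

/-- Move the base point of the circle labelled `f ^ (2m + 2)` by `r` letters. -/
def fRot (m r : ℕ) (h : r ≤ 2 * m + 2) : fObj m ⟶ fObj m :=
  rot (fPow r) (fPow (2 * m + 2 - r)) (word_fObj_eq_append h) (word_fObj_eq_append' h)

theorem fPow_eq {k l : ℕ} (h : k = l) : fPow k = fPow l := by rw [h]

theorem fPow_append_f (a b c : ℕ) (h : a + 1 + b = c) : fPow a ++ [EF.f] ++ fPow b = fPow c := by
  change List.replicate a EF.f ++ List.replicate 1 EF.f ++ _ = _
  rw [← List.replicate_add, ← List.replicate_add, h]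

theorem fPow_append_fff (a b c : ℕ) (h : a + 3 + b = c) :
    fPow a ++ [EF.f, EF.f, EF.f] ++ fPow b = fPow c := by
  change List.replicate a EF.f ++ List.replicate 3 EF.f ++ _ = _
  rw [← List.replicate_add, ← List.replicate_add, h]

theorem fPow_append (a b c : ℕ) (h : a + b = c) : fPow a ++ fPow b = fPow c := by
  rw [fPow, fPow, ← List.replicate_add, h]

/-- A replacement at `i` lengthens the word by two letters and so shifts every later position by 2.
-/
theorem lam_comm {m i j : ℕ} (hij : i < j) (hj : j < 2 * m + 2) :
    lam m i (by omega) ≫ lam (m + 1) (j + 2) (by omega) =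
      lam m j hj ≫ lam (m + 1) i (by omega) := by
  refine tri_comm (fPow (j - i - 1)) (fPow (2 * m + 2 - 1 - j)) _ _ _ _ ?_ ?_ ?_ ?_ ?_ ?_ ?_ _ _ _ _
  · rw [fPow_append_f _ _ _ rfl]; exact fPow_eq (by omega)
  · rw [fPow_append_fff _ _ _ rfl]; exact fPow_eq (by omega)
  · exact fPow_eq (by omega)
  · rw [fPow_append_f _ _ _ rfl]; exact fPow_eq (by omega)
  · rfl
  · rfl
  · rw [fPow_append_fff _ _ _ rfl]; exact fPow_eq (by omega)

theorem lam_fRot_lt {m i k : ℕ} (h : i < k) (hk : k ≤ 2 * m + 2) :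
    lam m i (by omega) ≫ fRot (m + 1) (k + 2) (by omega) =
      fRot m k hk ≫ lam m (i + (2 * m + 2 - k)) (by omega) := by
  refine tri_rot_left (fPow (k - i - 1)) (fPow (2 * m + 2 - k)) _ _ _ _ ?_ ?_ ?_ ?_ ?_ ?_ ?_ _ _ _ _
  · rw [fPow_append _ _ _ rfl]; exact fPow_eq (by omega)
  · rw [fPow_append_fff _ _ _ rfl]; exact fPow_eq (by omega)
  · exact fPow_eq (by omega)
  · rw [fPow_append_f _ _ _ rfl]; exact fPow_eq (by omega)
  · rfl
  · rw [fPow_append _ _ _ rfl]; exact fPow_eq (by omega)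
  · exact fPow_eq (by omega)

theorem lam_fRot_ge {m i k : ℕ} (h : k ≤ i) (hi : i < 2 * m + 2) :
    lam m i hi ≫ fRot (m + 1) k (by omega) =
      fRot m k (by omega) ≫ lam m (i - k) (by omega) := by
  refine tri_rot_right (fPow k) (fPow (i - k)) _ _ _ _ ?_ ?_ ?_ ?_ ?_ ?_ ?_ _ _ _ _
  · rw [fPow_append _ _ _ rfl]; exact fPow_eq (by omega)
  · rfl
  · rw [fPow_append_fff _ _ _ rfl]; exact fPow_eq (by omega)
  · rfl
  · rw [fPow_append_f _ _ _ rfl]; exact fPow_eq (by omega)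
  · rfl
  · rw [fPow_append _ _ _ rfl]; exact fPow_eq (by omega)

theorem rot_congr {u v : EFObj} {p p' q q' : List EF} (hp : p = p') (hq : q = q')
    (hu : u.word = p ++ q) (hv : v.word = q ++ p) :
    (rot p q hu hv : u ⟶ v) = rot p' q' (by rw [hu, hp, hq]) (by rw [hv, hp, hq]) := by
  subst hp hq
  rfl

theorem fRot_comp {m k l : ℕ} (h : k + l ≤ 2 * m + 2) :
    fRot m k (by omega) ≫ fRot m l (by omega) = fRot m (k + l) h := by
  have hn : 2 * m + 2 = k + l + (2 * m + 2 - k - l) := by omega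
  generalize hj : 2 * m + 2 - k - l = j at hn
  have e := rot_rot (P := efPresentation) (u := fObj m) (v := fObj m) (w := fObj m)
    (fPow k) (fPow l) (fPow j)
    (by rw [word_fObj, hn, fPow_append _ _ _ rfl, fPow_append _ _ _ rfl])
    (by rw [word_fObj, hn, fPow_append _ _ _ rfl, fPow_append _ _ _ rfl]; exact fPow_eq (by omega))
    (by rw [word_fObj, hn, fPow_append _ _ _ rfl, fPow_append _ _ _ rfl]; exact fPow_eq (by omega))
  rw [rot_congr (fPow_append k l _ rfl) rfl, rot_congr rfl (fPow_append l j _ rfl),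
    rot_congr (p := fPow l) rfl (fPow_append j k _ rfl)] at e
  have e1 : fRot m k (by omega) = _ := rot_congr rfl (fPow_eq (show 2 * m + 2 - k = l + j by omega)) _ _
  have e2 : fRot m l (by omega) = _ := rot_congr rfl (fPow_eq (show 2 * m + 2 - l = j + k by omega)) _ _
  have e3 : fRot m (k + l) h = _ :=
    rot_congr rfl (fPow_eq (show 2 * m + 2 - (k + l) = j by omega)) _ _
  rw [e1, e2, e3]
  exact e

theorem fRot_zero (m : ℕ) : fRot m 0 (by omega) = 𝟙 (fObj m) := nil_rot _ _

theorem fRot_full (m : ℕ) : fRot m (2 * m + 2) le_rfl = 𝟙 (fObj m) := by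
  have e := rot_congr (u := fObj m) (v := fObj m) (p := fPow (2 * m + 2)) rfl
    (fPow_eq (show 2 * m + 2 - (2 * m + 2) = 0 by omega)) (fPow_split le_rfl)
    (by simp [word_fObj])
  exact e.trans (rot_nil _ _)

theorem exists_fRot_comp {m k l : ℕ} (hk : k ≤ 2 * m + 2) (hl : l ≤ 2 * m + 2) :
    ∃ (r : ℕ) (hr : r ≤ 2 * m + 2), fRot m k hk ≫ fRot m l hl = fRot m r hr := by
  rcases le_or_gt (k + l) (2 * m + 2) with h | h
  · exact ⟨_, h, fRot_comp h⟩
  -- The second rotation is split into the part that completes a full turn and the remainder.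
  · refine ⟨l - (2 * m + 2 - k), by omega, ?_⟩
    have e := fRot_comp (m := m) (k := 2 * m + 2 - k) (l := l - (2 * m + 2 - k)) (by omega)
    have e' := fRot_comp (m := m) (k := k) (l := 2 * m + 2 - k) (by omega)
    have e1 : fRot m (2 * m + 2 - k + (l - (2 * m + 2 - k))) (by omega) = fRot m l hl := by
      congr 1; omega
    have e2 : fRot m (k + (2 * m + 2 - k)) (by omega) = 𝟙 _ := by
      rw [← fRot_full]; congr 1; omega
    rw [← e1, ← e, ← Category.assoc, e', e2, Category.id_comp]

theorem exists_inv_fRot {m k : ℕ} (hk : k ≤ 2 * m + 2) :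
    ∃ (r : ℕ) (hr : r ≤ 2 * m + 2), Groupoid.inv (fRot m k hk) = fRot m r hr := by
  refine ⟨2 * m + 2 - k, by omega, ?_⟩
  have e' := fRot_comp (m := m) (k := k) (l := 2 * m + 2 - k) (by omega)
  have e2 : fRot m (k + (2 * m + 2 - k)) (by omega) = 𝟙 _ := by
    rw [← fRot_full]; congr 1; omega
  rw [e2] at e'
  rw [← cancel_epi (fRot m k hk), e', Groupoid.comp_inv]

/-- Morphisms between powers of `f` generated by rotations and the replacement of `f` by `fff`. -/
inductive Generated : ∀ {m k : ℕ}, (fObj m ⟶ fObj k) → Prop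
  | id (m : ℕ) : Generated (𝟙 (fObj m))
  | lam {m i : ℕ} (h : i < 2 * m + 2) : Generated (lam m i h)
  | inv_lam {m i : ℕ} (h : i < 2 * m + 2) : Generated (Groupoid.inv (AnnularObj.lam m i h))
  | rot {m r : ℕ} (h : r ≤ 2 * m + 2) : Generated (fRot m r h)
  | comp {m k l : ℕ} {a : fObj m ⟶ fObj k} {b : fObj k ⟶ fObj l} :
      Generated a → Generated b → Generated (a ≫ b)

theorem fObj_injective {m k : ℕ} (h : fObj m = fObj k) : m = k := by
  have := congrArg List.length (show fPow (2 * m + 2) = fPow (2 * k + 2) from h)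
  simp at this
  omega

theorem tri_eq_lam {m : ℕ} {v : EFObj} {p q : List EF} (hu : (fObj m).word = p ++ [EF.f] ++ q)
    (hv : v.word = p ++ [EF.f, EF.f, EF.f] ++ q) :
    ∃ (h : v = fObj (m + 1)) (hi : p.length < 2 * m + 2),
      tri p q hu hv = lam m p.length hi ≫ eqToHom h.symm := by
  obtain ⟨hp, hq, hi⟩ := eq_fPow_of_append_f hu
  have h : v = fObj (m + 1) := by
    change v.word = _
    rw [hv]
    conv_lhs => rw [hp, hq]
    exact (fPow_split_fff hi).symm
  subst h
  refine ⟨rfl, hi, ?_⟩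
  generalize hn : p.length = n at *
  subst hp hq
  simp [lam]

theorem rot_eq_fRot {m : ℕ} {v : EFObj} {p q : List EF} (hu : (fObj m).word = p ++ q)
    (hv : v.word = q ++ p) :
    ∃ (h : v = fObj m) (hi : p.length ≤ 2 * m + 2),
      rot p q hu hv = fRot m p.length hi ≫ eqToHom h.symm := by
  obtain ⟨hp, hq, hi⟩ := eq_fPow_of_append hu
  have h : v = fObj m := by
    change v.word = _
    rw [hv]
    conv_lhs => rw [hp, hq]
    exact fPow_append _ _ _ (by omega)
  subst h
  refine ⟨rfl, hi, ?_⟩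
  generalize hn : p.length = n at *
  subst hp hq
  simp [fRot]

/-! ### Replacing all letters `e` by `ff` -/

/-- Compositions of cells that replace letters `e` by `ff`. -/
inductive Expansion : ∀ {u v : EFObj}, (u ⟶ v) → Prop
  | id (u : EFObj) : Expansion (𝟙 u)
  | step {u v w : EFObj} (p q : List EF) (hu : u.word = p ++ [EF.e] ++ q)
      (hv : v.word = p ++ [EF.f, EF.f] ++ q) {a : v ⟶ w} (ha : Expansion a) :
      Expansion (splitE p q hu hv ≫ a)

theorem append_cons_eq_cases {α : Type*} {p q p' q' : List α} {x y : α}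
    (h : p ++ [x] ++ q = p' ++ [y] ++ q') :
    (p = p' ∧ x = y ∧ q = q') ∨ (∃ m, p' = p ++ [x] ++ m ∧ q = m ++ [y] ++ q') ∨
      ∃ m, p = p' ++ [y] ++ m ∧ q' = m ++ [x] ++ q := by
  simp only [List.append_assoc, List.singleton_append] at h ⊢
  rcases List.append_eq_append_iff.mp h with ⟨m, rfl, h⟩ | ⟨m, rfl, h⟩
  · rcases m with _ | ⟨a, m⟩
    · simp_all
    · simp at h
      obtain ⟨rfl, rfl⟩ := h
      simp
  · rcases m with _ | ⟨a, m⟩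
    · simp_all
    · simp at h
      obtain ⟨rfl, rfl⟩ := h
      simp

theorem append_triple_eq_cases {p q p' q' : List EF}
    (h : p ++ [EF.f, EF.f, EF.f] ++ q = p' ++ [EF.e] ++ q') :
    (∃ m, p' = p ++ [EF.f, EF.f, EF.f] ++ m ∧ q = m ++ [EF.e] ++ q') ∨
      ∃ m, p = p' ++ [EF.e] ++ m ∧ q' = m ++ [EF.f, EF.f, EF.f] ++ q := by
  simp only [List.append_assoc, List.singleton_append] at h ⊢
  rcases List.append_eq_append_iff.mp h with ⟨m, rfl, h⟩ | ⟨m, rfl, h⟩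
  · rcases m with _ | ⟨_, _ | ⟨_, _ | ⟨_, m⟩⟩⟩ <;> simp_all
  · rcases m with _ | ⟨a, m⟩ <;> simp_all

namespace Expansion

/-- The target has no letter `e`, so the given `e` is split at some stage; splittings of distinct
letters commute, and this one can be moved to the front. -/
theorem splitE_residual {u v w : EFObj} {a : u ⟶ w} (ha : Expansion a) {m : ℕ} (hw : w = fObj m)
    (p q : List EF) (hu : u.word = p ++ [EF.e] ++ q) (hv : v.word = p ++ [EF.f, EF.f] ++ q) :
    ∃ b : v ⟶ w, Expansion b ∧ splitE p q hu hv ≫ b = a := by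
  induction ha generalizing v p q with
  | id u =>
    subst hw
    exfalso
    have : EF.e ∈ fPow (2 * m + 2) := by
      rw [← word_fObj, hu]; simp
    simp at this
  | @step u v' w p' q' hu' hv' a ha ih =>
    rcases append_cons_eq_cases (hu.symm.trans hu') with
      ⟨rfl, -, rfl⟩ | ⟨m', rfl, rfl⟩ | ⟨m', rfl, rfl⟩
    · obtain rfl : v = v' := hv.trans hv'.symm
      exact ⟨a, ha, rfl⟩
    · obtain ⟨b, hb, rfl⟩ := ih hw (v := ofWord (p ++ [EF.f, EF.f] ++ m' ++ [EF.f, EF.f] ++ q'))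
        p (m' ++ [EF.f, EF.f] ++ q') (by simp [hv']) (by simp [word])
      refine ⟨splitE (p ++ [EF.f, EF.f] ++ m') q' (by simp [hv]) (by simp [word]) ≫ b,
        .step _ _ _ _ hb, ?_⟩
      rw [← Category.assoc, ← Category.assoc]
      congr 1
      exact cell_comm m' q' _ _ _ _ rfl rfl rfl rfl rfl rfl rfl _ _ _ _
    · obtain ⟨b, hb, rfl⟩ := ih hw (v := ofWord (p' ++ [EF.f, EF.f] ++ m' ++ [EF.f, EF.f] ++ q))
        (p' ++ [EF.f, EF.f] ++ m') q (by simp [hv']) (by simp [word])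
      refine ⟨splitE p' (m' ++ [EF.f, EF.f] ++ q) (by simp [hv]) (by simp [word]) ≫ b,
        .step _ _ _ _ hb, ?_⟩
      rw [← Category.assoc, ← Category.assoc]
      congr 1
      exact (cell_comm m' q _ _ _ _ rfl rfl rfl rfl rfl rfl rfl _ _ _ _).symm

/-- An expansion never touches a letter `f`, so a replacement of `f` by `fff` can be postponed until
the word is a power of `f`. -/
theorem tri_residual {u v w : EFObj} {a : u ⟶ w} (ha : Expansion a) {m : ℕ} (hw : w = fObj m)
    (p q : List EF) (hu : u.word = p ++ [EF.f] ++ q)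
    (hv : v.word = p ++ [EF.f, EF.f, EF.f] ++ q) :
    ∃ (b : v ⟶ fObj (m + 1)) (i : ℕ) (hi : i < 2 * m + 2), Expansion b ∧
      tri p q hu hv ≫ b = a ≫ eqToHom hw ≫ lam m i hi := by
  induction ha generalizing v p q with
  | id u =>
    subst hw
    obtain ⟨rfl, hi, e⟩ := tri_eq_lam hu hv
    exact ⟨𝟙 _, _, hi, .id _, by simp [e]⟩
  | @step u v' w p' q' hu' hv' a ha ih =>
    rcases append_cons_eq_cases (hu.symm.trans hu') with
      ⟨-, h, -⟩ | ⟨m', rfl, rfl⟩ | ⟨m', rfl, rfl⟩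
    · cases h
    · obtain ⟨b, i, hi, hb, e⟩ := ih hw
        (v := ofWord (p ++ [EF.f, EF.f, EF.f] ++ m' ++ [EF.f, EF.f] ++ q'))
        p (m' ++ [EF.f, EF.f] ++ q') (by simp [hv']) (by simp [word])
      refine ⟨splitE (p ++ [EF.f, EF.f, EF.f] ++ m') q' (by simp [hv]) (by simp [word]) ≫ b, i, hi,
        .step _ _ _ _ hb, ?_⟩
      rw [Category.assoc, ← e, ← Category.assoc, ← Category.assoc]
      congr 1
      exact tri_cell_comm m' q' _ _ _ _ rfl rfl rfl rfl rfl rfl rfl _ _ _ _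
    · obtain ⟨b, i, hi, hb, e⟩ := ih hw
        (v := ofWord (p' ++ [EF.f, EF.f] ++ m' ++ [EF.f, EF.f, EF.f] ++ q))
        (p' ++ [EF.f, EF.f] ++ m') q (by simp [hv']) (by simp [word])
      refine ⟨splitE p' (m' ++ [EF.f, EF.f, EF.f] ++ q) (by simp [hv]) (by simp [word]) ≫ b, i, hi,
        .step _ _ _ _ hb, ?_⟩
      rw [Category.assoc, ← e, ← Category.assoc, ← Category.assoc]
      congr 1
      exact (cell_tri_comm m' q _ _ _ _ rfl rfl rfl rfl rfl rfl rfl _ _ _ _).symm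

/-- The same postponement when the expansion is given after the replacement: it leaves the block
`fff` alone, so it already exists on the shorter word. -/
theorem tri_coresidual {u v w : EFObj} {b : v ⟶ w} (hb : Expansion b) {k : ℕ} (hw : w = fObj k)
    (p q : List EF) (hu : u.word = p ++ [EF.f] ++ q)
    (hv : v.word = p ++ [EF.f, EF.f, EF.f] ++ q) :
    ∃ (m : ℕ) (hm : k = m + 1) (a : u ⟶ fObj m) (i : ℕ) (hi : i < 2 * m + 2), Expansion a ∧
      tri p q hu hv ≫ b = a ≫ lam m i hi ≫ eqToHom (by rw [hw, hm]) := by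
  induction hb generalizing u p q with
  | id v =>
    have hvw : v.word = fPow (2 * k + 2) := hw
    have hl := congrArg List.length (hv.symm.trans hvw)
    simp only [List.length_append, List.length_cons, List.length_nil, fPow,
      List.length_replicate] at hl
    -- The word contains `fff`, so `2 * k + 2 ≥ 3`.
    obtain ⟨m, rfl⟩ : ∃ m, k = m + 1 := ⟨k - 1, by omega⟩
    have hu' : u = fObj m := by
      have e := hvw.symm.trans hv
      rw [List.append_assoc] at e
      obtain ⟨hp, hq, -⟩ := eq_fPow_of_append e
      obtain ⟨-, hq', -⟩ := eq_fPow_of_append hq.symm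
      change u.word = _
      rw [hu, hp, hq']
      refine fPow_append_f _ _ _ ?_
      simp only [List.length_cons, List.length_nil]
      omega
    subst hu'
    obtain ⟨rfl, hi, e⟩ := tri_eq_lam hu hv
    exact ⟨m, rfl, 𝟙 _, _, hi, .id _, by simp [e]⟩
  | @step v v' w p' q' hv₁ hv' b hb ih =>
    rcases append_triple_eq_cases (hv.symm.trans hv₁) with ⟨m', rfl, rfl⟩ | ⟨m', rfl, rfl⟩
    · obtain ⟨m, rfl, a, i, hi, ha, e⟩ := ih hw
        (u := ofWord (p ++ [EF.f] ++ m' ++ [EF.f, EF.f] ++ q'))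
        p (m' ++ [EF.f, EF.f] ++ q') (by simp [word]) (by simp [hv'])
      refine ⟨m, rfl, splitE (p ++ [EF.f] ++ m') q' (by simp [hu]) (by simp [word]) ≫ a, i, hi,
        .step _ _ _ _ ha, ?_⟩
      rw [Category.assoc, ← e, ← Category.assoc, ← Category.assoc]
      congr 1
      exact tri_cell_comm m' q' _ _ _ _ rfl rfl rfl rfl rfl rfl rfl _ _ _ _
    · obtain ⟨m, rfl, a, i, hi, ha, e⟩ := ih hw
        (u := ofWord (p' ++ [EF.f, EF.f] ++ m' ++ [EF.f] ++ q))
        (p' ++ [EF.f, EF.f] ++ m') q (by simp [word]) (by simp [hv'])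
      refine ⟨m, rfl, splitE p' (m' ++ [EF.f] ++ q) (by simp [hu]) (by simp [word]) ≫ a, i, hi,
        .step _ _ _ _ ha, ?_⟩
      rw [Category.assoc, ← e, ← Category.assoc, ← Category.assoc]
      congr 1
      exact (cell_tri_comm m' q _ _ _ _ rfl rfl rfl rfl rfl rfl rfl _ _ _ _).symm

theorem rot_residual {u v w : EFObj} {a : u ⟶ w} (ha : Expansion a) {m : ℕ} (hw : w = fObj m)
    (p q : List EF) (hu : u.word = p ++ q) (hv : v.word = q ++ p) :
    ∃ (b : v ⟶ fObj m) (r : ℕ) (hr : r ≤ 2 * m + 2), Expansion b ∧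
      rot p q hu hv ≫ b = a ≫ eqToHom hw ≫ fRot m r hr := by
  induction ha generalizing v p q with
  | id u =>
    subst hw
    obtain ⟨rfl, hi, e⟩ := rot_eq_fRot hu hv
    exact ⟨𝟙 _, _, hi, .id _, by simp [e]⟩
  | @step u v' w p' q' hu' hv' a ha ih =>
    have h := hu.symm.trans hu'
    rw [List.append_assoc] at h
    have h2 : (∃ m', p' = p ++ m' ∧ q = m' ++ [EF.e] ++ q') ∨
        ∃ m', p = p' ++ [EF.e] ++ m' ∧ q' = m' ++ q := by
      rcases List.append_eq_append_iff.mp h with ⟨m', rfl, rfl⟩ | ⟨m', rfl, h⟩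
      · exact .inl ⟨m', rfl, by simp⟩
      · rcases m' with _ | ⟨x, m'⟩
        · exact .inl ⟨[], by simp, by simpa [eq_comm] using h⟩
        · simp at h
          obtain ⟨rfl, rfl⟩ := h
          exact .inr ⟨m', by simp, rfl⟩
    rcases h2 with ⟨m', rfl, rfl⟩ | ⟨m', rfl, rfl⟩
    · obtain ⟨b, r, hr, hb, e⟩ := ih hw (v := ofWord (m' ++ [EF.f, EF.f] ++ q' ++ p))
        p (m' ++ [EF.f, EF.f] ++ q') (by simp [hv']) (by simp [word])
      refine ⟨splitE m' (q' ++ p) (by simp [hv]) (by simp [word]) ≫ b, r, hr,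
        .step _ _ _ _ hb, ?_⟩
      rw [Category.assoc, ← e, ← Category.assoc, ← Category.assoc]
      congr 1
      exact (cell_rot_right p m' _ _ _ _ rfl rfl rfl rfl rfl rfl rfl _ _ _ _).symm
    · obtain ⟨b, r, hr, hb, e⟩ := ih hw (v := ofWord (q ++ p' ++ [EF.f, EF.f] ++ m'))
        (p' ++ [EF.f, EF.f] ++ m') q (by simp [hv']) (by simp [word])
      refine ⟨splitE (q ++ p') m' (by simp [hv]) (by simp [word]) ≫ b, r, hr,
        .step _ _ _ _ hb, ?_⟩
      rw [Category.assoc, ← e, ← Category.assoc, ← Category.assoc]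
      congr 1
      exact (cell_rot_left m' q _ _ _ _ rfl rfl rfl rfl rfl rfl rfl _ _ _ _).symm

theorem comp {u v w : EFObj} {a : u ⟶ v} {b : v ⟶ w} (ha : Expansion a) (hb : Expansion b) :
    Expansion (a ≫ b) := by
  induction ha with
  | id => simpa using hb
  | step p q hu hv _ ih => rw [Category.assoc]; exact .step _ _ _ _ (ih hb)

end Expansion

theorem cell_symm_comp {u v : EFObj} {p q r s : List EF}
    {h : efPresentation.rel r s ∨ efPresentation.rel s r} (hu : u.word = p ++ r ++ q)
    (hv : v.word = p ++ s ++ q) :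
    (cell p r s q h hu hv : u ⟶ v) ≫ (cell p s r q h.symm hv hu : v ⟶ u) = 𝟙 u := by
  rw [← inv_cell p r s q h hu hv, Groupoid.comp_inv]

/-- Every annular diagram becomes a composition of rotations and replacements of `f` by `fff` and
their inverses after all letters `e` of its boundary words have been replaced by `ff`. -/
theorem exists_generated {u v : EFObj} (a : u ⟶ v) : ∀ {m : ℕ} {θ : u ⟶ fObj m}, Expansion θ →
    ∃ (k : ℕ) (θ' : v ⟶ fObj k) (t : fObj m ⟶ fObj k), Expansion θ' ∧ Generated t ∧
      a ≫ θ' = θ ≫ t := by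
  induction a using hom_induction with
  | id u => exact fun {m θ} hθ => ⟨m, θ, 𝟙 _, hθ, .id _, by simp⟩
  | @cell u v p r s q h hu hv =>
    intro m θ hθ
    rcases h with (⟨rfl, rfl⟩ | ⟨rfl, rfl⟩) | (⟨rfl, rfl⟩ | ⟨rfl, rfl⟩)
    -- Cell `e → ff`: it is already part of the expansion `θ` and leaves no trace.
    · obtain ⟨b, hb, e⟩ := hθ.splitE_residual rfl p q hu hv
      exact ⟨m, b, 𝟙 _, hb, .id _, by rw [Category.comp_id]; exact e⟩
    -- Cell `f → fe`: splitting the new `e` at once makes it a replacement of `f` by `fff`.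
    · obtain ⟨b, i, hi, hb, e⟩ := hθ.tri_residual rfl
        (v := ofWord (p ++ [EF.f, EF.f, EF.f] ++ q)) p q hu rfl
      refine ⟨m + 1, splitE (p ++ [EF.f]) q (hv.trans (by simp)) (by simp [word]) ≫ b, lam m i hi,
        .step _ _ _ _ hb, .lam hi, ?_⟩
      rw [eqToHom_refl, Category.id_comp] at e
      rw [← e, ← Category.assoc]
      congr 1
      exact splitF_comp_splitE hu hv (hv.trans (by simp)) _ rfl
    -- Cell `ff → e`: the new `e` is split again, which cancels the cell.
    · refine ⟨m, splitE p q hv hu ≫ θ, 𝟙 _, .step _ _ _ _ hθ, .id _, ?_⟩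
      rw [← Category.assoc, Category.comp_id, splitE, cell_symm_comp, Category.id_comp]
    -- Cell `fe → f`: the `e` is split first, and the inverse replacement `fff → f` is then moved
    -- behind the rest of the expansion.
    · obtain ⟨b, hb, rfl⟩ := hθ.splitE_residual rfl
        (v := ofWord (p ++ [EF.f, EF.f, EF.f] ++ q)) (p ++ [EF.f]) q
        (hu.trans (by simp)) (by simp [word])
      obtain ⟨k, rfl, a, i, hi, ha, e⟩ := hb.tri_coresidual rfl (u := v) p q hv rfl
      rw [eqToHom_refl, Category.comp_id] at e
      refine ⟨k, a, Groupoid.inv (lam k i hi), ha, .inv_lam hi, ?_⟩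
      have e' : splitF p q hv hu ≫ (splitE (p ++ [EF.f]) q (hu.trans (by simp))
          (by simp [word]) ≫ b) = a ≫ lam k i hi := by
        rw [← e, ← Category.assoc]
        congr 1
        exact splitF_comp_splitE _ _ _ _ rfl
      have e2 : a ≫ lam k i hi ≫ Groupoid.inv (lam k i hi) = a := by
        rw [Groupoid.comp_inv, Category.comp_id]
      conv_lhs => rw [← e2, ← Category.assoc a, ← e', Category.assoc, ← Category.assoc, splitF,
        cell_symm_comp, Category.id_comp]
  | @rot u v p q hu hv =>
    intro m θ hθ
    obtain ⟨b, r, hr, hb, e⟩ := hθ.rot_residual rfl (v := v) p q hu hv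
    rw [eqToHom_refl, Category.id_comp] at e
    exact ⟨m, b, fRot m r hr, hb, .rot hr, e⟩
  | @comp u v w a b iha ihb =>
    intro m θ hθ
    obtain ⟨k, θ', t, hθ', ht, e⟩ := iha hθ
    obtain ⟨l, θ'', t', hθ'', ht', e'⟩ := ihb hθ'
    refine ⟨l, θ'', t ≫ t', hθ'', .comp ht ht', ?_⟩
    rw [Category.assoc, e', ← Category.assoc, e, Category.assoc]

theorem Expansion.eq_eqToHom {u w : EFObj} {a : u ⟶ w} (ha : Expansion a) {m : ℕ}
    (hu : u = fObj m) : ∃ h : u = w, a = eqToHom h := by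
  cases ha with
  | id => exact ⟨rfl, by simp⟩
  | step p q hu' hv _ =>
    exfalso
    subst hu
    have : EF.e ∈ fPow (2 * m + 2) := by
      rw [← word_fObj, hu']; simp
    simp at this

/-- The word `e` as an object. -/
def eObj : EFObj := [EF.e]

/-- The cell from `e` to `ff`. -/
def baseCell : eObj ⟶ fObj 0 := splitE [] [] (by rfl) (by rfl)

theorem exists_generated_of_loop (a : eObj ⟶ eObj) :
    ∃ t : fObj 0 ⟶ fObj 0, Generated t ∧ a = baseCell ≫ t ≫ Groupoid.inv baseCell := by
  have hb : Expansion baseCell := by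
    rw [← Category.comp_id baseCell]
    exact .step _ _ _ _ (.id _)
  obtain ⟨k, θ, t, hθ, ht, e⟩ := exists_generated a hb
  -- An expansion of the one-letter word `e` to a power of `f` must be the base cell, because
  -- nothing in `ff` can be expanded.
  obtain ⟨b, hb', rfl⟩ := hθ.splitE_residual rfl (v := fObj 0) [] [] rfl rfl
  obtain ⟨h, rfl⟩ := hb'.eq_eqToHom rfl
  obtain rfl := fObj_injective h
  refine ⟨t, ht, ?_⟩
  rw [← Category.assoc, ← e, eqToHom_refl, Category.comp_id]
  change a = (a ≫ baseCell) ≫ _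
  rw [Category.assoc, Groupoid.comp_inv, Category.comp_id]

end AnnularObj

namespace AnnularObj

/-! ### Normal forms -/

/-- `a` is the composition of the replacements of `f` by `fff` at the positions listed. -/
inductive Positive : ∀ {m k : ℕ}, (fObj m ⟶ fObj k) → List ℕ → Prop
  | nil (m : ℕ) : Positive (𝟙 (fObj m)) []
  | cons {m k i : ℕ} (h : i < 2 * m + 2) {a : fObj (m + 1) ⟶ fObj k} {l : List ℕ} :
      Positive a l → Positive (lam m i h ≫ a) (i :: l)

namespace Positive

theorem comp {m k n : ℕ} {a : fObj m ⟶ fObj k} {b : fObj k ⟶ fObj n} {l l' : List ℕ}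
    (ha : Positive a l) (hb : Positive b l') : Positive (a ≫ b) (l ++ l') := by
  induction ha with
  | nil => simpa using hb
  | cons h _ ih => rw [Category.assoc]; exact .cons h (ih hb)

theorem eq_add_length {m k : ℕ} {a : fObj m ⟶ fObj k} {l : List ℕ} (ha : Positive a l) :
    k = m + l.length := by
  induction ha with
  | nil => rfl
  | cons h _ ih => rw [ih, List.length_cons]; omega

/-- Rotations can be moved to the right past replacements, which keeps the number of replacements
visible in the target. -/
theorem fRot_comp {m k : ℕ} {a : fObj m ⟶ fObj k} {l : List ℕ} (ha : Positive a l) {r : ℕ}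
    (hr : r ≤ 2 * m + 2) : ∃ (b : fObj m ⟶ fObj k) (l' : List ℕ) (r' : ℕ) (hr' : r' ≤ 2 * k + 2),
      Positive b l' ∧ fRot m r hr ≫ a = b ≫ fRot k r' hr' := by
  induction ha generalizing r with
  | nil m => exact ⟨𝟙 _, [], r, hr, .nil _, by simp⟩
  | @cons m k i h a l _ ih =>
    have key : ∃ (j : ℕ) (hj : j < 2 * m + 2) (s : ℕ) (hs : s ≤ 2 * (m + 1) + 2),
        fRot m r hr ≫ lam m i h = lam m j hj ≫ fRot (m + 1) s hs := by
      rcases lt_or_ge i (2 * m + 2 - r) with h' | h'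
      · refine ⟨i + r, by omega, r, by omega, ?_⟩
        rw [lam_fRot_ge (by omega)]
        congr 2
        omega
      · refine ⟨i - (2 * m + 2 - r), by omega, r + 2, by omega, ?_⟩
        rw [lam_fRot_lt (by omega) (by omega)]
        congr 2
        omega
    obtain ⟨j, hj, s, hs, e⟩ := key
    obtain ⟨b, l', r', hr', hb, e'⟩ := ih hs
    refine ⟨lam m j hj ≫ b, j :: l', r', hr', .cons hj hb, ?_⟩
    rw [← Category.assoc, e, Category.assoc, e', Category.assoc]

/-- The Ore condition: two positive morphisms with the same source have a common continuation. It
suffices to complete squares of single replacements by `lam_comm`. -/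
theorem lam_residual {m k : ℕ} {a : fObj m ⟶ fObj k} {l : List ℕ} (ha : Positive a l) {i : ℕ}
    (hi : i < 2 * m + 2) : ∃ (n : ℕ) (b : fObj (m + 1) ⟶ fObj n) (s : fObj k ⟶ fObj n)
      (l₁ l₂ : List ℕ), Positive b l₁ ∧ Positive s l₂ ∧ a ≫ s = lam m i hi ≫ b := by
  induction ha generalizing i with
  | nil m =>
    refine ⟨m + 1, 𝟙 _, lam m i hi ≫ 𝟙 _, [], [i], .nil _, .cons hi (.nil _), by simp⟩
  | @cons m k j hj a l ha ih =>
    rcases eq_or_ne i j with rfl | hne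
    · exact ⟨k, a, 𝟙 _, l, [], ha, .nil _, by simp⟩
    · have key : ∃ (i' : ℕ) (hi' : i' < 2 * (m + 1) + 2) (j' : ℕ) (hj' : j' < 2 * (m + 1) + 2),
          lam m j hj ≫ lam (m + 1) i' hi' = lam m i hi ≫ lam (m + 1) j' hj' := by
        rcases lt_or_gt_of_ne hne with h | h
        · exact ⟨i, by omega, j + 2, by omega, (lam_comm h hj).symm⟩
        · exact ⟨i + 2, by omega, j, by omega, lam_comm h hi⟩
      obtain ⟨i', hi', j', hj', e⟩ := key
      obtain ⟨n, b, s, l₁, l₂, hb, hs, e'⟩ := ih hi'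
      refine ⟨n, lam (m + 1) j' hj' ≫ b, s, j' :: l₁, l₂, .cons hj' hb, hs, ?_⟩
      rw [Category.assoc, e', ← Category.assoc, e, Category.assoc]

/-- The step of insertion sort: when `i > j`, replacing at `i` and then at `j` equals replacing at
`j` and then at `i + 2`. The lower bound in the conclusion is what keeps `j` in front in the
recursion. -/
theorem exists_insert {m k : ℕ} {a : fObj (m + 1) ⟶ fObj k} {l : List ℕ} (ha : Positive a l)
    (hl : l.Pairwise (· ≤ ·)) {i : ℕ} (hi : i < 2 * m + 2) :
    ∃ l' : List ℕ, Positive (lam m i hi ≫ a) l' ∧ l'.Pairwise (· ≤ ·) ∧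
      ∀ c, c ≤ i → (∀ j ∈ l, c ≤ j) → ∀ j ∈ l', c ≤ j := by
  induction l generalizing m i with
  | nil =>
    exact ⟨[i], .cons hi ha, by simp, fun c hc _ => by simpa using hc⟩
  | cons j l ih =>
    rw [List.pairwise_cons] at hl
    rcases le_or_gt i j with h | h
    · refine ⟨i :: j :: l, .cons hi ha, ?_, fun c hc hc' k hk => ?_⟩
      · rw [List.pairwise_cons, List.pairwise_cons]
        refine ⟨fun k hk => ?_, hl⟩
        rcases List.mem_cons.mp hk with rfl | hk
        · exact h
        · exact h.trans (hl.1 k hk)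
      · rcases List.mem_cons.mp hk with rfl | hk
        · exact hc
        · exact hc' k hk
    · cases ha with
      | cons hj hb =>
        obtain ⟨l', h1, h2, h3⟩ := ih hb hl.2 (i := i + 2) (by omega)
        refine ⟨j :: l', ?_, ?_, fun c _ hc' k hk => ?_⟩
        · rw [← Category.assoc, ← lam_comm h hi, Category.assoc]
          exact .cons (by omega) h1
        · rw [List.pairwise_cons]
          exact ⟨h3 j (by omega) hl.1, h2⟩
        · rcases List.mem_cons.mp hk with rfl | hk
          · exact hc' _ (by simp)
          · exact h3 c (by have := hc' j (by simp); omega)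
              (fun k hk => hc' k (List.mem_cons_of_mem _ hk)) k hk

theorem exists_sorted {m k : ℕ} {a : fObj m ⟶ fObj k} {l : List ℕ} (ha : Positive a l) :
    ∃ l' : List ℕ, Positive a l' ∧ l'.Pairwise (· ≤ ·) := by
  induction ha with
  | nil => exact ⟨[], .nil _, by simp⟩
  | cons h _ ih =>
    obtain ⟨l', h1, h2⟩ := ih
    obtain ⟨l'', h3, h4, -⟩ := h1.exists_insert h2 h
    exact ⟨l'', h3, h4⟩

end Positive

/-- A composition of replacements of `f` by `fff`, a rotation, and inverse replacements. -/
def HasNormalForm {m k : ℕ} (a : fObj m ⟶ fObj k) : Prop :=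
  ∃ (n : ℕ) (b : fObj m ⟶ fObj n) (c : fObj k ⟶ fObj n) (l l' : List ℕ) (r : ℕ)
    (hr : r ≤ 2 * n + 2), Positive b l ∧ Positive c l' ∧ a = b ≫ fRot n r hr ≫ Groupoid.inv c

theorem inv_comp_distrib {u v w : EFObj} (a : u ⟶ v) (b : v ⟶ w) :
    Groupoid.inv (a ≫ b) = Groupoid.inv b ≫ Groupoid.inv a := by
  simp

/-- A new replacement crosses the inverse positive part by the Ore condition and then the rotation;
an inverse replacement is absorbed; a new rotation crosses the inverse part and joins the old one.
-/
theorem Generated.hasNormalForm_comp {m k n : ℕ} {a : fObj m ⟶ fObj k} {t : fObj k ⟶ fObj n}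
    (ht : Generated t) (ha : HasNormalForm a) : HasNormalForm (a ≫ t) := by
  induction ht generalizing m with
  | id => simpa using ha
  | @lam k i h =>
    obtain ⟨n, b, c, l, l', r, hr, hb, hc, rfl⟩ := ha
    obtain ⟨n', c', s, l₁, l₂, hc', hs, e⟩ := hc.lam_residual h
    obtain ⟨s', l₃, r', hr', hs', e'⟩ := hs.fRot_comp hr
    refine ⟨n', b ≫ s', c', l ++ l₃, l₁, r', hr', hb.comp hs', hc', ?_⟩
    have e2 : Groupoid.inv c ≫ AnnularObj.lam k i h = s ≫ Groupoid.inv c' := by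
      have := congrArg (fun z => Groupoid.inv c ≫ z ≫ Groupoid.inv c') e
      simpa using this.symm
    rw [Category.assoc, Category.assoc, e2, Category.assoc, ← Category.assoc s', ← e',
      Category.assoc]
  | @inv_lam k i h =>
    obtain ⟨n, b, c, l, l', r, hr, hb, hc, rfl⟩ := ha
    refine ⟨n, b, AnnularObj.lam k i h ≫ c, l, i :: l', r, hr, hb, .cons h hc, ?_⟩
    rw [inv_comp_distrib, Category.assoc, Category.assoc]
  | @rot k s h =>
    obtain ⟨n, b, c, l, l', r, hr, hb, hc, rfl⟩ := ha
    obtain ⟨s', hs', e⟩ := exists_inv_fRot h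
    obtain ⟨c', l₁, r', hr', hc', e'⟩ := hc.fRot_comp hs'
    obtain ⟨r'', hr'', e''⟩ := exists_inv_fRot hr'
    obtain ⟨q, hq, e3⟩ := exists_fRot_comp hr hr''
    refine ⟨n, b, c', l, l₁, q, hq, hb, hc', ?_⟩
    have e4 : Groupoid.inv c ≫ fRot k s h = fRot n r'' hr'' ≫ Groupoid.inv c' := by
      rw [← e'', ← inv_comp_distrib, ← e', ← e, inv_comp_distrib]
      simp
    rw [Category.assoc, Category.assoc, e4, ← e3, Category.assoc]
  | comp _ _ ih1 ih2 => rw [← Category.assoc]; exact ih2 (ih1 ha)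

theorem Generated.hasNormalForm {m k : ℕ} {t : fObj m ⟶ fObj k} (ht : Generated t) :
    HasNormalForm t := by
  have h : HasNormalForm (𝟙 (fObj m)) :=
    ⟨m, 𝟙 _, 𝟙 _, [], [], 0, by omega, .nil _, .nil _, by simp [fRot_zero]⟩
  simpa using ht.hasNormalForm_comp h

/-! ### Faithfulness -/

theorem le_cellFun {p r s x : ℝ} (hr : 0 < r) (hrs : r ≤ s) : x ≤ cellFun p r s x := by
  rcases lt_or_ge x p with h | h
  · rw [cellFun_of_lt h]
  · rcases lt_or_ge x (p + r) with h' | h'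
    · rw [cellFun_of_mem h h']
      have : 1 ≤ s / r := (one_le_div hr).mpr hrs
      nlinarith
    · rw [cellFun_of_ge hr.le h']
      linarith

theorem length_fObj (m : ℕ) : ((fObj m).word.length : ℝ) = 2 * m + 2 := by
  simp [word_fObj]

theorem eval_tri {u v : EFObj} {p q : List EF} (hu : u.word = p ++ [EF.f] ++ q)
    (hv : v.word = p ++ [EF.f, EF.f, EF.f] ++ q) {x : ℝ}
    (hx : x ∈ Set.Ico (0 : ℝ) u.word.length) :
    eval (tri p q hu hv : u ⟶ v) x = cellFun (p.length + 1) 1 2 (cellFun p.length 1 2 x) := by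
  rw [tri, eval_comp _ _ hx, splitE, eval_cell _ _ _ _ _ _ _ (eval_mem _ hx), splitF,
    eval_cell _ _ _ _ _ _ _ hx]
  simp

theorem eval_lam {m i : ℕ} (h : i < 2 * m + 2) {x : ℝ}
    (hx : x ∈ Set.Ico (0 : ℝ) (fObj m).word.length) :
    eval (lam m i h) x = cellFun (i + 1) 1 2 (cellFun i 1 2 x) := by
  refine (eval_tri _ _ hx).trans ?_
  simp

theorem eval_fRot {m r : ℕ} (h : r ≤ 2 * m + 2) {x : ℝ}
    (hx : x ∈ Set.Ico (0 : ℝ) (fObj m).word.length) :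
    eval (fRot m r h) x = rotFun r ((2 * m + 2 - r : ℕ) : ℝ) x := by
  refine (eval_rot _ _ _ _ hx).trans ?_
  simp

theorem le_eval_lam {m i : ℕ} (h : i < 2 * m + 2) {x : ℝ}
    (hx : x ∈ Set.Ico (0 : ℝ) (fObj m).word.length) : x ≤ eval (lam m i h) x := by
  rw [eval_lam h hx]
  exact (le_cellFun one_pos one_le_two).trans (le_cellFun one_pos one_le_two)

theorem eval_lam_of_lt {m i : ℕ} (h : i < 2 * m + 2) {x : ℝ}
    (hx : x ∈ Set.Ico (0 : ℝ) (fObj m).word.length) (hxi : x < i) : eval (lam m i h) x = x := by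
  rw [eval_lam h hx, cellFun_of_lt hxi, cellFun_of_lt (by linarith)]

theorem eval_lam_mid {m i : ℕ} (h : i < 2 * m + 2)
    (hx : (i : ℝ) + 1 / 2 ∈ Set.Ico (0 : ℝ) (fObj m).word.length) :
    eval (lam m i h) (i + 1 / 2) = i + 1 := by
  have e : cellFun i 1 2 ((i : ℝ) + 1 / 2) = i + 1 := by
    rw [cellFun_of_mem (by linarith) (by linarith)]
    ring
  rw [eval_lam h hx, e, cellFun_of_mem le_rfl (by linarith)]
  ring

namespace Positive

theorem le_eval {m k : ℕ} {a : fObj m ⟶ fObj k} {l : List ℕ} (ha : Positive a l) {x : ℝ}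
    (hx : x ∈ Set.Ico (0 : ℝ) (fObj m).word.length) : x ≤ eval a x := by
  induction ha generalizing x with
  | nil => rw [eval_id hx]
  | cons h _ ih =>
    rw [eval_comp _ _ hx]
    exact (le_eval_lam h hx).trans (ih (eval_mem _ hx))

theorem eval_of_lt {m k : ℕ} {a : fObj m ⟶ fObj k} {l : List ℕ} (ha : Positive a l) {x : ℝ}
    (hx : x ∈ Set.Ico (0 : ℝ) (fObj m).word.length) (hl : ∀ i ∈ l, x < (i : ℝ)) :
    eval a x = x := by
  induction ha generalizing x with
  | nil => rw [eval_id hx]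
  | @cons m k i h a l ha ih =>
    have e := eval_lam_of_lt h hx (hl i (by simp))
    have hx' := eval_mem (lam m i h) hx
    rw [e] at hx'
    rw [eval_comp _ _ hx, e, ih hx' fun j hj => hl j (List.mem_cons_of_mem _ hj)]

/-- The test point is `i + 1/2`. Replacing at `i` moves it to `i + 1` and positive morphisms never
move points back, whereas `b` fixes it if all its positions exceed `i`. -/
theorem head_le {m k k' : ℕ} {i j : ℕ} {a : fObj m ⟶ fObj k} {b : fObj m ⟶ fObj k'}
    {l l' : List ℕ} (ha : Positive a (i :: l)) (hb : Positive b (j :: l'))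
    (hl' : (j :: l').Pairwise (· ≤ ·))
    (h : ∀ x ∈ Set.Ico (0 : ℝ) (fObj m).word.length, eval a x = eval b x) : j ≤ i := by
  by_contra! hij
  cases ha with
  | cons hi ha =>
    have hi' : (i : ℝ) + 1 ≤ 2 * m + 2 := by exact_mod_cast hi
    have hx : (i : ℝ) + 1 / 2 ∈ Set.Ico (0 : ℝ) (fObj m).word.length := by
      rw [length_fObj]
      exact ⟨by positivity, by linarith⟩
    have h1 := ha.le_eval (eval_mem (lam m i hi) hx)
    have h2 : eval b (i + 1 / 2) = i + 1 / 2 := by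
      refine hb.eval_of_lt hx fun k hk => ?_
      have hk' : i + 1 ≤ k := by
        rcases List.mem_cons.mp hk with rfl | hk
        · exact hij
        · exact hij.trans_le ((List.pairwise_cons.mp hl').1 k hk)
      have : (i : ℝ) + 1 ≤ k := by exact_mod_cast hk'
      linarith
    rw [← eval_comp _ _ hx, h _ hx, h2, eval_lam_mid hi hx] at h1
    linarith

/-- A common target forces lists of equal length, `head_le` in both directions equates the first
positions, and the first replacement, being invertible, cancels. -/
theorem eq_of_eval_eq {m k : ℕ} {a b : fObj m ⟶ fObj k} {l l' : List ℕ} (ha : Positive a l)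
    (hb : Positive b l') (hl : l.Pairwise (· ≤ ·)) (hl' : l'.Pairwise (· ≤ ·))
    (h : ∀ x ∈ Set.Ico (0 : ℝ) (fObj m).word.length, eval a x = eval b x) : a = b := by
  induction l generalizing m l' with
  | nil =>
    have h1 := ha.eq_add_length
    have h2 := hb.eq_add_length
    obtain rfl : l' = [] := List.length_eq_zero_iff.mp (by simp at h1; omega)
    cases ha
    cases hb
    rfl
  | cons i l ih =>
    rcases l' with _ | ⟨j, l'⟩
    · have h1 := ha.eq_add_length
      have h2 := hb.eq_add_length
      simp at h1 h2
      omega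
    · obtain rfl : i = j := le_antisymm (hb.head_le ha hl fun x hx => (h x hx).symm)
        (ha.head_le hb hl' h)
      cases ha with
      | cons hi ha =>
        cases hb with
        | cons _ hb =>
          congr 1
          refine ih ha hb (List.pairwise_cons.mp hl).2 (List.pairwise_cons.mp hl').2 fun x hx => ?_
          have hx' := eval_mem (Groupoid.inv (lam m i hi)) hx
          have e := h _ hx'
          rwa [eval_comp _ _ hx', eval_comp _ _ hx', eval_eval_inv _ hx] at e

end Positive

theorem Generated.eq_id {t : fObj 0 ⟶ fObj 0} (ht : Generated t)
    (h : ∀ x ∈ Set.Ico (0 : ℝ) (fObj 0).word.length, eval t x = x) : t = 𝟙 (fObj 0) := by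
  obtain ⟨n, b, c, l, l', r, hr, hb, hc, rfl⟩ := ht.hasNormalForm
  have key : ∀ x ∈ Set.Ico (0 : ℝ) (fObj 0).word.length,
      eval (fRot n r hr) (eval b x) = eval c x := by
    intro x hx
    have e := h x hx
    rw [eval_comp _ _ hx, eval_comp _ _ (eval_mem b hx)] at e
    rw [← eval_eval_inv c (eval_mem (fRot n r hr) (eval_mem b hx)), e]
  obtain ⟨l₁, hb₁, hl₁⟩ := hb.exists_sorted
  obtain ⟨l₂, hc₂, hl₂⟩ := hc.exists_sorted
  have pos_zero : ∀ {m k : ℕ} {a : fObj m ⟶ fObj k} {l : List ℕ}, Positive a l →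
      eval a 0 = 0 := by
    intro m k a l ha
    induction ha with
    | @nil m => exact eval_id (by rw [length_fObj]; exact ⟨le_rfl, by positivity⟩)
    | @cons m k i h a l ha ih =>
      have h0 : (0 : ℝ) ∈ Set.Ico (0 : ℝ) (fObj m).word.length := by
        rw [length_fObj]; exact ⟨le_rfl, by positivity⟩
      rw [eval_comp _ _ h0]
      suffices e : eval (AnnularObj.lam m i h) 0 = 0 by rw [e, ih]
      rcases Nat.eq_zero_or_pos i with rfl | hi
      · have e : cellFun ((0 : ℕ) : ℝ) 1 2 0 = 0 := by
          rw [cellFun_of_mem] <;> simp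
        rw [eval_lam h h0, e, cellFun_of_lt]
        simp
      · exact eval_lam_of_lt h h0 (by exact_mod_cast hi)
  -- Positive morphisms fix 0, so the rotation fixes 0 and is either empty or a full turn.
  have hrot : fRot n r hr = 𝟙 (fObj n) := by
    have h0 : ∀ n, (0 : ℝ) ∈ Set.Ico (0 : ℝ) (fObj n).word.length := fun n => by
      rw [length_fObj]; exact ⟨le_rfl, by positivity⟩
    have e := key 0 (h0 0)
    rw [pos_zero hb, pos_zero hc, eval_fRot hr (h0 n)] at e
    rcases Nat.eq_zero_or_pos r with rfl | hr'
    · exact fRot_zero n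
    · rw [rotFun_of_lt (by simpa using hr')] at e
      have e' : 2 * n + 2 - r = 0 := by simpa using e
      obtain rfl : r = 2 * n + 2 := by omega
      exact fRot_full n
  have hbc : b = c := by
    refine hb₁.eq_of_eval_eq hc₂ hl₁ hl₂ fun x hx => ?_
    rw [← key x hx, hrot, eval_id (eval_mem b hx)]
  rw [hrot, hbc, Category.id_comp, Groupoid.comp_inv]

theorem eq_id_of_eval_eq {a : eObj ⟶ eObj}
    (h : ∀ x ∈ Set.Ico (0 : ℝ) 1, eval a x = x) : a = 𝟙 eObj := by
  obtain ⟨t, ht, rfl⟩ := exists_generated_of_loop a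
  have hone : ((word eObj).length : ℝ) = 1 := by
    change (([EF.e].length : ℕ) : ℝ) = 1
    simp
  have := ht.eq_id fun x hx => by
    have hx' := eval_mem (Groupoid.inv baseCell) hx
    have e := h _ (hone ▸ hx')
    rw [eval_comp _ _ hx', eval_eval_inv _ hx, eval_comp _ _ hx] at e
    rw [← eval_eval_inv baseCell (eval_mem t hx), e, eval_eval_inv _ hx]
  rw [this, Category.id_comp, Groupoid.comp_inv]

end AnnularObj

/-! ### Finite generation of the annular diagram group -/

/-- The annular diagram group of `⟨e, f ∣ e = ff, f = fe⟩` with base `e`. -/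
abbrev EFGroup := AnnularDiagramGroup efPresentation [EF.e]

namespace AnnularObj

/-- An endomorphism of `e` as an element of the annular diagram group. -/
def toGroup (a : eObj ⟶ eObj) : EFGroup := a

theorem toGroup_comp (a b : eObj ⟶ eObj) : toGroup (a ≫ b) = toGroup a * toGroup b := rfl

theorem toGroup_id : toGroup (𝟙 eObj) = 1 := rfl

/-- The morphism from `e` to `f ^ (2m + 2)` that always splits the last letter. -/
def basePath : (m : ℕ) → (eObj ⟶ fObj m)
  | 0 => baseCell
  | m + 1 => basePath m ≫ lam m (2 * m + 1) (by omega)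

/-- The element of the annular diagram group given by a morphism between powers of `f`. -/
def loop {m k : ℕ} (a : fObj m ⟶ fObj k) : EFGroup :=
  toGroup (basePath m ≫ a ≫ Groupoid.inv (basePath k))

theorem loop_comp {m k n : ℕ} (a : fObj m ⟶ fObj k) (b : fObj k ⟶ fObj n) :
    loop (a ≫ b) = loop a * loop b := by
  rw [loop, loop, loop, ← toGroup_comp]
  simp

theorem loop_id (m : ℕ) : loop (𝟙 (fObj m)) = 1 := by
  rw [loop, Category.id_comp, Groupoid.comp_inv, toGroup_id]

theorem loop_inv {m k : ℕ} (a : fObj m ⟶ fObj k) : loop (Groupoid.inv a) = (loop a)⁻¹ := by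
  rw [eq_inv_iff_mul_eq_one, ← loop_comp, Groupoid.inv_comp, loop_id]

theorem loop_lam_last (m : ℕ) : loop (lam m (2 * m + 1) (by omega)) = 1 := by
  rw [loop, ← Category.assoc]
  change toGroup (basePath (m + 1) ≫ _) = 1
  rw [Groupoid.comp_inv, toGroup_id]

theorem loop_lam_comm {m i j : ℕ} (hij : i < j) (hj : j < 2 * m + 2) :
    loop (lam m i (by omega)) * loop (lam (m + 1) (j + 2) (by omega)) =
      loop (lam m j hj) * loop (lam (m + 1) i (by omega)) := by
  rw [← loop_comp, ← loop_comp, lam_comm hij hj]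

/-- Replacement at the last letter is trivial as a loop, so commuting with it shows that the loop of
position `i` does not depend on `m`, as long as `i` is not last. -/
theorem loop_lam_succ {m i : ℕ} (hi : i < 2 * m + 1) :
    loop (lam (m + 1) i (by omega)) = loop (lam m i (by omega)) := by
  have h := loop_lam_comm hi (show 2 * m + 1 < 2 * m + 2 by omega)
  rw [loop_lam_last, one_mul] at h
  rw [← h]
  have h' := loop_lam_last (m + 1)
  change loop (lam (m + 1) (2 * m + 1 + 2) _) = 1 at h'
  rw [h', mul_one]

/-- Moving the trivial last replacement through a rotation by one letter turns it into the
replacement at `2 * m`. -/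
theorem loop_fRot_succ (m : ℕ) : loop (fRot (m + 1) 1 (by omega)) =
    loop (fRot m 1 (by omega)) * loop (lam m (2 * m) (by omega)) := by
  have h := lam_fRot_ge (m := m) (i := 2 * m + 1) (k := 1) (by omega) (by omega)
  have h' := congrArg loop h
  rw [loop_comp, loop_comp, loop_lam_last, one_mul] at h'
  exact h'

/-- The finite set of generators. -/
def generators : Set EFGroup :=
  {loop (lam 1 0 (by omega)), loop (lam 1 1 (by omega)), loop (lam 1 2 (by omega)),
    loop (fRot 0 1 (by omega))}

theorem loop_lam_succ_mem (m : ℕ) : ∀ (i : ℕ) (hi : i < 2 * (m + 1) + 2),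
    loop (lam (m + 1) i hi) ∈ Subgroup.closure generators := by
  induction m with
  | zero =>
    intro i hi
    have : i = 0 ∨ i = 1 ∨ i = 2 ∨ i = 3 := by omega
    rcases this with rfl | rfl | rfl | rfl
    · exact Subgroup.subset_closure (by simp [generators])
    · exact Subgroup.subset_closure (by simp [generators])
    · exact Subgroup.subset_closure (by simp [generators])
    · have h := loop_lam_last 1
      exact h ▸ Subgroup.one_mem _
  | succ m ih =>
    intro i hi
    rcases lt_or_ge i (2 * (m + 1) + 1) with h | h
    · rw [loop_lam_succ h]
      exact ih i _
    · rcases eq_or_ne i (2 * (m + 1 + 1) + 1) with rfl | hne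
      · rw [loop_lam_last]
        exact Subgroup.one_mem _
      -- Only the two positions before the last are left. The commutation with position 0 exhibits
      -- each as a conjugate of a loop at the previous level.
      · obtain ⟨j, rfl⟩ : ∃ j, i = j + 2 := ⟨i - 2, by omega⟩
        have e := loop_lam_comm (m := m + 1) (i := 0) (j := j) (by omega) (by omega)
        rw [loop_lam_succ (m := m + 1) (i := 0) (by omega)] at e
        rw [eq_inv_mul_of_mul_eq e]
        exact Subgroup.mul_mem _ (Subgroup.inv_mem _ (ih _ _))
          (Subgroup.mul_mem _ (ih _ _) (ih _ _))

theorem loop_lam_mem (m i : ℕ) (hi : i < 2 * m + 2) :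
    loop (lam m i hi) ∈ Subgroup.closure generators := by
  rcases m with _ | m
  · have : i = 0 ∨ i = 1 := by omega
    rcases this with rfl | rfl
    · rw [← loop_lam_succ (by omega)]
      exact loop_lam_succ_mem _ _ _
    · have h := loop_lam_last 0
      exact h ▸ Subgroup.one_mem _
  · exact loop_lam_succ_mem m i hi

theorem loop_fRot_one_mem (m : ℕ) :
    loop (fRot m 1 (by omega)) ∈ Subgroup.closure generators := by
  induction m with
  | zero => exact Subgroup.subset_closure (by simp [generators])
  | succ m ih =>
    rw [loop_fRot_succ]
    exact Subgroup.mul_mem _ ih (loop_lam_mem _ _ _)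

theorem loop_fRot_mem (m r : ℕ) (hr : r ≤ 2 * m + 2) :
    loop (fRot m r hr) ∈ Subgroup.closure generators := by
  induction r with
  | zero => rw [fRot_zero, loop_id]; exact Subgroup.one_mem _
  | succ r ih =>
    rw [← fRot_comp, loop_comp]
    exact Subgroup.mul_mem _ (ih (by omega)) (loop_fRot_one_mem m)

theorem Generated.loop_mem {m k : ℕ} {t : fObj m ⟶ fObj k} (ht : Generated t) :
    loop t ∈ Subgroup.closure generators := by
  induction ht with
  | id => rw [loop_id]; exact Subgroup.one_mem _
  | lam h => exact loop_lam_mem _ _ _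
  | inv_lam h => rw [loop_inv]; exact Subgroup.inv_mem _ (loop_lam_mem _ _ _)
  | rot h => exact loop_fRot_mem _ _ _
  | comp _ _ ih1 ih2 => rw [loop_comp]; exact Subgroup.mul_mem _ ih1 ih2

theorem fg_EFGroup : Group.FG EFGroup := by
  refine Group.fg_iff.mpr ⟨generators, ?_, by simp [generators]⟩
  rw [eq_top_iff]
  rintro a -
  obtain ⟨t, ht, e⟩ := exists_generated_of_loop a
  have h : loop t = a := e.symm
  exact h ▸ ht.loop_mem

end AnnularObj

/-! ### The action of the annular diagram group on `[0, 1)` -/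

open AnnularObj

theorem length_eObj : ((word eObj).length : ℝ) = 1 := by
  change (([EF.e].length : ℕ) : ℝ) = 1
  simp

/-- The permutation of `[0, 1)` given by an annular diagram. -/
noncomputable def circlePerm (a : eObj ⟶ eObj) : Equiv.Perm (Set.Ico (0 : ℝ) 1) where
  toFun x := ⟨eval a x, by
    have := eval_mem a (x := x) (by rw [length_eObj]; exact x.2)
    rwa [length_eObj] at this⟩
  invFun x := ⟨eval (Groupoid.inv a) x, by
    have := eval_mem (Groupoid.inv a) (x := x) (by rw [length_eObj]; exact x.2)
    rwa [length_eObj] at this⟩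
  left_inv x := Subtype.ext (eval_inv_eval a (by rw [length_eObj]; exact x.2))
  right_inv x := Subtype.ext (eval_eval_inv a (by rw [length_eObj]; exact x.2))

/-- The action of the annular diagram group on `[0, 1)`; products of diagrams are read from the
outside to the inside, those of permutations from right to left. -/
noncomputable def circleAction : EFGroup →* Equiv.Perm (Set.Ico (0 : ℝ) 1) where
  toFun a := circlePerm (Groupoid.inv (show eObj ⟶ eObj from a))
  map_one' := by
    ext x
    change eval (𝟙 eObj) x = x
    exact eval_id (by rw [length_eObj]; exact x.2)
  map_mul' a b := by
    ext x
    change eval (Groupoid.inv ((show eObj ⟶ eObj from a) ≫ (show eObj ⟶ eObj from b))) x =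
      eval (Groupoid.inv (show eObj ⟶ eObj from a))
        (eval (Groupoid.inv (show eObj ⟶ eObj from b)) x)
    rw [inv_comp_distrib, eval_comp _ _ (by rw [length_eObj]; exact x.2)]

theorem circleAction_inv (a : eObj ⟶ eObj) : circleAction (toGroup a)⁻¹ = circlePerm a := by
  change circlePerm (Groupoid.inv (Groupoid.inv a)) = _
  simp

/-- The kernel is trivial by the faithfulness of the action of loops at `e`, `eq_id_of_eval_eq`. -/
theorem circleAction_injective : Function.Injective circleAction := by
  rw [injective_iff_map_eq_one]
  intro a ha
  have h : circlePerm (show eObj ⟶ eObj from a) = 1 := by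
    rw [← circleAction_inv]
    change circleAction a⁻¹ = 1
    rw [map_inv, ha, inv_one]
  refine eq_id_of_eval_eq (a := a) fun x hx => ?_
  exact congrArg Subtype.val (Equiv.congr_fun h ⟨x, hx⟩)

/-! ### Trees and annular diagrams -/

/-- The letter recording the type of a vertex. -/
def letter (w : List Bool) : EF := if typeFrom false w then EF.f else EF.e

theorem letter_eq_iff {u v : List Bool} :
    letter u = letter v ↔ typeFrom false u = typeFrom false v := by
  unfold letter
  cases typeFrom false u <;> cases typeFrom false v <;> simp

theorem letter_append_false (w : List Bool) : letter (w ++ [false]) = EF.f := by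
  simp [letter, typeFrom_append, typeFrom_cons, typeFrom_nil]

theorem letter_append_true_of_e {w : List Bool} (h : letter w = EF.e) :
    letter (w ++ [true]) = EF.f := by
  revert h
  cases h : typeFrom false w <;> simp [letter, typeFrom_append, typeFrom_cons, typeFrom_nil, h]

theorem letter_append_true_of_f {w : List Bool} (h : letter w = EF.f) :
    letter (w ++ [true]) = EF.e := by
  revert h
  cases h : typeFrom false w <;> simp [letter, typeFrom_append, typeFrom_cons, typeFrom_nil, h]

/-- The bridge between types and diagrams: splitting any vertex of a tree is a cell of the
presentation. -/
theorem rel_letter (w : List Bool) :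
    efPresentation.rel [letter w] [letter (w ++ [false]), letter (w ++ [true])] := by
  rw [letter_append_false]
  cases h : letter w
  · rw [letter_append_true_of_e h]; exact rel_e
  · rw [letter_append_true_of_f h]; exact rel_f

/-- `b` maps the intervals of the leaves of `t` affinely to the successive unit intervals. -/
structure IsTreeMap (t : BinTree) {u : EFObj} (b : eObj ⟶ u) : Prop where
  word_eq : u.word = t.leaves.map letter
  eval_eq : ∀ (A B : List (List Bool)) (w : List Bool), t.leaves = A ++ w :: B →
    ∀ s : ℝ, 0 ≤ s → s < 1 → eval b (binVal w + s / 2 ^ w.length) = A.length + s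

theorem coord_mem {w : List Bool} {s : ℝ} (h0 : 0 ≤ s) (h1 : s < 1) :
    binVal w + s / 2 ^ w.length ∈ Set.Ico (0 : ℝ) (word eObj).length := by
  rw [length_eObj]
  exact (inInterval_of_coord h0 h1).mem_Ico

namespace IsTreeMap

theorem leaf : IsTreeMap .leaf (𝟙 eObj) where
  word_eq := rfl
  eval_eq A B w h s h0 h1 := by
    rw [eval_id (coord_mem h0 h1)]
    rcases A with _ | ⟨a, A⟩
    · simp [BinTree.leaves] at h
      obtain ⟨rfl, rfl⟩ := h
      simp [binVal]
    · simp [BinTree.leaves] at h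

/-- A cell that stretches one unit interval to length two matches halving the dyadic interval of the
corresponding leaf. The case analysis locates `w'` before, at or after the new caret. -/
theorem split {t t' : BinTree} {u v : EFObj} {b : eObj ⟶ u} (hb : IsTreeMap t b)
    {A B : List (List Bool)} {w : List Bool} (ht : t.leaves = A ++ w :: B)
    (ht' : t'.leaves = A ++ (w ++ [false]) :: (w ++ [true]) :: B) {c : u ⟶ v}
    (hv : v.word = t'.leaves.map letter)
    (hc : ∀ x ∈ Set.Ico (0 : ℝ) u.word.length, eval c x = cellFun A.length 1 2 x) :
    IsTreeMap t' (b ≫ c) where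
  word_eq := hv
  eval_eq A' B' w' h s h0 h1 := by
    rw [eval_comp _ _ (coord_mem h0 h1), hc _ (eval_mem b (coord_mem h0 h1))]
    rw [ht'] at h
    rcases List.append_eq_append_iff.mp h with ⟨C, rfl, hC⟩ | ⟨C, rfl, hC⟩
    · rcases C with _ | ⟨x, _ | ⟨y, C⟩⟩
      · simp only [List.nil_append, List.cons.injEq] at hC
        obtain ⟨rfl, rfl⟩ := hC
        have e : binVal (w ++ [false]) + s / 2 ^ (w ++ [false]).length =
            binVal w + (s / 2) / 2 ^ w.length := by
          simp [binVal_append, binVal, pow_succ]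
          field_simp
        rw [e, hb.eval_eq A B w ht _ (by linarith) (by linarith),
          cellFun_of_mem (by linarith) (by linarith)]
        simp only [List.append_nil]
        ring
      · simp only [List.cons_append, List.nil_append, List.cons.injEq] at hC
        obtain ⟨rfl, rfl, rfl⟩ := hC
        have e : binVal (w ++ [true]) + s / 2 ^ (w ++ [true]).length =
            binVal w + ((1 + s) / 2) / 2 ^ w.length := by
          simp [binVal_append, binVal, pow_succ]
          field_simp
          ring
        rw [e, hb.eval_eq A B w ht _ (by linarith) (by linarith),
          cellFun_of_mem (by linarith) (by linarith)]
        simp only [List.length_append, List.length_cons, List.length_nil]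
        push_cast
        ring
      · simp only [List.cons_append, List.cons.injEq] at hC
        obtain ⟨rfl, rfl, rfl⟩ := hC
        rw [hb.eval_eq (A ++ w :: C) B' w' (by simp [ht]) s h0 h1, cellFun_of_ge zero_le_one]
        · simp only [List.length_append, List.length_cons]
          push_cast
          ring
        · simp only [List.length_append, List.length_cons]
          push_cast
          have : (0 : ℝ) ≤ C.length := by positivity
          linarith
    · rcases C with _ | ⟨x, C⟩
      · simp only [List.nil_append, List.cons.injEq] at hC
        obtain ⟨rfl, rfl⟩ := hC
        simp only [List.append_nil] at *
        have e : binVal (w ++ [false]) + s / 2 ^ (w ++ [false]).length =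
            binVal w + (s / 2) / 2 ^ w.length := by
          simp [binVal_append, binVal, pow_succ]
          field_simp
        rw [e, hb.eval_eq A' B w ht _ (by linarith) (by linarith),
          cellFun_of_mem (by linarith) (by linarith)]
        ring
      · simp only [List.cons_append, List.cons.injEq] at hC
        obtain ⟨rfl, rfl⟩ := hC
        rw [hb.eval_eq A' (C ++ w :: B) w' (by simp [ht]) s h0 h1, cellFun_of_lt]
        simp only [List.length_append, List.length_cons]
        push_cast
        have : (0 : ℝ) ≤ C.length := by positivity
        linarith

theorem eval_getElem {t : BinTree} {u : EFObj} {b : eObj ⟶ u} (hb : IsTreeMap t b) {i : ℕ}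
    (hi : i < t.leaves.length) {s : ℝ} (h0 : 0 ≤ s) (h1 : s < 1) :
    eval b (binVal t.leaves[i] + s / 2 ^ t.leaves[i].length) = i + s := by
  have e := hb.eval_eq (t.leaves.take i) (t.leaves.drop (i + 1)) t.leaves[i] (by simp) s h0 h1
  rw [e, List.length_take, min_eq_left hi.le]

theorem length_eq {t : BinTree} {u : EFObj} {b : eObj ⟶ u} (hb : IsTreeMap t b) :
    u.word.length = t.leaves.length := by
  rw [hb.word_eq, List.length_map]

end IsTreeMap

theorem BinTree.exists_caret (t : BinTree) (ht : t ≠ leaf) :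
    ∃ (t' : BinTree) (A B : List (List Bool)) (w : List Bool), t'.leaves = A ++ w :: B ∧
      t.leaves = A ++ (w ++ [false]) :: (w ++ [true]) :: B := by
  induction t with
  | leaf => exact absurd rfl ht
  | node l r ihl ihr =>
    by_cases hl : l = leaf
    · by_cases hr : r = leaf
      · subst hl hr
        exact ⟨leaf, [], [], [], rfl, rfl⟩
      · obtain ⟨t', A, B, w, h1, h2⟩ := ihr hr
        exact ⟨node l t', l.leaves.map (List.cons false) ++ A.map (List.cons true),
          B.map (List.cons true), true :: w, by simp [leaves, h1], by simp [leaves, h2]⟩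
    · obtain ⟨t', A, B, w, h1, h2⟩ := ihl hl
      exact ⟨node t' r, A.map (List.cons false),
        B.map (List.cons false) ++ r.leaves.map (List.cons true), false :: w,
        by simp [leaves, h1], by simp [leaves, h2]⟩

theorem exists_isTreeMap (t : BinTree) :
    ∃ b : eObj ⟶ ofWord (t.leaves.map letter), IsTreeMap t b := by
  induction hn : t.leaves.length using Nat.strong_induction_on generalizing t with
  | _ n ih =>
    by_cases ht : t = .leaf
    · subst ht
      exact ⟨𝟙 eObj, IsTreeMap.leaf⟩
    · obtain ⟨t', A, B, w, h1, h2⟩ := t.exists_caret ht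
      obtain ⟨b, hb⟩ := ih _ (by rw [← hn, h1, h2]; simp) t' rfl
      refine ⟨b ≫ cell (A.map letter) [letter w] [letter (w ++ [false]), letter (w ++ [true])]
        (B.map letter) (.inl (rel_letter w)) (by simp [word, h1]) (by simp [word, h2]),
        hb.split h1 h2 rfl fun x hx => ?_⟩
      rw [eval_cell _ _ _ _ _ _ _ hx]
      simp

theorem eval_splitE {u v : EFObj} {p q : List EF} (hu : u.word = p ++ [EF.e] ++ q)
    (hv : v.word = p ++ [EF.f, EF.f] ++ q) {x : ℝ} (hx : x ∈ Set.Ico (0 : ℝ) u.word.length) :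
    eval (splitE p q hu hv : u ⟶ v) x = cellFun p.length 1 2 x := by
  rw [splitE, eval_cell _ _ _ _ _ _ _ hx]
  simp

theorem isTreeMap_baseCell : IsTreeMap (.node .leaf .leaf) baseCell := by
  have h := IsTreeMap.leaf.split (t' := .node .leaf .leaf) (A := []) (B := []) (w := []) rfl rfl
    (c := baseCell) rfl (fun x hx => eval_splitE _ _ hx)
  rwa [Category.id_comp] at h

/-- Replacing `f` by `fff` adds two carets: one at the leaf, of type `f`, and one at its right
child, of type `e`. -/
theorem IsTreeMap.comp_lam {t : BinTree} {m i : ℕ} {b : eObj ⟶ fObj m} (hb : IsTreeMap t b)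
    (hi : i < 2 * m + 2) : ∃ t' : BinTree, IsTreeMap t' (b ≫ lam m i hi) := by
  have hlen : t.leaves.length = 2 * m + 2 := by rw [← hb.length_eq]; simp [word_fObj]
  have hw := hb.word_eq
  rw [word_fObj] at hw
  obtain ⟨A, w, B, ht, rfl⟩ : ∃ A w B, t.leaves = A ++ w :: B ∧ A.length = i :=
    ⟨t.leaves.take i, t.leaves[i], t.leaves.drop (i + 1), by simp, by simp; omega⟩
  rw [ht, List.map_append, List.map_cons] at hw
  obtain ⟨hA, hw', -⟩ := eq_fPow_of_append hw
  have hwf : letter w = EF.f := by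
    have : letter w ∈ fPow (2 * m + 2) := by rw [hw]; simp
    exact List.eq_of_mem_replicate this
  rw [hwf] at hw
  obtain ⟨-, hB, -⟩ := eq_fPow_of_append_f (p := A.map letter) (q := B.map letter)
    (by rw [hw]; simp)
  rw [List.length_map] at hA hB
  obtain ⟨t₁, ht₁⟩ := BinTree.exists_split ht
  obtain ⟨t₂, ht₂⟩ := BinTree.exists_split (t := t₁) (A := A ++ [w ++ [false]]) (B := B)
    (u := w ++ [true]) (by simp [ht₁])
  refine ⟨t₂, ?_⟩
  have hwt := letter_append_true_of_f hwf
  rw [lam, tri, ← Category.assoc]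
  refine IsTreeMap.split (t := t₁) (hb.split ht ht₁ ?_ fun x hx => ?_)
    (A := A ++ [w ++ [false]]) (B := B) (w := w ++ [true]) (by simp [ht₁]) ht₂ ?_
    fun x hx => ?_
  · rw [ht₁]
    simp [word, hA, hB, hwt, letter_append_false]
  · rw [splitF, eval_cell _ _ _ _ _ _ _ hx]
    simp
  · rw [ht₂, word_fObj]
    simp only [List.map_append, List.map_cons, List.map_nil, hA, hB, letter_append_false,
      letter_append_true_of_e hwt]
    rw [List.append_assoc]
    exact (fPow_split_fff hi).trans (by simp)
  · rw [eval_splitE _ _ hx]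
    simp

theorem IsTreeMap.comp_positive {m k : ℕ} {a : fObj m ⟶ fObj k} {l : List ℕ}
    (ha : Positive a l) : ∀ {t : BinTree} {b : eObj ⟶ fObj m}, IsTreeMap t b →
      ∃ t' : BinTree, IsTreeMap t' (b ≫ a) := by
  induction ha with
  | nil => exact fun {t b} hb => ⟨t, by rwa [Category.comp_id]⟩
  | cons h _ ih =>
    intro t b hb
    obtain ⟨t', ht'⟩ := hb.comp_lam h
    rw [← Category.assoc]
    exact ih ht'

/-- The tree maps send the `i`-th leaf to the `i`-th unit interval, and the rotation moves that
interval to position `i + |q|` modulo the total length. -/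
theorem mapsTo_circlePerm {R S : BinTree} {u v : EFObj} {b : eObj ⟶ u} {c : eObj ⟶ v}
    (hb : IsTreeMap R b) (hc : IsTreeMap S c) {p q : List EF} (hu : u.word = p ++ q)
    (hv : v.word = q ++ p) {x y : List Bool}
    (hxy : (x, y) ∈ R.leaves.zip (S.leaves.rotate q.length)) :
    MapsTo (circlePerm (b ≫ rot p q hu hv ≫ Groupoid.inv c)) x y := by
  obtain ⟨i, hi, h⟩ := List.mem_iff_getElem.mp hxy
  have hlu := hb.length_eq
  have hlv := hc.length_eq
  rw [hu, List.length_append] at hlu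
  rw [hv, List.length_append] at hlv
  have hi' : i < R.leaves.length := by
    rw [List.length_zip] at hi; omega
  simp only [List.getElem_zip, Prod.mk.injEq, List.getElem_rotate] at h
  obtain ⟨rfl, rfl⟩ := h
  refine MapsTo.of_coord fun s h0 h1 => ?_
  change eval (b ≫ rot p q hu hv ≫ Groupoid.inv c) _ = _
  have hj : (i + q.length) % S.leaves.length < S.leaves.length :=
    Nat.mod_lt _ (by omega)
  have e := hc.eval_getElem hj h0 h1
  have hm := eval_mem b (coord_mem (w := R.leaves[i]) h0 h1)
  rw [eval_comp _ _ (coord_mem h0 h1), eval_comp _ _ hm, eval_rot _ _ _ _ hm,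
    hb.eval_getElem hi' h0 h1]
  rw [← eval_inv_eval c (coord_mem (w := S.leaves[(i + q.length) % S.leaves.length]) h0 h1), e]
  congr 1
  rcases lt_or_ge i p.length with h | h
  · have hr : (i : ℝ) + 1 ≤ p.length := by exact_mod_cast h
    rw [rotFun_of_lt (by linarith), Nat.mod_eq_of_lt (by omega)]
    push_cast
    ring
  · have hr : (p.length : ℝ) ≤ i := by exact_mod_cast h
    rw [rotFun_of_ge (by linarith)]
    have : (i + q.length) % S.leaves.length = i - p.length := by
      rw [Nat.mod_eq_sub_mod (by omega), Nat.mod_eq_of_lt (by omega)]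
      omega
    rw [this, Nat.cast_sub h]
    ring

/-- Equality of types says that the two words of leaf types are rotations of each other, so a
rotation can join the diagrams of the two trees. -/
theorem TreeDiagram.TypesAgree.exists_represents {d : TreeDiagram} (h : d.TypesAgree) :
    ∃ a : eObj ⟶ eObj, d.Represents (circlePerm a) := by
  obtain ⟨b, hb⟩ := exists_isTreeMap d.input
  obtain ⟨c, hc⟩ := exists_isTreeMap d.output
  have hk : d.shift ≤ (d.output.leaves.map letter).length := by
    rw [List.length_map, d.length_eq]; exact d.shift_lt.le
  have hq : ((d.output.leaves.map letter).take d.shift).length = d.shift := by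
    rw [List.length_take, min_eq_left hk]
  have hw : d.input.leaves.map letter = (d.output.leaves.map letter).rotate d.shift := by
    rw [← List.map_rotate]
    have h' := typesAgree_iff_map_eq.mp h
    rw [← List.map_rotate] at h'
    have e : letter = (fun y : Bool => if y then EF.f else EF.e) ∘ typeFrom false := by
      funext w; simp [letter]
    rw [e, ← List.map_map, ← List.map_map, h']
  rw [List.rotate_eq_drop_append_take hk] at hw
  refine ⟨b ≫ rot _ _ hw (List.take_append_drop d.shift _).symm ≫ Groupoid.inv c, fun u v huv => ?_⟩
  refine mapsTo_circlePerm hb hc _ _ ?_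
  rwa [hq, ← d.matched_iff]

theorem exists_typesAgree_represents (a : eObj ⟶ eObj) :
    ∃ d : TreeDiagram, d.TypesAgree ∧ d.Represents (circlePerm a) := by
  obtain ⟨t, ht, rfl⟩ := exists_generated_of_loop a
  obtain ⟨n, b, c, l, l', r, hr, hb, hc, rfl⟩ := ht.hasNormalForm
  obtain ⟨R, hR⟩ := isTreeMap_baseCell.comp_positive hb
  obtain ⟨S, hS⟩ := isTreeMap_baseCell.comp_positive hc
  have hl : S.leaves.length = R.leaves.length := by rw [← hR.length_eq, ← hS.length_eq]
  -- Both trees have only leaves of type `f`, so the types agree under any identification. The shift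
  -- is the length of the segment that the rotation brings to the front.
  refine ⟨.ofRotate R S (fPow (2 * n + 2 - r)).length hl, fun u v huv => ?_, fun u v huv => ?_⟩
  · rw [TreeDiagram.matched_ofRotate] at huv
    have hu : letter u ∈ fPow (2 * n + 2) := by
      rw [← word_fObj, hR.word_eq]; exact List.mem_map_of_mem (List.of_mem_zip huv).1
    have hv : letter v ∈ fPow (2 * n + 2) := by
      rw [← word_fObj, hS.word_eq]
      exact List.mem_map_of_mem (List.mem_rotate.mp (List.of_mem_zip huv).2)
    rw [← letter_eq_iff, List.eq_of_mem_replicate hu, List.eq_of_mem_replicate hv]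
  · rw [TreeDiagram.matched_ofRotate] at huv
    have h := mapsTo_circlePerm hR hS (p := fPow r) (q := fPow (2 * n + 2 - r)) (word_fObj_eq_append hr)
      (word_fObj_eq_append' hr) huv
    have e : baseCell ≫ (b ≫ fRot n r hr ≫ Groupoid.inv c) ≫ Groupoid.inv baseCell =
        (baseCell ≫ b) ≫ fRot n r hr ≫ Groupoid.inv (baseCell ≫ c) := by
      rw [inv_comp_distrib]
      simp only [Category.assoc]
    rw [e]
    exact h

/-! ### The subgroup of elements with bipartite Thompson graph -/

theorem TreeDiagram.Represents.mem_thompsonT {d : TreeDiagram}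
    {f : Equiv.Perm (Set.Ico (0 : ℝ) 1)} (h : d.Represents f) : f ∈ ThompsonT :=
  Subgroup.subset_closure ⟨d, h⟩

theorem circleAction_mem_thompsonT (a : EFGroup) : circleAction a ∈ ThompsonT := by
  obtain ⟨d, -, hd⟩ := exists_typesAgree_represents (Groupoid.inv (show eObj ⟶ eObj from a))
  exact hd.mem_thompsonT

/-- The annular diagram group as a subgroup of Thompson's group `T`. -/
noncomputable def toThompson : EFGroup →* ThompsonT :=
  circleAction.codRestrict ThompsonT circleAction_mem_thompsonT

theorem toThompson_injective : Function.Injective toThompson := fun _ _ h =>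
  circleAction_injective (congrArg Subtype.val h)

theorem coe_range_toThompson : (toThompson.range : Set ThompsonT) = jonesSet := by
  ext g
  rw [mem_jonesSet_iff]
  constructor
  · rintro ⟨a, rfl⟩
    exact exists_typesAgree_represents (Groupoid.inv (show eObj ⟶ eObj from a))
  · rintro ⟨d, ht, hd⟩
    obtain ⟨a, ha⟩ := ht.exists_represents
    refine ⟨(toGroup a)⁻¹, Subtype.ext ?_⟩
    change circleAction (toGroup a)⁻¹ = g
    rw [circleAction_inv]
    exact ha.eq hd

theorem fg_range_toThompson : toThompson.range.FG := by
  have := fg_EFGroup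
  rw [← Group.fg_iff_subgroup_fg]
  infer_instance

/-! ### Many elements of the subgroup -/

/-- The path to `w` is grown into a full tree; each side branch of type `e` is closed by one caret,
each of type `f` is left as a leaf. -/
theorem BinTree.exists_leaf_of_typeFrom (w : List Bool) : ∀ x : Bool, typeFrom x w = true →
    ∃ t : BinTree, (∀ v ∈ t.leaves, typeFrom x v = true) ∧ w ∈ t.leaves := by
  have hE : ∀ x : Bool, ∃ t : BinTree, ∀ v ∈ t.leaves, typeFrom x v = true := by
    intro x
    cases x
    · exact ⟨node leaf leaf, by simp [leaves, typeFrom]⟩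
    · exact ⟨leaf, by simp [leaves, typeFrom]⟩
  induction w with
  | nil => exact fun x hx => ⟨leaf, by simpa [leaves] using hx, by simp [leaves]⟩
  | cons b w ih =>
    intro x hx
    rw [typeFrom_cons] at hx
    obtain ⟨t, h1, h2⟩ := ih _ hx
    cases b
    · obtain ⟨r, hr⟩ := hE (!x)
      refine ⟨node t r, fun v hv => ?_, by simp [leaves, h2]⟩
      simp only [leaves, List.mem_append, List.mem_map] at hv
      rcases hv with ⟨a, ha, rfl⟩ | ⟨a, ha, rfl⟩
      · exact h1 a ha
      · exact hr a ha
    · obtain ⟨l, hl⟩ := hE true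
      refine ⟨node l t, fun v hv => ?_, by simp [leaves, h2]⟩
      simp only [leaves, List.mem_append, List.mem_map] at hv
      rcases hv with ⟨a, ha, rfl⟩ | ⟨a, ha, rfl⟩
      · exact hl a ha
      · exact h1 a ha

/-- The assignment `e ↦ 0`, `f ↦ 1` modulo 2 respects both relations. -/
theorem BinTree.length_leaves_mod_two (t : BinTree) : ∀ x : Bool,
    (∀ v ∈ t.leaves, typeFrom x v = true) → t.leaves.length % 2 = x.toNat := by
  induction t with
  | leaf =>
    intro x h
    have : x = true := h [] (by simp [leaves])
    subst this
    rfl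
  | node l r ihl ihr =>
    intro x h
    have hl := ihl true fun v hv => h (false :: v) (by simp [leaves, hv])
    have hr := ihr (!x) fun v hv => h (true :: v) (by simp [leaves, hv])
    simp only [leaves, List.length_append, List.length_map]
    rw [Nat.add_mod, hl, hr]
    cases x <;> rfl

theorem BinTree.exists_comb (m : ℕ) : ∃ t : BinTree, (∀ v ∈ t.leaves, typeFrom true v = true) ∧
    t.leaves.length = 2 * m + 1 := by
  induction m with
  | zero => exact ⟨leaf, by simp [leaves, typeFrom], rfl⟩
  | succ m ih =>
    obtain ⟨t, h1, h2⟩ := ih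
    refine ⟨node leaf (node leaf t), fun v hv => ?_, ?_⟩
    · simp only [leaves, List.map_cons, List.map_nil, List.map_append, List.mem_append,
        List.mem_singleton, List.mem_map] at hv
      rcases hv with rfl | rfl | ⟨_, ⟨a, ha, rfl⟩, rfl⟩
      · rfl
      · rfl
      · exact h1 a ha
    · simp [leaves, h2]
      ring

/-- A tree with all leaves of type `f` that contains `u0` has an even number of leaves. It is
therefore paired with a tree of the same size, again with only leaves of type `f`, whose first leaf
is `0`. -/
theorem exists_mapsTo_false (u : List Bool) :
    ∃ g ∈ toThompson.range, MapsTo (g : ThompsonT) (u ++ [false]) [false] := by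
  obtain ⟨R, hR, hu⟩ := BinTree.exists_leaf_of_typeFrom (u ++ [false]) false (by
    rw [typeFrom_append]; rfl)
  have h2 := R.length_leaves_mod_two false hR
  have h0 := List.length_pos_iff.mpr R.leaves_ne_nil
  simp only [Bool.toNat_false] at h2
  obtain ⟨t, ht, htl⟩ := BinTree.exists_comb (R.leaves.length / 2 - 1)
  obtain ⟨i, hi, hiu⟩ := List.mem_iff_getElem.mp hu
  have hl : (BinTree.node .leaf t).leaves.length = R.leaves.length := by
    simp [BinTree.leaves, htl]
    omega
  have hS : ∀ v ∈ (BinTree.node .leaf t).leaves, typeFrom false v = true := by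
    intro v hv
    simp only [BinTree.leaves, List.map_cons, List.map_nil, List.mem_append, List.mem_singleton,
      List.mem_map] at hv
    rcases hv with rfl | ⟨a, ha, rfl⟩
    · rfl
    · exact ht a ha
  -- The shift carries position `i`, that of the leaf `u0`, to position 0.
  have hagree : (TreeDiagram.ofRotate R _ (R.leaves.length - i) hl).TypesAgree := fun a b hab =>
    (hR a hab.mem_input).trans (hS b hab.mem_output).symm
  obtain ⟨a, ha⟩ := hagree.exists_represents
  have hg : (⟨circlePerm a, ha.mem_thompsonT⟩ : ThompsonT) ∈ jonesSet :=
    mem_jonesSet_iff.mpr ⟨_, hagree, ha⟩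
  refine ⟨⟨circlePerm a, ha.mem_thompsonT⟩,
    by rw [← SetLike.mem_coe, coe_range_toThompson]; exact hg, ha _ _ ?_⟩
  rw [TreeDiagram.matched_ofRotate, List.mem_iff_getElem]
  refine ⟨i, by simp only [List.length_zip, List.length_rotate]; omega, ?_⟩
  simp only [List.getElem_zip, List.getElem_rotate, hiu, hl, Nat.add_sub_cancel' hi.le,
    Nat.mod_self]
  rfl

/-! ### Reading words in deterministic graphs -/

namespace LabeledDigraph

variable {V : Type*}

open Classical in
/-- Reading one more letter: the state is the vertex reached, followed by the unread word once
there is no suitable edge. -/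
noncomputable def readStep (K : LabeledDigraph V) (s : V × List Bool) (b : Bool) :
    V × List Bool :=
  if h : s.2 = [] ∧ ∃ y, K.edge b s.1 y then (h.2.choose, []) else (s.1, s.2 ++ [b])

/-- The state after reading a word. -/
noncomputable def read (K : LabeledDigraph V) (x : V) (w : List Bool) : V × List Bool :=
  w.foldl K.readStep (x, [])

variable {K : LabeledDigraph V} {x : V}

theorem read_nil : K.read x [] = (x, []) := rfl

theorem read_append_singleton (w : List Bool) (b : Bool) :
    K.read x (w ++ [b]) = K.readStep (K.read x w) b := by
  simp [read]

/-- Every vertex has at most one outgoing edge for every label. -/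
def IsDeterministic (K : LabeledDigraph V) : Prop :=
  ∀ b x y y', K.edge b x y → K.edge b x y' → y = y'

theorem readStep_of_edge (hK : K.IsDeterministic) {b : Bool} {y z : V} (h : K.edge b y z) :
    K.readStep (y, []) b = (z, []) := by
  have h' : (y, ([] : List Bool)).2 = [] ∧ ∃ z, K.edge b (y, ([] : List Bool)).1 z := ⟨rfl, z, h⟩
  rw [readStep, dif_pos h', hK _ _ _ _ h'.2.choose_spec h]

theorem readStep_cases (K : LabeledDigraph V) (s : V × List Bool) (b : Bool) :
    (∃ y z, s = (y, []) ∧ K.edge b y z ∧ K.readStep s b = (z, [])) ∨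
      K.readStep s b = (s.1, s.2 ++ [b]) := by
  by_cases h : s.2 = [] ∧ ∃ y, K.edge b s.1 y
  · refine .inl ⟨s.1, h.2.choose, Prod.ext rfl h.1, h.2.choose_spec, ?_⟩
    rw [readStep, dif_pos h]
  · exact .inr (by rw [readStep, dif_neg h])

/-- Keeping the unread suffix in the state makes this true for words that leave the graph as well:
then the last letter can be stripped off. If both steps follow edges, the hypothesis on common
children applies. -/
theorem isTreeCongruence_read (x : V)
    (hK' : ∀ y y' l r, K.edge false y l → K.edge true y r → K.edge false y' l →
      K.edge true y' r → y = y') : IsTreeCongruence (K.read x) where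
  child h b := by rw [read_append_singleton, read_append_singleton, h]
  parent {u v} h0 h1 := by
    simp only [read_append_singleton] at h0 h1
    have key : ∀ b, K.readStep (K.read x u) b = K.readStep (K.read x v) b →
        K.read x u = K.read x v ∨ ∃ y y' z, K.read x u = (y, []) ∧ K.read x v = (y', []) ∧
          K.edge b y z ∧ K.edge b y' z := by
      intro b h
      rcases K.readStep_cases (K.read x u) b with ⟨y, z, e1, e2, e3⟩ | e3 <;>
      rcases K.readStep_cases (K.read x v) b with ⟨y', z', f1, f2, f3⟩ | f3
      · rw [e3, f3] at h
        obtain rfl : z = z' := congrArg Prod.fst h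
        exact .inr ⟨y, y', z, e1, f1, e2, f2⟩
      · rw [e3, f3] at h
        simp at h
      · rw [e3, f3] at h
        simp at h
      · rw [e3, f3] at h
        simp only [Prod.mk.injEq, List.append_cancel_right_eq] at h
        exact .inl (Prod.ext h.1 h.2)
    rcases key _ h0 with h | ⟨y, y', z, e1, e2, e3, e4⟩
    · exact h
    · rcases key _ h1 with h | ⟨w, w', z', f1, f2, f3, f4⟩
      · exact h
      · rw [e1] at f1
        rw [e2] at f2
        obtain rfl : y = w := congrArg Prod.fst f1
        obtain rfl : y' = w' := congrArg Prod.fst f2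
        rw [e1, e2, hK' y y' z z' e3 f3 e4 f4]

/-! ### Folded graphs -/

variable {G : LabeledDigraph V}

theorem foldRel_equivalence (G : LabeledDigraph V) : Equivalence G.FoldRel :=
  ⟨.refl, .symm, .trans⟩

theorem mk_eq_mk {x y : V} : Quot.mk G.FoldRel x = Quot.mk G.FoldRel y ↔ G.FoldRel x y :=
  G.foldRel_equivalence.quot_mk_eq_iff x y

theorem folded_isDeterministic (G : LabeledDigraph V) : G.folded.IsDeterministic := by
  rintro b _ _ _ ⟨x, y, rfl, rfl, h⟩ ⟨x', y', hx, rfl, h'⟩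
  exact mk_eq_mk.mpr (.child (mk_eq_mk.mp hx) h h')

theorem folded_root_eq {x y : Quot G.FoldRel} (hx : G.folded.root x) (hy : G.folded.root y) :
    x = y := by
  obtain ⟨x, rfl, hx⟩ := hx
  obtain ⟨y, rfl, hy⟩ := hy
  exact mk_eq_mk.mpr (.root hx hy)

/-- The two edges at a folded vertex may come from different representatives. Existence of siblings
and determinism supply both edges at one representative, as the folding rule needs. -/
theorem folded_parent (hG : ∀ b b' x y, G.edge b x y → ∃ y', G.edge b' x y')
    {y y' l r : Quot G.FoldRel} (h1 : G.folded.edge false y l) (h2 : G.folded.edge true y r)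
    (h3 : G.folded.edge false y' l) (h4 : G.folded.edge true y' r) : y = y' := by
  have hdet := G.folded_isDeterministic
  obtain ⟨x, xl, rfl, rfl, hl⟩ := h1
  obtain ⟨xr, hr⟩ := hG _ true _ _ hl
  obtain ⟨x', xl', rfl, hl'', hl'⟩ := h3
  obtain ⟨xr', hr'⟩ := hG _ true _ _ hl'
  have e1 : r = Quot.mk _ xr := hdet _ _ _ _ h2 ⟨x, xr, rfl, rfl, hr⟩
  have e2 : r = Quot.mk _ xr' := hdet _ _ _ _ h4 ⟨x', xr', rfl, rfl, hr'⟩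
  exact mk_eq_mk.mpr (.parent hl hr hl' hr' (mk_eq_mk.mp hl'') (mk_eq_mk.mp (e1.symm.trans e2)))

end LabeledDigraph

/-! ### Graphs of tree diagrams -/

namespace BinTree

theorem isVertex_nil (t : BinTree) : t.IsVertex [] := by
  obtain ⟨k, L, h⟩ := t.leaves_eq_cons
  exact ⟨List.replicate k false, by rw [h]; simp, List.nil_prefix⟩

theorem isVertex_node_cons (l r : BinTree) (b : Bool) (w : List Bool) :
    (node l r).IsVertex (b :: w) ↔ (if b then r else l).IsVertex w := by
  constructor
  · rintro ⟨u, hu, hw⟩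
    simp only [leaves, List.mem_append, List.mem_map] at hu
    rcases hu with ⟨a, ha, rfl⟩ | ⟨a, ha, rfl⟩ <;> rw [List.cons_prefix_cons] at hw <;>
      obtain ⟨rfl, hw⟩ := hw
    · exact ⟨a, ha, hw⟩
    · exact ⟨a, ha, hw⟩
  · rintro ⟨u, hu, hw⟩
    refine ⟨b :: u, ?_, by simpa using hw⟩
    cases b <;> simpa [leaves] using hu

theorem IsVertex.sibling {t : BinTree} {w : List Bool} {b : Bool} (h : t.IsVertex (w ++ [b]))
    (b' : Bool) : t.IsVertex (w ++ [b']) := by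
  induction t generalizing w with
  | leaf =>
    obtain ⟨u, hu, hw⟩ := h
    simp only [leaves, List.mem_singleton] at hu
    subst hu
    simp at hw
  | node l r ihl ihr =>
    rcases w with _ | ⟨c, w⟩
    · rw [List.nil_append, isVertex_node_cons]
      exact isVertex_nil _
    · rw [List.cons_append, isVertex_node_cons] at h ⊢
      cases c
      · exact ihl h
      · exact ihr h

theorem IsVertex.of_append {t : BinTree} {w v : List Bool} (h : t.IsVertex (w ++ v)) :
    t.IsVertex w := by
  obtain ⟨u, hu, hw⟩ := h
  exact ⟨u, hu, (List.prefix_append w v).trans hw⟩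

end BinTree

namespace TreeDiagram

variable {d : TreeDiagram}

theorem PreVertex.addr_induction {motive : d.PreVertex → Prop}
    (root : ∀ p, p.addr = [] → motive p)
    (step : ∀ (p q : d.PreVertex) (b : Bool), q.side = p.side → q.addr = p.addr ++ [b] →
      motive p → motive q) (p : d.PreVertex) : motive p := by
  obtain ⟨s, w, h⟩ := p
  induction w using List.reverseRecOn with
  | nil => exact root _ rfl
  | append_singleton w b ih =>
    exact step ⟨s, w, h.of_append⟩ _ b rfl rfl (ih h.of_append)

/-- The vertex of the graph of `d` given by a vertex of one of the trees. -/
def vertex (p : d.PreVertex) : d.Vertex := Quot.mk _ p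

theorem graph_edge {p q : d.PreVertex} {b : Bool} (hs : q.side = p.side)
    (ha : q.addr = p.addr ++ [b]) : d.graph.edge b (vertex p) (vertex q) :=
  ⟨p, q, rfl, rfl, hs, ha⟩

theorem graph_root {p : d.PreVertex} (ha : p.addr = []) : d.graph.root (vertex p) :=
  ⟨p, rfl, ha⟩

/-- A vertex of the input tree. -/
def inVertex (d : TreeDiagram) {w : List Bool} (h : d.input.IsVertex w) : d.PreVertex :=
  ⟨false, w, h⟩

/-- A vertex of the output tree. -/
def outVertex (d : TreeDiagram) {w : List Bool} (h : d.output.IsVertex w) : d.PreVertex :=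
  ⟨true, w, h⟩

theorem Matched.exists_vertex_eq {u v : List Bool} (h : d.Matched u v) :
    ∃ p q : d.PreVertex, p.addr = u ∧ q.addr = v ∧ vertex p = vertex q :=
  ⟨d.inVertex ⟨u, h.mem_input, List.prefix_rfl⟩, d.outVertex ⟨v, h.mem_output, List.prefix_rfl⟩,
    rfl, rfl, Quot.sound ⟨rfl, rfl, h⟩⟩

theorem graph_edge_sibling {b : Bool} (b' : Bool) {x y : d.Vertex} (h : d.graph.edge b x y) :
    ∃ y', d.graph.edge b' x y' := by
  obtain ⟨p, q, rfl, rfl, hs, ha⟩ := h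
  obtain ⟨s, w, hq⟩ := q
  simp only at hs ha
  subst hs ha
  exact ⟨vertex ⟨p.side, _, hq.sibling b'⟩, p, _, rfl, rfl, rfl, rfl⟩

end TreeDiagram

/-! ### The core -/

section Core

variable {Y : Set ThompsonT}

/-- The vertex of the core given by a vertex of a reduced diagram. -/
def coreVertex (d : reducedDiagrams Y) (x : d.1.Vertex) : Quot (generatorGraph Y).FoldRel :=
  Quot.mk _ ⟨d, x⟩

theorem core_edge {d : reducedDiagrams Y} {b : Bool} {x y : d.1.Vertex}
    (h : d.1.graph.edge b x y) : (stallingsCore Y).edge b (coreVertex d x) (coreVertex d y) :=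
  ⟨_, _, rfl, rfl, d, x, y, rfl, rfl, h⟩

theorem core_root {d : reducedDiagrams Y} {x : d.1.Vertex}
    (h : d.1.graph.root x) : (stallingsCore Y).root (coreVertex d x) :=
  ⟨_, rfl, h⟩

theorem generatorGraph_edge_sibling (b b' : Bool) (x y : Σ d : reducedDiagrams Y, d.1.Vertex)
    (h : (generatorGraph Y).edge b x y) : ∃ y', (generatorGraph Y).edge b' x y' := by
  obtain ⟨d, x, y, rfl, rfl, h⟩ := h
  obtain ⟨y', h'⟩ := TreeDiagram.graph_edge_sibling b' h
  exact ⟨⟨d, y'⟩, d, x, y', rfl, rfl, h'⟩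

theorem isTreeCongruence_read_core (x : Quot (generatorGraph Y).FoldRel) :
    IsTreeCongruence ((stallingsCore Y).read x) :=
  LabeledDigraph.isTreeCongruence_read x fun _ _ _ _ h1 h2 h3 h4 =>
    LabeledDigraph.folded_parent generatorGraph_edge_sibling h1 h2 h3 h4

/-- Consequently identified leaves of a generator, being one vertex of its diagram, are read to the
same state. -/
theorem read_core_addr {x : Quot (generatorGraph Y).FoldRel} (hx : (stallingsCore Y).root x)
    (d : reducedDiagrams Y) (p : d.1.PreVertex) :
    (stallingsCore Y).read x p.addr = (coreVertex d (TreeDiagram.vertex p), []) := by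
  induction p using TreeDiagram.PreVertex.addr_induction with
  | root p hp =>
    rw [hp, LabeledDigraph.read_nil]
    rw [LabeledDigraph.folded_root_eq hx (core_root (TreeDiagram.graph_root hp))]
  | step p q b hs ha ih =>
    rw [ha, LabeledDigraph.read_append_singleton, ih]
    exact LabeledDigraph.readStep_of_edge (LabeledDigraph.folded_isDeterministic _)
      (core_edge (TreeDiagram.graph_edge hs ha))

theorem mem_range_toThompson_iff {g : ThompsonT} : g ∈ toThompson.range ↔ g ∈ jonesSet := by
  rw [← SetLike.mem_coe, coe_range_toThompson]

theorem preservesClasses_read_core (hY : Subgroup.closure Y = toThompson.range)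
    {x : Quot (generatorGraph Y).FoldRel} (hx : (stallingsCore Y).root x) {g : ThompsonT}
    (hg : g ∈ toThompson.range) : PreservesClasses ((stallingsCore Y).read x) g := by
  have hgen : ∀ y ∈ Y, ∃ d : TreeDiagram, d.Represents y ∧
      ∀ u v, d.Matched u v → (stallingsCore Y).read x u = (stallingsCore Y).read x v := by
    intro y hy
    obtain ⟨d, hr, hd, -⟩ := mem_range_toThompson_iff.mp (hY ▸ Subgroup.subset_closure hy)
    refine ⟨d, hd, fun u v huv => ?_⟩
    obtain ⟨p, q, rfl, rfl, e⟩ := huv.exists_vertex_eq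
    have hp := read_core_addr hx ⟨d, hr, y, hy, hd⟩ p
    have hq := read_core_addr hx ⟨d, hr, y, hy, hd⟩ q
    rw [hp, hq, e]
  have hc := isTreeCongruence_read_core x
  rw [← hY] at hg
  -- This form of induction asks for inverses of generators only, and these come from exchanging
  -- input and output trees.
  induction hg using Subgroup.closure_induction'' with
  | mem y hy =>
    obtain ⟨d, hd, h⟩ := hgen y hy
    exact hd.preservesClasses hc h
  | inv_mem y hy =>
    obtain ⟨d, hd, h⟩ := hgen y hy
    exact hd.preservesClasses_inv hc h
  | one => exact .one
  | mul a b _ _ iha ihb => exact iha.mul hc ihb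

theorem nonempty_of_closure_eq (hY : Subgroup.closure Y = toThompson.range) : Y.Nonempty := by
  rw [Set.nonempty_iff_ne_empty]
  rintro rfl
  -- An element stretching the interval of `00` onto that of `0` is not the identity, so the
  -- subgroup is nontrivial.
  obtain ⟨g, hg, h⟩ := exists_mapsTo_false [false]
  rw [← hY, Subgroup.closure_empty, Subgroup.mem_bot] at hg
  subst hg
  have := MapsTo.unique h MapsTo.one
  simp at this

theorem exists_core_root (hY : Subgroup.closure Y = toThompson.range) :
    ∃ x, (stallingsCore Y).root x := by
  obtain ⟨y, hy⟩ := nonempty_of_closure_eq hY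
  obtain ⟨d, hr, hd, -⟩ := mem_range_toThompson_iff.mp (hY ▸ Subgroup.subset_closure hy)
  exact ⟨_, core_root (d := ⟨d, hr, y, hy, hd⟩)
    (TreeDiagram.graph_root (p := d.inVertex d.input.isVertex_nil) rfl)⟩

theorem exists_read_core (hY : Subgroup.closure Y = toThompson.range)
    {x : Quot (generatorGraph Y).FoldRel} (hx : (stallingsCore Y).root x) (u : List Bool) :
    ∃ y, (stallingsCore Y).read x u = (y, []) := by
  have hc := isTreeCongruence_read_core (Y := Y) x
  -- All words ending in 0 reach one state. Were that state stuck, reading another 0 would lengthen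
  -- its unread suffix; hence it is a vertex, and so is every earlier state.
  have hrich : ∀ u : List Bool, (stallingsCore Y).read x (u ++ [false]) =
      (stallingsCore Y).read x [false] := by
    intro u
    obtain ⟨g, hg, h⟩ := exists_mapsTo_false u
    exact (preservesClasses_read_core hY hx hg).eq_of_mapsTo hc h
  have hstep : ∀ w, ((stallingsCore Y).read x (w ++ [false])).2 = [] →
      ∃ y, (stallingsCore Y).read x w = (y, []) := by
    intro w h
    rw [LabeledDigraph.read_append_singleton] at h
    rcases (stallingsCore Y).readStep_cases ((stallingsCore Y).read x w) false with
      ⟨y, z, e1, -⟩ | e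
    · exact ⟨y, e1⟩
    · rw [e] at h
      simp at h
  have h0 : ((stallingsCore Y).read x [false]).2 = [] := by
    have h := hrich [false]
    rw [LabeledDigraph.read_append_singleton] at h
    rcases (stallingsCore Y).readStep_cases ((stallingsCore Y).read x [false]) false with
      ⟨y, z, e1, -⟩ | e
    · rw [e1]
    · rw [e] at h
      have := congrArg (fun s => s.2.length) h
      simp at this
  exact hstep u (by rw [hrich, h0])

/-- Elements of the subgroup are accepted by the core of a generating set. -/
theorem subset_coreAccepted (hY : Subgroup.closure Y = toThompson.range) :
    (toThompson.range : Set ThompsonT) ⊆ coreAccepted Y := by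
  intro g hg
  obtain ⟨x, hx⟩ := exists_core_root hY
  obtain ⟨d, hr, hd, -⟩ := mem_range_toThompson_iff.mp hg
  have hc := isTreeCongruence_read_core (Y := Y) x
  have hpres := preservesClasses_read_core hY hx hg
  -- The homomorphism reads addresses in the core; it is well defined on identified leaves because
  -- `g` preserves the states.
  refine ⟨d, hr, hd, Quot.lift (fun p => ((stallingsCore Y).read x p.addr).1) ?_, ?_, ?_⟩
  · rintro p q ⟨-, -, h⟩
    rw [hpres.eq_of_mapsTo hc (hd _ _ h)]
  · rintro b _ _ ⟨p, q, rfl, rfl, -, ha⟩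
    simp only
    obtain ⟨y, hy⟩ := exists_read_core hY hx p.addr
    obtain ⟨z, hz⟩ := exists_read_core hY hx q.addr
    rw [hy, hz]
    rw [ha, LabeledDigraph.read_append_singleton, hy] at hz
    rcases (stallingsCore Y).readStep_cases (y, []) b with ⟨y', z', e1, e2, e3⟩ | e
    · rw [e3] at hz
      obtain rfl : y = y' := congrArg Prod.fst e1
      obtain rfl : z' = z := congrArg Prod.fst hz
      exact e2
    · rw [e] at hz
      simp at hz
  · rintro _ ⟨p, rfl, ha⟩
    simp only
    rw [ha, LabeledDigraph.read_nil]
    exact hx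

/-- Agreement of types depends on the element and not on the diagram, since `typeFrom false` is
itself a tree congruence. -/
theorem typesAgree_of_represents {d : TreeDiagram} {g : ThompsonT} (hg : g ∈ toThompson.range)
    (hd : d.Represents g) : d.TypesAgree := by
  obtain ⟨d', ht', hd'⟩ := mem_jonesSet_iff.mp (mem_range_toThompson_iff.mp hg)
  exact fun u v huv => (hd'.preservesClasses isTreeCongruence_typeFrom ht').eq_of_mapsTo
    isTreeCongruence_typeFrom (hd u v huv)

/-- The core of a set of elements of the subgroup accepts only elements of the subgroup. -/
theorem coreAccepted_subset (hY : Subgroup.closure Y = toThompson.range) :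
    coreAccepted Y ⊆ toThompson.range := by
  rintro g ⟨d, hr, hd, φ, hφe, hφr⟩
  have hagree : ∀ c : reducedDiagrams Y, c.1.TypesAgree := by
    rintro ⟨c, -, y, hy, hc⟩
    exact typesAgree_of_represents (hY ▸ Subgroup.subset_closure hy) hc
  -- Types are well defined on the glued diagrams because the generators lie in the subgroup.
  let type : (Σ c : reducedDiagrams Y, c.1.Vertex) → Bool := fun x =>
    Quot.lift (fun p : x.1.1.PreVertex => typeFrom false p.addr)
      (fun p q h => hagree x.1 _ _ h.2.2) x.2
  have hedge : ∀ b x y, (generatorGraph Y).edge b x y →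
      type y = if b then !type x else true := by
    rintro b _ _ ⟨c, _, _, rfl, rfl, p, q, rfl, rfl, -, ha⟩
    change typeFrom false q.addr = if b then !typeFrom false p.addr else true
    rw [ha, typeFrom_append]
    rfl
  have hroot' : ∀ (c : reducedDiagrams Y) (x : c.1.Vertex), c.1.graph.root x →
      type ⟨c, x⟩ = false := by
    rintro c _ ⟨p, rfl, ha⟩
    change typeFrom false p.addr = false
    rw [ha]
    rfl
  have hroot : ∀ x, (generatorGraph Y).root x → type x = false := fun x hx => hroot' x.1 x.2 hx
  have hfold : ∀ x y, (generatorGraph Y).FoldRel x y → type x = type y := by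
    intro x y h
    induction h with
    | refl => rfl
    | symm _ ih => exact ih.symm
    | trans _ _ ih1 ih2 => exact ih1.trans ih2
    | root hx hy => rw [hroot _ hx, hroot _ hy]
    | child _ h1 h2 ih => rw [hedge _ _ _ h1, hedge _ _ _ h2, ih]
    -- Right children suffice, because the type of a right child is the negation of that of its
    -- parent.
    | parent _ h1 _ h2 _ _ _ ih =>
      rw [hedge _ _ _ h1, hedge _ _ _ h2] at ih
      simpa using ih
  let coreType : Quot (generatorGraph Y).FoldRel → Bool := Quot.lift type hfold
  have key : ∀ p : d.PreVertex, coreType (φ (TreeDiagram.vertex p)) = typeFrom false p.addr := by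
    intro p
    induction p using TreeDiagram.PreVertex.addr_induction with
    | root p hp =>
      obtain ⟨x, hx, hx'⟩ := hφr _ (TreeDiagram.graph_root hp)
      rw [hx, hp]
      exact hroot x hx'
    | step p q b hs ha ih =>
      obtain ⟨x, y, hx, hy, hxy⟩ := hφe b _ _ (TreeDiagram.graph_edge hs ha)
      rw [ha, typeFrom_append, ← ih, hx, hy]
      exact hedge _ _ _ hxy
  refine mem_range_toThompson_iff.mpr (mem_jonesSet_iff.mpr ⟨d, fun u v huv => ?_, hd⟩)
  obtain ⟨p, q, rfl, rfl, e⟩ := huv.exists_vertex_eq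
  rw [← key, ← key, e]

end Core

theorem mainTheorem8 :
    ∃ V : Subgroup ThompsonT, (V : Set ThompsonT) = jonesSet ∧ V.FG ∧
      (∀ Y : Finset ThompsonT, Subgroup.closure (Y : Set ThompsonT) = V →
        coreAccepted (Y : Set ThompsonT) = (V : Set ThompsonT)) ∧
      Nonempty (V ≃* AnnularDiagramGroup efPresentation [EF.e]) :=
  ⟨toThompson.range, coe_range_toThompson, fg_range_toThompson,
    fun _ hY => (coreAccepted_subset hY).antisymm (subset_coreAccepted hY),
    ⟨(MonoidHom.ofInjective toThompson_injective).symm⟩⟩
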